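/- Let $n\ge 1$ and let $\Sigma\subset\mathbf{R}^{n+1}$ be a (nonempty) smooth embedded hypersurface without boundary that is complete (for its intrinsic Riemannian distance) and is a self-shrinker, i.e. $H=\frac{\langle x,\mathbf{n}\rangle}{2}$ on $\Sigma$, where $\mathbf{n}$ is a local unit normal and $H=\operatorname{div}_\Sigma\mathbf{n}$. Suppose that $\Sigma$ has polynomial volume growth (there are constants $C,d$ with $\mathrm{Vol}(B_r(0)\cap\Sigma)\le C\,r^d$ for all $r\ge 1$) and does not split off a line isometrically (i.e. $\Sigma$ is not an orthogonal product $\Sigma_0\times\mathbf{R}v$ with $|v|=1$ and $\Sigma_0\subset v^\perp$). For $x_0\in\mathbf{R}^{n+1}$ and $t_0>0$ set $$F_{x_0,t_0}(\Sigma)=(4\pi t_0)^{-n/2}\int_\Sigma e^{-\frac{|x-x_0|^2}{4t_0}}\,d\mu ,\qquad \lambda=\lambda(\Sigma)=\sup_{x_0\in\mathbf{R}^{n+1},\,t_0>0}F_{x_0,t_0}(\Sigma),$$ where $\mu$ is the $n$-dimensional area measure of $\Sigma$. Then $\lambda=F_{0,1}(\Sigma)<\infty$, and $F_{x_0,t_0}(\Sigma)<F_{0,1}(\Sigma)$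 for all $(x_0,t_0)\ne(0,1)$ with $t_0>0$. Moreover, for every $\epsilon>0$ there exists $\delta>0$ such that $$\sup\{F_{x_0,t_0}(\Sigma)\;:\;x_0\in\mathbf{R}^{n+1},\ t_0>0,\ |x_0|+|\log t_0|>\epsilon\}<\lambda-\delta .$$ -/

import Mathlib

open scoped MeasureTheory ContDiff ENNReal

noncomputable section

namespace SelfShrinker

/-- The ambient Euclidean space `ℝⁿ⁺¹` of hypersurfaces of dimension `n`. -/
abbrev Ambient (n : ℕ) : Type := EuclideanSpace ℝ (Fin (n + 1))

variable {n : ℕ}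

/-- `f` is a smooth defining function of `S` on the open set `U`: its gradient does not vanish on
`U`, and `S ∩ U` is the zero set of `f` in `U`. -/
structure IsDefiningFunction (S U : Set (Ambient n)) (f : Ambient n → ℝ) : Prop where
  isOpen : IsOpen U
  smooth : ContDiffOn ℝ ∞ f U
  gradient_ne_zero : ∀ x ∈ U, gradient f x ≠ 0
  inter_eq : S ∩ U = {x ∈ U | f x = 0}

/-- `S` is a smooth embedded hypersurface of `ℝⁿ⁺¹` without boundary: around each of its points
it is a regular level set of a smooth function. -/
def IsEmbeddedHypersurface (S : Set (Ambient n)) : Prop :=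
  ∀ p ∈ S, ∃ (U : Set (Ambient n)) (f : Ambient n → ℝ), p ∈ U ∧ IsDefiningFunction S U f

/-- The unit normal field `∇f / |∇f|` of the level sets of `f`. -/
def unitNormal (f : Ambient n → ℝ) (x : Ambient n) : Ambient n :=
  ‖gradient f x‖⁻¹ • gradient f x

/-- The mean curvature at `x` of the level set of `f` through `x`, with respect to the normal
`N = ∇f / |∇f|`. It is the tangential divergence `H = div_S N`, that is, the trace of the
derivative of `N` over the tangent space (the orthogonal complement of `N x`). -/
def meanCurvature (f : Ambient n → ℝ) (x : Ambient n) : ℝ :=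
  LinearMap.trace ℝ (Ambient n) (fderiv ℝ (unitNormal f) x : Ambient n →ₗ[ℝ] Ambient n)
    - inner ℝ (fderiv ℝ (unitNormal f) x (unitNormal f x)) (unitNormal f x)

/-- The self-shrinker equation `H = ⟨x, N⟩ / 2` at every point of the hypersurface. Replacing `N`
by `-N` changes both sides by a sign, so the choice of the local unit normal is immaterial. -/
def SatisfiesShrinkerEquation (S : Set (Ambient n)) : Prop :=
  ∀ (U : Set (Ambient n)) (f : Ambient n → ℝ), IsDefiningFunction S U f →
    ∀ p ∈ S ∩ U, meanCurvature f p = inner ℝ p (unitNormal f p) / 2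

/-- `S` is a smooth embedded self-shrinker without boundary. -/
structure IsSelfShrinker (S : Set (Ambient n)) : Prop where
  isEmbeddedHypersurface : IsEmbeddedHypersurface S
  equation : SatisfiesShrinkerEquation S

/-- `γ` restricts to a `C¹` curve `[0,1] → S` from `p` to `q`. -/
structure IsCurveIn (S : Set (Ambient n)) (p q : Ambient n) (γ : ℝ → Ambient n) : Prop where
  contDiffOn : ContDiffOn ℝ 1 γ (Set.Icc 0 1)
  mapsTo : Set.MapsTo γ (Set.Icc 0 1) S
  source : γ 0 = p
  target : γ 1 = q

/-- The length of a curve on `[0,1]`. -/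
def curveLength (γ : ℝ → Ambient n) : ℝ≥0∞ :=
  ∫⁻ t in Set.Icc (0 : ℝ) 1, ‖derivWithin γ (Set.Icc 0 1) t‖ₑ

/-- The intrinsic (Riemannian) distance of `S`: the infimum of the lengths of curves in `S`.
It is `∞` for points in different components. -/
def intrinsicEDist (S : Set (Ambient n)) (p q : Ambient n) : ℝ≥0∞ :=
  ⨅ (γ : ℝ → Ambient n) (_ : IsCurveIn S p q γ), curveLength γ

/-- `S` is complete: every sequence in `S` that is Cauchy for the intrinsic distance converges in
`S` for the intrinsic distance. -/
def IsIntrinsicallyComplete (S : Set (Ambient n)) : Prop :=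
  ∀ u : ℕ → Ambient n, (∀ k, u k ∈ S) →
    (∀ ε : ℝ≥0∞, 0 < ε → ∃ N, ∀ k ≥ N, ∀ l ≥ N, intrinsicEDist S (u k) (u l) < ε) →
    ∃ p ∈ S, Filter.Tendsto (fun k => intrinsicEDist S (u k) p) Filter.atTop (nhds 0)

/-- The area measure of `S`: the `n`-dimensional Hausdorff measure on `S`, normalized to agree with
Lebesgue measure on `n`-dimensional Euclidean space. -/
def areaMeasure (S : Set (Ambient n)) : MeasureTheory.Measure (Ambient n) :=
  (μHE[n] : MeasureTheory.Measure (Ambient n)).restrict S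

/-- Polynomial volume growth: `Vol (B_r(0) ∩ S) ≤ C r ^ d` for all `r ≥ 1`. -/
def HasPolynomialVolumeGrowth (S : Set (Ambient n)) : Prop :=
  ∃ C d : ℝ, ∀ r : ℝ, 1 ≤ r → areaMeasure S (Metric.ball 0 r) ≤ ENNReal.ofReal (C * r ^ d)

/-- `S` splits off a line isometrically: it is the orthogonal product `S₀ × ℝ v` of a line and a
subset `S₀` of the orthogonal complement of that line. -/
def SplitsOffLine (S : Set (Ambient n)) : Prop :=
  ∃ (v : Ambient n) (S₀ : Set (Ambient n)), ‖v‖ = 1 ∧ (∀ y ∈ S₀, inner ℝ y v = 0) ∧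
    S = {x | ∃ y ∈ S₀, ∃ s : ℝ, x = y + s • v}

/-- The Gaussian functional
`F_{x₀,t₀}(S) = (4 π t₀)^{-n/2} ∫_S exp (-|x - x₀|² / (4 t₀)) dμ`, with values in `[0, ∞]`. -/
def gaussianF (S : Set (Ambient n)) (x₀ : Ambient n) (t₀ : ℝ) : ℝ≥0∞ :=
  ENNReal.ofReal ((4 * Real.pi * t₀) ^ (-(n : ℝ) / 2)) *
    ∫⁻ x, ENNReal.ofReal (Real.exp (-‖x - x₀‖ ^ 2 / (4 * t₀))) ∂(areaMeasure S)

/-- The entropy `λ(S)`: the supremum of `F_{x₀,t₀}(S)` over all `x₀` and all `t₀ > 0`. -/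
def entropy (S : Set (Ambient n)) : ℝ≥0∞ :=
  ⨆ (x₀ : Ambient n) (t₀ : ℝ) (_ : 0 < t₀), gaussianF S x₀ t₀

end SelfShrinker

end

open scoped MeasureTheory ContDiff ENNReal

noncomputable section

namespace SelfShrinker

open MeasureTheory Measure Filter Topology Set

/-! The proof moves `(x₀, t₀)` along the paths `s ↦ (s y, 1 + a s²)`, `0 ≤ s ≤ 1`, which start at
`(0, 1)` and, with `y = x₀` and `a = t₀ - 1`, end at any prescribed `(x₀, t₀)`. With `t = 1 + a s²`,
for `0 < s < 1`, `d/ds F = -(4πt)^(-n/2) · s/(2t²) · ∫ ⟨y + a s x, N⟩² exp(-|x - s y|²/(4t)) dμ ≤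
0`. This monotonicity formula is `hasDerivAt_gaussianReal_path`. It comes from differentiating under
the integral and adding the divergence of a Gaussian field with affine coefficient, after which a
perfect square is left (`shrinkerDiv_gaussField`).

The divergence used is `div_S W - ⟨x, N⟩⟨W, N⟩/2`, which on a shrinker is the divergence of the
tangential part of `W`. It integrates to zero when it and `W` are integrable
(`integral_shrinkerDiv_eq_zero`). In a graph chart it becomes a Euclidean divergence, by the area
formula and the symmetry of the second fundamental form. The charts are patched by a partition of
unity, and cutoffs in the intrinsic distance remove the support condition. `S` is not assumed closed
in the ambient space, so compactness of the supports of the cutoffs comes from completeness through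
Hopf–Rinow (`IntrinsicSpace.totallyBounded_ball`). Polynomial volume growth makes the Gaussian
integrals converge.

The decrease is strict. If the derivative vanished at some `s > 0`, the nonzero affine field `y + a
s x` would be tangent to `S`. If it is constant, `S` is invariant under translations along a line.
Otherwise `S` is a cone whose vertex lies in `S` by completeness; a cone smooth at its vertex is a
hyperplane. Both cases split off a line (`splitsOffLine_of_tangent`), which is excluded.

For the uniform gap, every path ending where `|x₀| + |log t₀| > ε` crosses the compact set where
this quantity equals `ε`. On that set the continuous function `F` has a maximum below `F_{0,1}`, and
`F` only decreases after the crossing. -/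

section

/-! ### Area formula for distance-nondecreasing `C¹` maps -/

section Area

variable {n : ℕ} {F : Type*} [NormedAddCommGroup F] [InnerProductSpace ℝ F]

/-- If distances between values of `f` are at most `K` times those between values of `g`, then the
Euclidean Hausdorff measures of the images compare accordingly. -/
theorem euclideanHausdorffMeasure_image_le_of_dist_le {X Y Z : Type*} [MetricSpace Y]
    [MetricSpace Z] [MeasurableSpace Y] [BorelSpace Y] [MeasurableSpace Z] [BorelSpace Z]
    {f : X → Y} {g : X → Z} {A : Set X} {K : NNReal} (d : ℕ)
    (h : ∀ x ∈ A, ∀ y ∈ A, dist (f x) (f y) ≤ K * dist (g x) (g y)) :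
    (μHE[d] : Measure Y) (f '' A) ≤ (K : ℝ≥0∞) ^ d * (μHE[d] : Measure Z) (g '' A) := by
  rcases A.eq_empty_or_nonempty with rfl | ⟨a, ha⟩
  · simp
  have : Nonempty X := ⟨a⟩
  -- The hypothesis makes `f` constant on the fibres of `g` in `A`, so `f` factors as `k ∘ g` there
  -- with `k` Lipschitz; the bound is then the one for Lipschitz images.
  set k : Z → Y := fun z => f (Function.invFunOn g A z) with hk
  have key : ∀ x ∈ A, k (g x) = f x := by
    intro x hx
    have h1 : Function.invFunOn g A (g x) ∈ A := Function.invFunOn_mem ⟨x, hx, rfl⟩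
    have h2 : g (Function.invFunOn g A (g x)) = g x := Function.invFunOn_eq ⟨x, hx, rfl⟩
    have h3 := h _ h1 x hx
    rw [h2, dist_self, mul_zero] at h3
    exact dist_le_zero.1 h3
  have hL : LipschitzOnWith K k (g '' A) := by
    apply LipschitzOnWith.of_dist_le_mul
    rintro _ ⟨x, hx, rfl⟩ _ ⟨y, hy, rfl⟩
    rw [key x hx, key y hy]
    exact h x hx y hy
  have himg : f '' A = k '' (g '' A) := by
    rw [image_image]
    exact image_congr (fun x hx => (key x hx).symm)
  rw [himg]
  have := hL.hausdorffMeasure_image_le (d := (d : ℝ)) (by positivity)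
  simp only [euclideanHausdorffMeasure_def, Measure.smul_apply, ENNReal.smul_def, smul_eq_mul]
  calc _ ≤ _ := mul_le_mul_right this _
    _ = _ := by rw [ENNReal.rpow_natCast]; ring

variable {Φ : EuclideanSpace ℝ (Fin n) → F}

/-- Difference quotients in direction `v` have norm at least `‖v‖`, and this survives in the limit.
-/
theorem norm_le_norm_fderiv_of_expanding (hΦ : ContDiff ℝ 1 Φ)
    (hexp : ∀ x y, ‖x - y‖ ≤ ‖Φ x - Φ y‖) (x v : EuclideanSpace ℝ (Fin n)) :
    ‖v‖ ≤ ‖fderiv ℝ Φ x v‖ := by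
  have hd : HasFDerivAt Φ (fderiv ℝ Φ x) x :=
    (hΦ.differentiable (by simp)).differentiableAt.hasFDerivAt
  have hslope := (hd.hasLineDerivAt v).tendsto_slope_zero
  refine ge_of_tendsto hslope.norm ?_
  filter_upwards [self_mem_nhdsWithin] with t ht
  have h1 := hexp (x + t • v) x
  rw [add_sub_cancel_left, norm_smul] at h1
  rw [norm_smul, norm_inv]
  have : 0 < ‖t‖ := norm_pos_iff.2 ht
  rw [inv_mul_eq_div, le_div_iff₀ this]
  linarith

/-- Strict differentiability gives an additive error `ε ‖x - y‖`. Both `‖Φ x - Φ y‖` and the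
linearized distance dominate `‖x - y‖`, so the error turns into a factor `1 + ε` in either
direction. -/
theorem exists_ball_dist_comparison (hΦ : ContDiff ℝ 1 Φ)
    (hexp : ∀ x y, ‖x - y‖ ≤ ‖Φ x - Φ y‖) (x₀ : EuclideanSpace ℝ (Fin n)) {ε : ℝ}
    (hε : 0 < ε) :
    ∃ r > 0, ∀ x ∈ Metric.ball x₀ r, ∀ y ∈ Metric.ball x₀ r,
      dist (Φ x) (Φ y) ≤ (1 + ε) * dist (fderiv ℝ Φ x₀ x) (fderiv ℝ Φ x₀ y) ∧
      dist (fderiv ℝ Φ x₀ x) (fderiv ℝ Φ x₀ y) ≤ (1 + ε) * dist (Φ x) (Φ y) := by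
  have hs : HasStrictFDerivAt Φ (fderiv ℝ Φ x₀) x₀ :=
    hΦ.contDiffAt.hasStrictFDerivAt (by simp)
  have := hs.isLittleO.def hε
  rw [nhds_prod_eq, Filter.Eventually, Filter.mem_prod_same_iff] at this
  obtain ⟨t, ht, hsub⟩ := this
  obtain ⟨r, hr, hrt⟩ := Metric.mem_nhds_iff.1 ht
  refine ⟨r, hr, fun x hx y hy => ?_⟩
  have h1 : ‖Φ x - Φ y - fderiv ℝ Φ x₀ (x - y)‖ ≤ ε * ‖x - y‖ :=
    hsub (⟨hrt hx, hrt hy⟩ : (x, y) ∈ t ×ˢ t)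
  have h2 := hexp x y
  have h3 := norm_le_norm_fderiv_of_expanding hΦ hexp x₀ (x - y)
  rw [dist_eq_norm, dist_eq_norm, ← map_sub]
  have h4 := norm_sub_norm_le (Φ x - Φ y) (fderiv ℝ Φ x₀ (x - y))
  have h5 := norm_sub_norm_le (fderiv ℝ Φ x₀ (x - y)) (Φ x - Φ y)
  rw [norm_sub_rev _ (Φ x - Φ y)] at h5
  constructor <;> nlinarith

variable [MeasurableSpace F] [BorelSpace F]

/-- The exact measure of linear images transfers to `Φ`, because `Φ` and its linearization are
Lipschitz functions of each other with constant `1 + ε`. -/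
theorem exists_ball_measure_comparison (hΦ : ContDiff ℝ 1 Φ)
    (hexp : ∀ x y, ‖x - y‖ ≤ ‖Φ x - Φ y‖) (x₀ : EuclideanSpace ℝ (Fin n)) {ε : NNReal}
    (hε : 0 < ε) :
    ∃ r > 0, ∀ A ⊆ Metric.ball x₀ r,
      μHE[n] (Φ '' A) ≤ ((1 + ε : NNReal) : ℝ≥0∞) ^ n *
        (ENNReal.ofReal (fderiv ℝ Φ x₀ : EuclideanSpace ℝ (Fin n) →ₗ[ℝ] F).normDet * volume A) ∧
      ENNReal.ofReal (fderiv ℝ Φ x₀ : EuclideanSpace ℝ (Fin n) →ₗ[ℝ] F).normDet * volume A ≤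
        ((1 + ε : NNReal) : ℝ≥0∞) ^ n * μHE[n] (Φ '' A) := by
  obtain ⟨r, hr, h⟩ := exists_ball_dist_comparison hΦ hexp x₀ (ε := ε) (by exact_mod_cast hε)
  refine ⟨r, hr, fun A hA => ?_⟩
  have hlin := (fderiv ℝ Φ x₀ : EuclideanSpace ℝ (Fin n) →ₗ[ℝ] F).euclideanHausdorffMeasure_image_eq_normDet_mul_volume A
  rw [finrank_euclideanSpace_fin] at hlin
  rw [← hlin]
  constructor
  · apply euclideanHausdorffMeasure_image_le_of_dist_le
    intro x hx y hy
    simpa using (h x (hA hx) y (hA hy)).1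
  · apply euclideanHausdorffMeasure_image_le_of_dist_le
    intro x hx y hy
    simpa using (h x (hA hx) y (hA hy)).2

/-- The **area formula** for a `C¹` map that does not decrease distances. -/
theorem comap_euclideanHausdorffMeasure_eq_withDensity (hΦ : ContDiff ℝ 1 Φ)
    (hexp : ∀ x y, ‖x - y‖ ≤ ‖Φ x - Φ y‖) :
    Measure.comap Φ μHE[n] = volume.withDensity (fun x =>
      ENNReal.ofReal (fderiv ℝ Φ x : EuclideanSpace ℝ (Fin n) →ₗ[ℝ] F).normDet) := by
  have hinj : Function.Injective Φ := fun x y hxy => by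
    have := hexp x y
    rw [hxy, sub_self, norm_zero] at this
    exact sub_eq_zero.1 (norm_le_zero_iff.1 this)
  have hemb : MeasurableEmbedding Φ := hΦ.continuous.measurableEmbedding hinj
  set ν := Measure.comap Φ μHE[n] with hν
  have hνA : ∀ A, ν A = μHE[n] (Φ '' A) := fun A => hemb.comap_apply _ _
  set J : EuclideanSpace ℝ (Fin n) → ℝ≥0∞ := fun x =>
    ENNReal.ofReal (fderiv ℝ Φ x : EuclideanSpace ℝ (Fin n) →ₗ[ℝ] F).normDet with hJ
  have hcmp : ∀ (x₀ : EuclideanSpace ℝ (Fin n)) (ε : NNReal), 0 < ε →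
      ∃ r > 0, ∀ A ⊆ Metric.ball x₀ r,
        ν A ≤ ((1 + ε : NNReal) : ℝ≥0∞) ^ n * (J x₀ * volume A) ∧
        J x₀ * volume A ≤ ((1 + ε : NNReal) : ℝ≥0∞) ^ n * ν A := by
    intro x₀ ε hε
    obtain ⟨r, hr, h⟩ := exists_ball_measure_comparison hΦ hexp x₀ hε
    refine ⟨r, hr, fun A hA => ?_⟩
    rw [hνA]
    exact h A hA
  have : IsLocallyFiniteMeasure ν := by
    refine ⟨fun x => ?_⟩
    obtain ⟨r, hr, h⟩ := hcmp x 1 one_pos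
    refine ⟨_, Metric.ball_mem_nhds x hr, lt_of_le_of_lt (h _ subset_rfl).1 ?_⟩
    refine ENNReal.mul_lt_top (ENNReal.pow_lt_top ENNReal.coe_lt_top) ?_
    exact ENNReal.mul_lt_top ENNReal.ofReal_lt_top measure_ball_lt_top
  have hac : ν ≪ volume := by
    intro A hA
    apply measure_null_of_locally_null
    intro x _
    obtain ⟨r, hr, h⟩ := hcmp x 1 one_pos
    refine ⟨_, inter_mem_nhdsWithin A (Metric.ball_mem_nhds x hr), ?_⟩
    have := (h (A ∩ Metric.ball x r) inter_subset_right).1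
    rw [measure_mono_null inter_subset_left hA] at this
    simpa using this
  -- The density is identified pointwise: by Besicovitch differentiation it is the limit of `ν a /
  -- volume a`, and these ratios are pinched between multiples of `J x` with factors tending to `1`
  -- as `ε → 0`.
  rw [← withDensity_rnDeriv_eq ν volume hac]
  apply withDensity_congr_ae
  filter_upwards [(Besicovitch.vitaliFamily
    (volume : Measure (EuclideanSpace ℝ (Fin n)))).ae_tendsto_rnDeriv ν] with x hx
  have hbounds : ∀ ε : NNReal, 0 < ε →
      ν.rnDeriv volume x ≤ ((1 + ε : NNReal) : ℝ≥0∞) ^ n * J x ∧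
      J x ≤ ((1 + ε : NNReal) : ℝ≥0∞) ^ n * ν.rnDeriv volume x := by
    intro ε hε
    obtain ⟨r, hr, h⟩ := hcmp x ε hε
    have hev : ∀ᶠ a in (Besicovitch.vitaliFamily
        (volume : Measure (EuclideanSpace ℝ (Fin n)))).filterAt x,
        a ⊆ Metric.ball x r ∧ 0 < volume a ∧ volume a < ⊤ := by
      filter_upwards [(Besicovitch.vitaliFamily
        (volume : Measure (EuclideanSpace ℝ (Fin n)))).eventually_filterAt_subset_closedBall x
          (half_pos hr), (Besicovitch.vitaliFamily
        (volume : Measure (EuclideanSpace ℝ (Fin n)))).eventually_measure_lt_top x,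
        (Besicovitch.vitaliFamily
        (volume : Measure (EuclideanSpace ℝ (Fin n)))).eventually_filterAt_mem_setsAt x]
        with a ha hfin hmem
      refine ⟨ha.trans (Metric.closedBall_subset_ball (half_lt_self hr)), ?_, hfin⟩
      exact isOpen_interior.measure_pos _
        ((Besicovitch.vitaliFamily _).nonempty_interior x a hmem) |>.trans_le
          (measure_mono interior_subset)
    constructor
    · refine le_of_tendsto hx ?_
      filter_upwards [hev] with a ⟨ha, hpos, hfin⟩
      rw [ENNReal.div_le_iff hpos.ne' hfin.ne, mul_assoc]
      exact (h a ha).1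
    · refine ge_of_tendsto (ENNReal.Tendsto.const_mul hx (Or.inr (by finiteness))) ?_
      filter_upwards [hev] with a ⟨ha, hpos, hfin⟩
      rw [← mul_div_assoc, ENNReal.le_div_iff_mul_le (Or.inl hpos.ne') (Or.inl hfin.ne)]
      exact (h a ha).2
  have hlim : ∀ c : ℝ≥0∞, Tendsto (fun ε : NNReal => ((1 + ε : NNReal) : ℝ≥0∞) ^ n * c)
      (𝓝[>] 0) (𝓝 c) := by
    intro c
    have h1 : Tendsto (fun ε : NNReal => ((1 + ε : NNReal) : ℝ≥0∞) ^ n) (𝓝[>] 0) (𝓝 1) := by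
      have : Continuous (fun ε : NNReal => (((1 + ε) ^ n : NNReal) : ℝ≥0∞)) := by fun_prop
      have h2 := (this.tendsto 0).mono_left (nhdsWithin_le_nhds (s := Ioi 0))
      simpa using h2
    simpa using ENNReal.Tendsto.mul_const h1 (Or.inl one_ne_zero)
  apply le_antisymm
  · refine ge_of_tendsto (hlim _) ?_
    filter_upwards [self_mem_nhdsWithin] with ε hε using (hbounds ε hε).1
  · refine ge_of_tendsto (hlim _) ?_
    filter_upwards [self_mem_nhdsWithin] with ε hε using (hbounds ε hε).2

end Area

end

/-! ### Graph charts from the implicit function theorem -/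

section

variable {n : ℕ}

/-- The space of parameters of hypersurfaces of dimension `n`. -/
abbrev Param (n : ℕ) : Type := EuclideanSpace ℝ (Fin n)

/-- A representation of `S` near `p` as the graph of a function `u` over the orthogonal complement
of the unit vector `e`, which is identified with `Param n` through `ι`. -/
structure GraphChart (S : Set (Ambient n)) (p : Ambient n) where
  /-- the identification of the parameter space with the tangent space at `p` -/
  ι : Param n →ₗᵢ[ℝ] Ambient n
  /-- the unit normal at `p` -/
  e : Ambient n
  norm_e : ‖e‖ = 1
  inner_e : ∀ w, inner ℝ (ι w) e = 0
  decomp : ∀ v, v = ι (ι.toContinuousLinearMap.adjoint v) + (inner ℝ v e : ℝ) • e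
  /-- the function whose graph is the hypersurface -/
  u : Param n → ℝ
  smooth : ContDiff ℝ ∞ u
  u_zero : u 0 = 0
  fderiv_u_zero : fderiv ℝ u 0 = 0
  /-- the radius of the base of the cylinder -/
  r : ℝ
  /-- the height of the cylinder -/
  h : ℝ
  r_pos : 0 < r
  h_pos : 0 < h
  norm_fderiv_le : ∀ w ∈ Metric.ball (0 : Param n) r, ‖fderiv ℝ u w‖ ≤ 1
  abs_u_lt : ∀ w ∈ Metric.ball (0 : Param n) r, |u w| < h
  mem_iff : ∀ x, ι.toContinuousLinearMap.adjoint (x - p) ∈ Metric.ball (0 : Param n) r →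
    |inner ℝ (x - p) e| < h →
      (x ∈ S ↔ (inner ℝ (x - p) e : ℝ) = u (ι.toContinuousLinearMap.adjoint (x - p)))

/-- An orthonormal basis of the complement of `e` provides `ι`; its adjoint is the orthogonal
projection read in these coordinates. -/
theorem exists_frame {e : Ambient n} (he : ‖e‖ = 1) :
    ∃ ι : Param n →ₗᵢ[ℝ] Ambient n, (∀ w, inner ℝ (ι w) e = (0 : ℝ)) ∧
      ∀ v, v = ι (ι.toContinuousLinearMap.adjoint v) + (inner ℝ v e : ℝ) • e := by
  have : Fact (Module.finrank ℝ (Ambient n) = n + 1) := ⟨finrank_euclideanSpace_fin⟩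
  have he0 : e ≠ 0 := by rintro rfl; simp at he
  set b := OrthonormalBasis.fromOrthogonalSpanSingleton (𝕜 := ℝ) n he0
  set ι : Param n →ₗᵢ[ℝ] Ambient n :=
    (Submodule.span ℝ {e})ᗮ.subtypeₗᵢ.comp b.repr.symm.toLinearIsometry with hι
  have hperp : ∀ w, inner ℝ (ι w) e = (0 : ℝ) := by
    intro w
    have : ι w ∈ (Submodule.span ℝ {e})ᗮ := by simp [hι]
    rw [Submodule.mem_orthogonal_singleton_iff_inner_left] at this
    exact this
  refine ⟨ι, hperp, fun v => ?_⟩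
  have hv : v - (inner ℝ v e : ℝ) • e ∈ (Submodule.span ℝ {e})ᗮ := by
    rw [Submodule.mem_orthogonal_singleton_iff_inner_left, inner_sub_left, inner_smul_left,
      real_inner_self_eq_norm_sq, he]
    simp
  obtain ⟨w, hw⟩ : ∃ w, ι w = v - (inner ℝ v e : ℝ) • e :=
    ⟨b.repr ⟨_, hv⟩, by simp [hι]⟩
  have h1 : ι.toContinuousLinearMap.adjoint v = w := by
    apply ext_inner_left ℝ
    intro z
    rw [ContinuousLinearMap.adjoint_inner_right]
    have : v = ι w + (inner ℝ v e : ℝ) • e := by rw [hw]; abel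
    rw [this, inner_add_right, inner_smul_right]
    simp [hperp]
  rw [h1, hw]
  abel

/-- By uniqueness, a continuous solution agrees near `w` with the implicit function based at `(w, ψ
w)`. This is needed because `ContDiffAt ℝ ∞` at one point gives a neighbourhood for each finite
order, not a common one; smoothness at nearby points requires applying the theorem there again. -/
theorem contDiffAt_of_implicit {G : Param n × ℝ → ℝ} {ψ : Param n → ℝ} {w : Param n}
    (hG : ContDiffAt ℝ ∞ G (w, ψ w))
    (hinv : (fderiv ℝ G (w, ψ w) ∘L .inr ℝ (Param n) ℝ).IsInvertible)
    (hψ : ContinuousAt ψ w) (hz : ∀ᶠ z in 𝓝 w, G (z, ψ z) = G (w, ψ w)) :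
    ContDiffAt ℝ ∞ ψ w := by
  have h1 := hG.contDiffAt_implicitFunction (by simp) hinv
  refine h1.congr_of_eventuallyEq ?_
  have h2 := hG.eventually_apply_eq_iff_implicitFunction (by simp) hinv
  have h3 : Tendsto (fun z => (z, ψ z)) (𝓝 w) (𝓝 (w, ψ w)) :=
    (continuousAt_id.prodMk hψ)
  filter_upwards [h3.eventually h2, hz] with z hz1 hz2
  exact (hz1.1 hz2).symm

/-- A function that is smooth near `0` agrees near `0` with a function smooth everywhere. -/
theorem exists_contDiff_eventuallyEq {ψ : Param n → ℝ}
    (h : ∀ᶠ w in 𝓝 0, ContDiffAt ℝ ∞ ψ w) :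
    ∃ u : Param n → ℝ, ContDiff ℝ ∞ u ∧ u =ᶠ[𝓝 0] ψ := by
  obtain ⟨R, hR, hball⟩ := Metric.eventually_nhds_iff_ball.1 h
  let χ : ContDiffBump (0 : Param n) := ⟨R / 4, R / 2, by positivity, by linarith⟩
  refine ⟨fun w => χ w * ψ w, ?_, ?_⟩
  · rw [contDiff_iff_contDiffAt]
    intro w
    by_cases hw : w ∈ Metric.ball (0 : Param n) R
    · exact χ.contDiff.contDiffAt.mul (hball w hw)
    · have hw' : w ∉ tsupport χ := by
        rw [χ.tsupport_eq]
        intro hmem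
        exact hw (Metric.closedBall_subset_ball (half_lt_self hR) hmem)
      have : (fun w => χ w * ψ w) =ᶠ[𝓝 w] fun _ => 0 := by
        filter_upwards [notMem_tsupport_iff_eventuallyEq.1 hw'] with z hz
        simp [hz]
      exact contDiffAt_const.congr_of_eventuallyEq this
  · filter_upwards [χ.eventuallyEq_one] with w hw
    simp [hw]

/-- The condition `htan` makes the graph horizontal at the origin. The implicit function is replaced
by a globally smooth function with the same germ, so that everything later built from `u` is smooth
on the whole parameter space. -/
theorem exists_implicit_graph {G : Param n × ℝ → ℝ} {V : Set (Param n × ℝ)} (hV : IsOpen V)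
    (h0 : (0, 0) ∈ V) (hG : ContDiffOn ℝ ∞ G V) (hG0 : G (0, 0) = 0)
    (hinv : (fderiv ℝ G (0, 0) ∘L .inr ℝ (Param n) ℝ).IsInvertible)
    (htan : fderiv ℝ G (0, 0) ∘L .inl ℝ (Param n) ℝ = 0) :
    ∃ u : Param n → ℝ, ContDiff ℝ ∞ u ∧ u 0 = 0 ∧ fderiv ℝ u 0 = 0 ∧
      ∀ᶠ v in 𝓝 ((0, 0) : Param n × ℝ), G v = 0 ↔ v.2 = u v.1 := by
  have hGat : ∀ v ∈ V, ContDiffAt ℝ ∞ G v := fun v hv => hG.contDiffAt (hV.mem_nhds hv)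
  set ψ := (hGat _ h0).implicitFunction (by simp) hinv with hψdef
  have hψ0 : ψ 0 = 0 := (hGat _ h0).implicitFunction_apply_self (by simp) hinv
  have hψd : HasStrictFDerivAt ψ (0 : Param n →L[ℝ] ℝ) 0 := by
    have := (hGat _ h0).hasStrictFDerivAt_implicitFunction (by simp) hinv
    rw [htan, ContinuousLinearMap.comp_zero, neg_zero] at this
    exact this
  have hiff := (hGat _ h0).eventually_apply_eq_iff_implicitFunction (by simp) hinv
  have hzero : ∀ᶠ z in 𝓝 (0 : Param n), G (z, ψ z) = 0 := by
    have := (hGat _ h0).eventually_apply_implicitFunction (by simp) hinv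
    simpa [hG0] using this
  have hψat : ContDiffAt ℝ ∞ ψ 0 := (hGat _ h0).contDiffAt_implicitFunction (by simp) hinv
  have hcont1 : ∀ᶠ w in 𝓝 (0 : Param n), ContinuousAt ψ w := by
    have := (hψat.of_le (m := 1) (by simp)).eventually (by simp)
    filter_upwards [this] with w hw using hw.continuousAt
  have htend : Tendsto (fun z => (z, ψ z)) (𝓝 0) (𝓝 ((0, 0) : Param n × ℝ)) := by
    have := continuousAt_id.prodMk hψat.continuousAt
    rw [ContinuousAt, hψ0] at this
    exact this
  have hinv' : ∀ᶠ v in 𝓝 ((0, 0) : Param n × ℝ),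
      (fderiv ℝ G v ∘L .inr ℝ (Param n) ℝ).IsInvertible := by
    have hc : ContinuousAt (fun v => fderiv ℝ G v ∘L .inr ℝ (Param n) ℝ) (0, 0) := by
      have : ContinuousAt (fderiv ℝ G) (0, 0) :=
        ((hGat _ h0).fderiv_right (m := 0) (by simp)).continuousAt
      exact this.clm_comp continuousAt_const
    obtain ⟨L, hL⟩ := hinv
    have hn : range ((↑) : (ℝ ≃L[ℝ] ℝ) → ℝ →L[ℝ] ℝ) ∈
        𝓝 (fderiv ℝ G (0, 0) ∘L .inr ℝ (Param n) ℝ) := by rw [← hL]; exact L.nhds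
    exact hc.eventually hn
  have hsmooth : ∀ᶠ w in 𝓝 (0 : Param n), ContDiffAt ℝ ∞ ψ w := by
    filter_upwards [hcont1, htend.eventually (hV.mem_nhds h0), htend.eventually hinv',
      hzero.eventually_nhds] with w h1 h2 h3 h4
    refine contDiffAt_of_implicit (hGat _ h2) h3 h1 ?_
    rw [h4.self_of_nhds]
    exact h4
  obtain ⟨u, hu, huψ⟩ := exists_contDiff_eventuallyEq hsmooth
  refine ⟨u, hu, ?_, ?_, ?_⟩
  · rw [huψ.self_of_nhds, hψ0]
  · rw [huψ.fderiv_eq, hψd.hasFDerivAt.fderiv]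
  · filter_upwards [hiff, (continuousAt_fst (p := ((0, 0) : Param n × ℝ))).eventually huψ]
      with v h1 h2
    rw [h2, ← hG0, h1, eq_comm]

theorem IsDefiningFunction.contDiffAt {S U : Set (Ambient n)} {f : Ambient n → ℝ}
    (hf : IsDefiningFunction S U f) {x : Ambient n} (hx : x ∈ U) : ContDiffAt ℝ ∞ f x :=
  hf.smooth.contDiffAt (hf.isOpen.mem_nhds hx)

theorem IsDefiningFunction.differentiableAt {S U : Set (Ambient n)} {f : Ambient n → ℝ}
    (hf : IsDefiningFunction S U f) {x : Ambient n} (hx : x ∈ U) : DifferentiableAt ℝ f x :=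
  (hf.contDiffAt hx).differentiableAt (by simp)

theorem IsDefiningFunction.mem_iff {S U : Set (Ambient n)} {f : Ambient n → ℝ}
    (hf : IsDefiningFunction S U f) {x : Ambient n} (hx : x ∈ U) : x ∈ S ↔ f x = 0 := by
  have := Set.ext_iff.1 hf.inter_eq x
  simp only [mem_inter_iff, hx, and_true, mem_ofPred_eq, true_and] at this
  exact this

theorem norm_unitNormal {f : Ambient n → ℝ} {x : Ambient n} (h : gradient f x ≠ 0) :
    ‖unitNormal f x‖ = 1 := by
  rw [unitNormal, norm_smul, norm_inv, norm_norm, inv_mul_cancel₀ (norm_ne_zero_iff.2 h)]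

/-- Every point of a regular level set has a graph chart, whose distinguished normal is the unit
normal of the level set. -/
theorem IsDefiningFunction.exists_graphChart {S U : Set (Ambient n)} {f : Ambient n → ℝ}
    (hf : IsDefiningFunction S U f) {p : Ambient n} (hp : p ∈ S ∩ U) :
    ∃ c : GraphChart S p, c.e = unitNormal f p := by
  set e := unitNormal f p with he_def
  have hg := hf.gradient_ne_zero p hp.2
  have he : ‖e‖ = 1 := norm_unitNormal hg
  obtain ⟨ι, hperp, hdec⟩ := exists_frame he
  have hgrad : gradient f p = ‖gradient f p‖ • e := by
    rw [he_def, unitNormal, smul_smul, mul_inv_cancel₀ (norm_ne_zero_iff.2 hg), one_smul]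
  set P : Param n × ℝ → Ambient n := fun v => p + (ι v.1 + v.2 • e) with hP
  have hPs : ContDiff ℝ ∞ P := by
    have : ContDiff ℝ ∞ (fun w => ι w) := ι.toContinuousLinearMap.contDiff
    fun_prop
  have hP0 : P (0, 0) = p := by simp [hP]
  have hPd : HasFDerivAt P (ι.toContinuousLinearMap ∘L .fst ℝ (Param n) ℝ +
      (ContinuousLinearMap.snd ℝ (Param n) ℝ).smulRight e) (0, 0) := by
    have h1 : HasFDerivAt (fun v : Param n × ℝ => ι v.1)
      (ι.toContinuousLinearMap ∘L .fst ℝ (Param n) ℝ) (0, 0) :=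
      (ι.toContinuousLinearMap ∘L .fst ℝ (Param n) ℝ).hasFDerivAt
    have h2 : HasFDerivAt (fun v : Param n × ℝ => v.2 • e)
      ((ContinuousLinearMap.snd ℝ (Param n) ℝ).smulRight e) (0, 0) :=
      ((ContinuousLinearMap.snd ℝ (Param n) ℝ).smulRight e).hasFDerivAt
    exact (h1.add h2).const_add p
  have hGd : fderiv ℝ (fun v => f (P v)) (0, 0) = fderiv ℝ f p ∘L
      (ι.toContinuousLinearMap ∘L .fst ℝ (Param n) ℝ +
      (ContinuousLinearMap.snd ℝ (Param n) ℝ).smulRight e) := by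
    have h1 : HasFDerivAt f (fderiv ℝ f p) (P (0, 0)) := by
      rw [hP0]; exact (hf.differentiableAt hp.2).hasFDerivAt
    exact (h1.comp _ hPd).fderiv
  have hV : IsOpen (P ⁻¹' U) := hf.isOpen.preimage hPs.continuous
  obtain ⟨u, hu, hu0, hdu0, hiff⟩ := exists_implicit_graph (G := fun v => f (P v)) hV
    (by rw [mem_preimage, hP0]; exact hp.2)
    (hf.smooth.comp hPs.contDiffOn (fun v hv => hv))
    (by rw [hP0]; exact (hf.mem_iff hp.2).1 hp.1)
    (by
      rw [hGd]
      -- The derivative in the direction of the normal is `‖∇f‖`, a nonzero scalar.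
      refine ⟨ContinuousLinearEquiv.unitsEquivAut ℝ (Units.mk0 ‖gradient f p‖
        (norm_ne_zero_iff.2 hg)), ?_⟩
      ext
      have h1 : fderiv ℝ f p e = ‖gradient f p‖ := by
        rw [← inner_gradient_left]
        nth_rewrite 1 [hgrad]
        rw [real_inner_smul_left, real_inner_self_eq_norm_sq, he]
        simp
      simp [h1])
    (by
      rw [hGd]
      ext w
      have h1 : (ι.toContinuousLinearMap ∘L .fst ℝ (Param n) ℝ +
          (ContinuousLinearMap.snd ℝ (Param n) ℝ).smulRight e) (w, 0) = ι w := by simp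
      rw [ContinuousLinearMap.comp_apply, ContinuousLinearMap.inl_apply,
        ContinuousLinearMap.comp_apply, h1, zero_apply, ← inner_gradient_left, hgrad,
        real_inner_smul_left, real_inner_comm, hperp, mul_zero])
  have hiff' := hiff.and (hV.mem_nhds (by rw [mem_preimage, hP0]; exact hp.2))
  -- The neighbourhood is shrunk to a cylinder. The height `h` is fixed first, and then the radius
  -- `r` is taken small enough that `|u| < h` and `‖Du‖ < 1` over the base.
  rw [nhds_prod_eq, Filter.eventually_prod_iff] at hiff'
  obtain ⟨pa, hpa, pb, hpb, hab⟩ := hiff'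
  obtain ⟨h, hh, hpb⟩ := Metric.eventually_nhds_iff_ball.1 hpb
  have hev1 : ∀ᶠ w in 𝓝 (0 : Param n), |u w| < h := by
    have : ContinuousAt (fun w => |u w|) 0 := hu.continuous.abs.continuousAt
    exact this.eventually (gt_mem_nhds (by simpa [hu0] using hh))
  have hev2 : ∀ᶠ w in 𝓝 (0 : Param n), ‖fderiv ℝ u w‖ < 1 := by
    have : ContinuousAt (fun w => ‖fderiv ℝ u w‖) 0 :=
      (hu.continuous_fderiv (by simp)).norm.continuousAt
    exact this.eventually (gt_mem_nhds (by simp [hdu0]))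
  obtain ⟨r, hr, hball⟩ := Metric.eventually_nhds_iff_ball.1 (hpa.and (hev1.and hev2))
  refine ⟨⟨ι, e, he, hperp, hdec, u, hu, hu0, hdu0, r, h, hr, hh,
    fun w hw => (hball w hw).2.2.le, fun w hw => (hball w hw).2.1, ?_⟩, rfl⟩
  intro x hx1 hx2
  have hxP : P (ι.toContinuousLinearMap.adjoint (x - p), inner ℝ (x - p) e) = x := by
    simp only [hP]
    rw [← hdec]
    abel
  have hk := hab (hball _ hx1).1 (hpb (inner ℝ (x - p) e) (by simpa using hx2))
  rw [hxP] at hk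
  rw [hf.mem_iff hk.2]
  exact hk.1

theorem IsEmbeddedHypersurface.nonempty_graphChart {S : Set (Ambient n)}
    (hS : IsEmbeddedHypersurface S) {p : Ambient n} (hp : p ∈ S) : Nonempty (GraphChart S p) := by
  obtain ⟨U, f, hpU, hf⟩ := hS p hp
  obtain ⟨c, -⟩ := hf.exists_graphChart ⟨hp, hpU⟩
  exact ⟨c⟩

end

/-! ### Geometry and area measure in a graph chart -/

section

variable {n : ℕ} {S : Set (Ambient n)} {p : Ambient n}

namespace GraphChart

variable (c : GraphChart S p)

/-- The linear projection onto the parameter space. -/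
def T : Ambient n →L[ℝ] Param n := c.ι.toContinuousLinearMap.adjoint

/-- The parameter of the foot point of `x` in the tangent plane at `p`. -/
def proj (x : Ambient n) : Param n := c.T (x - p)

/-- The signed height of `x` over the tangent plane at `p`. -/
def height (x : Ambient n) : ℝ := inner ℝ (x - p) c.e

/-- The graph parametrization. -/
def param (w : Param n) : Ambient n := p + (c.ι w + c.u w • c.e)

/-- The open cylinder in which `S` is a graph. -/
def dom : Set (Ambient n) := {x | c.proj x ∈ Metric.ball 0 c.r ∧ |c.height x| < c.h}

/-- The upward normal `(-∇u, 1)`. -/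
def conormal (w : Param n) : Ambient n := c.e - c.ι (gradient c.u w)

/-- The area density of the graph. -/
def J (w : Param n) : ℝ := ‖c.conormal w‖

/-- The upward unit normal, as a function of the parameter. -/
def ν (w : Param n) : Ambient n := (c.J w)⁻¹ • c.conormal w

theorem inner_T (v : Ambient n) (w : Param n) : (inner ℝ (c.T v) w : ℝ) = inner ℝ v (c.ι w) := by
  rw [T, ContinuousLinearMap.adjoint_inner_left]
  rfl

theorem T_ι (w : Param n) : c.T (c.ι w) = w := by
  apply ext_inner_right ℝ
  intro z
  rw [inner_T, LinearIsometry.inner_map_map]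

theorem T_e : c.T c.e = 0 := by
  apply ext_inner_right ℝ
  intro z
  rw [inner_T, real_inner_comm, c.inner_e, inner_zero_left]

theorem decomp' (v : Ambient n) : v = c.ι (c.T v) + (inner ℝ v c.e : ℝ) • c.e := c.decomp v

theorem inner_e_e : (inner ℝ c.e c.e : ℝ) = 1 := by
  rw [real_inner_self_eq_norm_sq, c.norm_e, one_pow]

theorem inner_eq (v w : Ambient n) : (inner ℝ v w : ℝ) =
    inner ℝ (c.T v) (c.T w) + inner ℝ v c.e * inner ℝ w c.e := by
  rw [inner_T]
  conv_lhs => rw [c.decomp' w, inner_add_right, real_inner_smul_right]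
  ring

theorem norm_T_le (v : Ambient n) : ‖c.T v‖ ≤ ‖v‖ := by
  have h := c.inner_eq v v
  rw [real_inner_self_eq_norm_sq, real_inner_self_eq_norm_sq] at h
  nlinarith [norm_nonneg v, norm_nonneg (c.T v), mul_self_nonneg (inner ℝ v c.e : ℝ)]

theorem param_sub (w : Param n) : c.param w - p = c.ι w + c.u w • c.e := by
  rw [param, add_sub_cancel_left]

@[simp] theorem proj_param (w : Param n) : c.proj (c.param w) = w := by
  rw [proj, param_sub, map_add, map_smul, T_ι, T_e, smul_zero, add_zero]

@[simp] theorem height_param (w : Param n) : c.height (c.param w) = c.u w := by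
  rw [height, param_sub, inner_add_left, c.inner_e, real_inner_smul_left, inner_e_e]
  ring

theorem eq_of_height {x : Ambient n} (h : c.height x = c.u (c.proj x)) : c.param (c.proj x) = x := by
  have := c.decomp' (x - p)
  rw [param, ← h, proj, height, ← this]
  abel

theorem mem_iff_of_dom {x : Ambient n} (hx : x ∈ c.dom) : x ∈ S ↔ c.height x = c.u (c.proj x) :=
  c.mem_iff x hx.1 hx.2

theorem param_mem_dom {w : Param n} (hw : w ∈ Metric.ball 0 c.r) : c.param w ∈ c.dom :=
  ⟨by rwa [proj_param], by rw [height_param]; exact c.abs_u_lt w hw⟩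

theorem param_mem {w : Param n} (hw : w ∈ Metric.ball 0 c.r) : c.param w ∈ S := by
  rw [c.mem_iff_of_dom (c.param_mem_dom hw), proj_param, height_param]

theorem param_proj {x : Ambient n} (hx : x ∈ c.dom) (hS : x ∈ S) : c.param (c.proj x) = x :=
  c.eq_of_height ((c.mem_iff_of_dom hx).1 hS)

theorem image_param_ball : c.param '' Metric.ball 0 c.r = S ∩ c.dom := by
  ext x
  constructor
  · rintro ⟨w, hw, rfl⟩
    exact ⟨c.param_mem hw, c.param_mem_dom hw⟩
  · rintro ⟨hS, hx⟩
    exact ⟨c.proj x, hx.1, c.param_proj hx hS⟩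

theorem proj_self : c.proj p = 0 := by rw [proj, sub_self, map_zero]

theorem height_self : c.height p = 0 := by rw [height, sub_self, inner_zero_left]

theorem param_zero : c.param 0 = p := by simp [param, c.u_zero]

theorem mem_dom : p ∈ c.dom := by
  refine ⟨?_, ?_⟩
  · rw [proj_self]; exact Metric.mem_ball_self c.r_pos
  · rw [height_self, abs_zero]; exact c.h_pos

theorem contDiff_ι : ContDiff ℝ ∞ c.ι := c.ι.toContinuousLinearMap.contDiff

theorem contDiff_proj : ContDiff ℝ ∞ c.proj :=
  c.T.contDiff.comp (contDiff_id.sub contDiff_const)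

theorem contDiff_height : ContDiff ℝ ∞ c.height :=
  (contDiff_id.sub contDiff_const).inner ℝ contDiff_const

theorem isOpen_dom : IsOpen c.dom :=
  (Metric.isOpen_ball.preimage c.contDiff_proj.continuous).inter
    (isOpen_lt c.contDiff_height.continuous.abs continuous_const)

theorem contDiff_param : ContDiff ℝ ∞ c.param :=
  contDiff_const.add (c.contDiff_ι.add (c.smooth.smul contDiff_const))

theorem contDiff_gradient : ContDiff ℝ ∞ (gradient c.u) :=
  (InnerProductSpace.toDual ℝ (Param n)).symm.contDiff.comp
    (c.smooth.fderiv_right (m := ∞) (by simp))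

theorem contDiff_conormal : ContDiff ℝ ∞ c.conormal :=
  contDiff_const.sub (c.contDiff_ι.comp c.contDiff_gradient)

theorem inner_conormal_e (w : Param n) : (inner ℝ (c.conormal w) c.e : ℝ) = 1 := by
  rw [conormal, inner_sub_left, inner_e_e, c.inner_e, sub_zero]

theorem conormal_ne_zero (w : Param n) : c.conormal w ≠ 0 := by
  intro h
  have := c.inner_conormal_e w
  rw [h, inner_zero_left] at this
  exact zero_ne_one this

theorem J_pos (w : Param n) : 0 < c.J w := norm_pos_iff.2 (c.conormal_ne_zero w)

theorem T_conormal (w : Param n) : c.T (c.conormal w) = -gradient c.u w := by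
  rw [conormal, map_sub, T_e, T_ι, zero_sub]

theorem J_sq (w : Param n) : c.J w ^ 2 = 1 + ‖gradient c.u w‖ ^ 2 := by
  have := c.inner_eq (c.conormal w) (c.conormal w)
  rw [real_inner_self_eq_norm_sq, real_inner_self_eq_norm_sq, inner_conormal_e, T_conormal,
    norm_neg] at this
  rw [J, this]
  ring

theorem contDiff_J : ContDiff ℝ ∞ c.J := by
  have : ∀ w, c.conormal w ≠ 0 := c.conormal_ne_zero
  exact c.contDiff_conormal.norm ℝ this

theorem contDiff_ν : ContDiff ℝ ∞ c.ν :=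
  (c.contDiff_J.inv fun w => (c.J_pos w).ne').smul c.contDiff_conormal

theorem norm_ν (w : Param n) : ‖c.ν w‖ = 1 := by
  rw [ν, norm_smul, norm_inv, J, norm_norm, inv_mul_cancel₀ (norm_ne_zero_iff.2
    (c.conormal_ne_zero w))]

theorem J_smul_ν (w : Param n) : c.J w • c.ν w = c.conormal w := by
  rw [ν, smul_smul, mul_inv_cancel₀ (c.J_pos w).ne', one_smul]

theorem hasFDerivAt_param (w : Param n) : HasFDerivAt c.param
    (c.ι.toContinuousLinearMap + (fderiv ℝ c.u w).smulRight c.e) w := by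
  have h1 : HasFDerivAt c.ι c.ι.toContinuousLinearMap w := c.ι.toContinuousLinearMap.hasFDerivAt
  have h2 : HasFDerivAt c.u (fderiv ℝ c.u w) w :=
    (c.smooth.differentiable (by simp)).differentiableAt.hasFDerivAt
  exact (h1.add (h2.smul_const c.e)).const_add p

theorem fderiv_param_apply (w ξ : Param n) :
    fderiv ℝ c.param w ξ = c.ι ξ + fderiv ℝ c.u w ξ • c.e := by
  rw [(c.hasFDerivAt_param w).fderiv]
  rfl

/-- The projection recovers the parameter and does not increase norms. This is the expansion
hypothesis of the area formula. -/
theorem norm_sub_le_norm_param_sub (x y : Param n) : ‖x - y‖ ≤ ‖c.param x - c.param y‖ := by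
  have := c.norm_T_le (c.param x - c.param y)
  have h : c.T (c.param x - c.param y) = c.proj (c.param x) - c.proj (c.param y) := by
    rw [proj, proj, ← map_sub]; congr 1; abel
  rwa [h, proj_param, proj_param] at this

/-- The Gram operator of the parametrization is `ξ ↦ ξ + Du(ξ) ∇u`, a rank-one perturbation of the
identity with determinant `1 + |∇u|² = J²`. -/
theorem normDet_fderiv_param (w : Param n) :
    (fderiv ℝ c.param w : Param n →ₗ[ℝ] Ambient n).normDet = c.J w := by
  have h := (fderiv ℝ c.param w).normDet_sq
  have hadj : ((fderiv ℝ c.param w).adjoint ∘L fderiv ℝ c.param w : Param n →ₗ[ℝ] Param n) =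
      LinearMap.transvection (fderiv ℝ c.u w : Param n →ₗ[ℝ] ℝ) (gradient c.u w) := by
    ext1 ξ
    apply ext_inner_right ℝ
    intro z
    simp only [ContinuousLinearMap.coe_coe, ContinuousLinearMap.comp_apply,
      ContinuousLinearMap.adjoint_inner_left, LinearMap.transvection.apply, fderiv_param_apply]
    simp only [inner_add_left, inner_add_right, real_inner_smul_left, real_inner_smul_right,
      LinearIsometry.inner_map_map, c.inner_e, inner_e_e, inner_gradient_left]
    rw [show (inner ℝ c.e (c.ι z) : ℝ) = 0 by rw [real_inner_comm, c.inner_e]]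
    ring
  have hdet : ((fderiv ℝ c.param w).adjoint ∘L fderiv ℝ c.param w).det =
      1 + ‖gradient c.u w‖ ^ 2 := by
    rw [ContinuousLinearMap.det, hadj, LinearMap.transvection.det, ← real_inner_self_eq_norm_sq,
      inner_gradient_left]
    rfl
  rw [hdet, ← J_sq] at h
  exact (pow_left_inj₀ (LinearMap.normDet_nonneg _) (c.J_pos w).le two_ne_zero).1 (by simpa using h)

theorem comap_param : Measure.comap c.param μHE[n] =
    volume.withDensity fun w => ENNReal.ofReal (c.J w) := by
  rw [comap_euclideanHausdorffMeasure_eq_withDensity (c.contDiff_param.of_le (by simp))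
    c.norm_sub_le_norm_param_sub]
  simp_rw [normDet_fderiv_param]

theorem measurableEmbedding_param : MeasurableEmbedding c.param :=
  c.contDiff_param.continuous.measurableEmbedding fun x y h => by
    rw [← c.proj_param x, h, proj_param]

theorem measurableSet_inter_dom : MeasurableSet (S ∩ c.dom) := by
  rw [← image_param_ball]
  exact c.measurableEmbedding_param.measurableSet_image.2 measurableSet_ball

theorem restrict_areaMeasure_dom : (areaMeasure S).restrict c.dom =
    Measure.map c.param ((volume.restrict (Metric.ball 0 c.r)).withDensity
      fun w => ENNReal.ofReal (c.J w)) := by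
  rw [areaMeasure, Measure.restrict_restrict c.isOpen_dom.measurableSet, inter_comm,
    ← image_param_ball, ← restrict_withDensity measurableSet_ball, ← comap_param,
    c.measurableEmbedding_param.restrict_comap, c.measurableEmbedding_param.map_comap,
    Measure.restrict_restrict c.measurableEmbedding_param.measurableSet_range,
    inter_eq_self_of_subset_right (image_subset_range _ _)]

/-- Integration over the part of `S` in the cylinder of a graph chart. -/
theorem setIntegral_dom (g : Ambient n → ℝ) :
    ∫ x in c.dom, g x ∂(areaMeasure S) = ∫ w in Metric.ball 0 c.r, c.J w * g (c.param w) := by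
  rw [restrict_areaMeasure_dom, c.measurableEmbedding_param.integral_map]
  rw [integral_withDensity_eq_integral_toReal_smul
    (c.contDiff_J.continuous.measurable.ennreal_ofReal) (by simp)]
  simp_rw [ENNReal.toReal_ofReal (c.J_pos _).le, smul_eq_mul]

include c in
-- Since `param` does not decrease distances, the image of a nonempty open set of parameters has at
-- least the Lebesgue measure of that set.
theorem areaMeasure_pos {V : Set (Ambient n)} (hV : IsOpen V) (hp : p ∈ V) :
    0 < areaMeasure S V := by
  set A : Set (Param n) := c.param ⁻¹' V ∩ Metric.ball 0 c.r with hA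
  have hAo : IsOpen A := (hV.preimage c.contDiff_param.continuous).inter Metric.isOpen_ball
  have hAne : A.Nonempty :=
    ⟨0, by rw [mem_preimage, c.param_zero]; exact hp, Metric.mem_ball_self c.r_pos⟩
  have h1 : (μHE[n] : Measure (Param n)) (id '' A) ≤
      ((1 : NNReal) : ℝ≥0∞) ^ n * (μHE[n] : Measure (Ambient n)) (c.param '' A) :=
    euclideanHausdorffMeasure_image_le_of_dist_le n fun x _ y _ => by
      simpa [dist_eq_norm] using c.norm_sub_le_norm_param_sub x y
  rw [EuclideanSpace.euclideanHausdorffMeasure_eq_volume, image_id] at h1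
  simp only [ENNReal.coe_one, one_pow, one_mul] at h1
  rw [areaMeasure, Measure.restrict_apply hV.measurableSet]
  refine (hAo.measure_pos volume hAne).trans_le (h1.trans (measure_mono ?_))
  rintro _ ⟨w, hw, rfl⟩
  exact ⟨hw.1, c.param_mem hw.2⟩

end GraphChart

end

/-! ### Euclidean integration by parts; mean curvature in a chart -/

section

variable {n : ℕ} {S : Set (Ambient n)} {p : Ambient n}

/-- The trace of an endomorphism. -/
def tr {E : Type*} [NormedAddCommGroup E] [NormedSpace ℝ E] (A : E →L[ℝ] E) : ℝ :=
  LinearMap.trace ℝ E (A : E →ₗ[ℝ] E)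

theorem tr_eq_sum (A : Param n →L[ℝ] Param n) :
    tr A = ∑ i, A (EuclideanSpace.single i 1) i := by
  rw [tr, LinearMap.trace_eq_sum_inner _ (EuclideanSpace.basisFun (Fin n) ℝ)]
  simp [EuclideanSpace.inner_single_left]

/-- A Lipschitz function can be integrated by parts against a compactly supported `C¹` vector
field. -/
theorem abs_integral_mul_divergence_le {X : Param n → Param n} (hX : ContDiff ℝ 1 X)
    (hXc : HasCompactSupport X) {η : Param n → ℝ} {K : NNReal} (hη : LipschitzWith K η) :
    |∫ w, η w * tr (fderiv ℝ X w)| ≤ K * ∫ w, ‖X w‖ := by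
  set E : Fin n → Param n := fun i => EuclideanSpace.single i 1 with hE
  have hXi : ∀ i, ContDiff ℝ 1 (fun w => X w i) := fun i =>
    (EuclideanSpace.proj (𝕜 := ℝ) i).contDiff.comp hX
  have hXic : ∀ i, HasCompactSupport (fun w => X w i) := fun i =>
    hXc.comp_left (g := fun v : Param n => v i) rfl
  have hXd : ∀ w, DifferentiableAt ℝ X w := fun w => (hX.differentiable (by simp)).differentiableAt
  have hder : ∀ i w, fderiv ℝ X w (E i) i = lineDeriv ℝ (fun w => X w i) w (E i) := by
    intro i w
    have h1 : HasFDerivAt (fun w => X w i) ((EuclideanSpace.proj (𝕜 := ℝ) i).comp (fderiv ℝ X w)) w :=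
      (EuclideanSpace.proj (𝕜 := ℝ) i).hasFDerivAt.comp w (hXd w).hasFDerivAt
    rw [(h1.hasLineDerivAt (E i)).lineDeriv]
    rfl
  have hint : ∀ i, Integrable (fun w => η w * lineDeriv ℝ (fun w => X w i) w (E i)) := by
    intro i
    have : (fun w => η w * lineDeriv ℝ (fun w => X w i) w (E i)) =
        fun w => η w * fderiv ℝ X w (E i) i := by
      ext w; rw [hder]
    rw [this]
    apply Continuous.integrable_of_hasCompactSupport
    · have : Continuous (fun w => fderiv ℝ X w (E i) i) :=
        (EuclideanSpace.proj (𝕜 := ℝ) i).continuous.comp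
          ((hX.continuous_fderiv (by simp)).clm_apply continuous_const)
      exact hη.continuous.mul this
    · refine HasCompactSupport.mul_left ?_
      exact (hXc.fderiv (𝕜 := ℝ)).comp_left (g := fun A : Param n →L[ℝ] Param n => A (E i) i)
        (by simp)
  have hlip : ∀ i, ∃ D, LipschitzWith D (fun w => X w i) := fun i =>
    (hXi i).lipschitzWith_of_hasCompactSupport (hXic i) (by simp)
  have hparts : ∀ i, ∫ w, η w * lineDeriv ℝ (fun w => X w i) w (E i) =
      - ∫ w, lineDeriv ℝ η w (E i) * X w i := by
    intro i
    obtain ⟨D, hD⟩ := hlip i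
    -- Taking the direction `-(E i)` puts the sign on the derivative of `η`.
    have := hη.integral_lineDeriv_mul_eq hD (hXic i) (-(E i)) (μ := volume)
    simp only [lineDeriv_neg, neg_neg, neg_mul, integral_neg] at this
    rw [this]
    simp_rw [mul_comm]
  have hint2 : ∀ i, Integrable (fun w => lineDeriv ℝ η w (E i) * X w i) := by
    intro i
    have := (hη.locallyIntegrable_lineDeriv (μ := volume) (E i)).integrable_smul_left_of_hasCompactSupport
      (hXi i).continuous (hXic i)
    simpa [mul_comm] using this
  have hsum : ∫ w, η w * tr (fderiv ℝ X w) = - ∫ w, ∑ i, lineDeriv ℝ η w (E i) * X w i := by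
    rw [integral_finsetSum _ (fun i _ => hint2 i)]
    simp_rw [tr_eq_sum, Finset.mul_sum]
    rw [integral_finsetSum]
    · rw [← Finset.sum_neg_distrib]
      refine Finset.sum_congr rfl fun i _ => ?_
      rw [← hparts i]
      simp_rw [← hder]
      rfl
    · intro i _
      have := hint i
      simp_rw [← hder] at this
      exact this
  rw [hsum, abs_neg, ← integral_const_mul, ← Real.norm_eq_abs]
  apply norm_integral_le_of_norm_le
  · exact ((hX.continuous.norm.integrable_of_hasCompactSupport hXc.norm).const_mul _)
  -- By Rademacher's theorem the sum is `Dη(X)` almost everywhere, with `‖Dη‖ ≤ K`.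
  · filter_upwards [hη.ae_differentiableAt] with w hw
    have h1 : ∑ i, lineDeriv ℝ η w (E i) * X w i = fderiv ℝ η w (X w) := by
      have h2 : X w = ∑ i, X w i • E i := by
        have := (EuclideanSpace.basisFun (Fin n) ℝ).sum_repr (X w)
        simpa [hE] using this.symm
      conv_rhs => rw [h2, _root_.map_sum]
      refine Finset.sum_congr rfl fun i _ => ?_
      rw [hw.lineDeriv_eq_fderiv, map_smul, smul_eq_mul, mul_comm]
    rw [h1]
    exact ((fderiv ℝ η w).le_opNorm _).trans
      (mul_le_mul_of_nonneg_right (norm_fderiv_le_of_lipschitz ℝ hη) (norm_nonneg _))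

namespace GraphChart

variable (c : GraphChart S p)

/-- The defining function of `S` given by the graph chart. -/
def fn (x : Ambient n) : ℝ := c.height x - c.u (c.proj x)

theorem contDiff_fn : ContDiff ℝ ∞ c.fn := c.contDiff_height.sub (c.smooth.comp c.contDiff_proj)

theorem hasFDerivAt_proj (x : Ambient n) : HasFDerivAt c.proj c.T x := by
  have : c.proj = fun y => c.T y - c.T p := by ext1 y; rw [proj, map_sub]
  rw [this]
  exact c.T.hasFDerivAt.sub_const _

theorem gradient_fn (x : Ambient n) : gradient c.fn x = c.conormal (c.proj x) := by
  apply HasGradientAt.gradient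
  rw [hasGradientAt_iff_hasFDerivAt]
  have h1 : HasFDerivAt c.height (innerSL ℝ c.e) x := by
    have h2 : c.height = fun y => innerSL ℝ c.e y - innerSL ℝ c.e p := by
      ext y
      rw [height, inner_sub_left, innerSL_apply_apply, innerSL_apply_apply, real_inner_comm,
        real_inner_comm p]
    rw [h2]
    exact (innerSL ℝ c.e).hasFDerivAt.sub_const _
  have h3 : HasFDerivAt (fun x => c.u (c.proj x)) ((fderiv ℝ c.u (c.proj x)).comp c.T) x :=
    (c.smooth.differentiable (by simp)).differentiableAt.hasFDerivAt.comp x (c.hasFDerivAt_proj x)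
  refine (h1.sub h3).congr_fderiv ?_
  ext v
  have h4 : fderiv ℝ c.u (c.proj x) (c.T v) = inner ℝ (c.ι (gradient c.u (c.proj x))) v := by
    rw [← inner_gradient_left, real_inner_comm v, ← c.inner_T, real_inner_comm]
  rw [InnerProductSpace.toDual_apply_apply, conormal, inner_sub_left, ← h4]
  rfl

theorem isDefiningFunction : IsDefiningFunction S c.dom c.fn where
  isOpen := c.isOpen_dom
  smooth := c.contDiff_fn.contDiffOn
  gradient_ne_zero x _ := by rw [gradient_fn]; exact c.conormal_ne_zero _
  inter_eq := by
    ext x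
    constructor
    · rintro ⟨hS, hx⟩
      exact ⟨hx, by rw [fn, (c.mem_iff_of_dom hx).1 hS, sub_self]⟩
    · rintro ⟨hx, h⟩
      exact ⟨(c.mem_iff_of_dom hx).2 (sub_eq_zero.1 h), hx⟩

theorem unitNormal_fn : unitNormal c.fn = fun x => c.ν (c.proj x) := by
  ext1 x
  rw [unitNormal, gradient_fn]
  rfl

theorem differentiable_ν : Differentiable ℝ c.ν := c.contDiff_ν.differentiable (by simp)

theorem inner_fderiv_ν (w ξ : Param n) : (inner ℝ (fderiv ℝ c.ν w ξ) (c.ν w) : ℝ) = 0 := by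
  have h1 : HasFDerivAt c.ν (fderiv ℝ c.ν w) w := (c.differentiable_ν w).hasFDerivAt
  have h2 := h1.norm_sq
  have h3 : (fun w => ‖c.ν w‖ ^ 2) = fun _ => 1 := by
    ext w; rw [norm_ν, one_pow]
  rw [h3] at h2
  have h4 := congrArg (fun A : Param n →L[ℝ] ℝ => A ξ) (h2.unique (hasFDerivAt_const _ _))
  simp only [_root_.smul_apply, ContinuousLinearMap.comp_apply, innerSL_apply_apply,
    zero_apply] at h4
  rw [real_inner_comm]
  simpa using h4

/-- The unit normal of `fn` is `ν ∘ proj`, constant in the direction `e`. Its normal derivative has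
no normal component because `|ν| = 1`, and cyclicity of the trace moves the computation to the
parameter space. -/
theorem meanCurvature_fn (x : Ambient n) :
    meanCurvature c.fn x = tr (c.T ∘L fderiv ℝ c.ν (c.proj x)) := by
  have h1 : fderiv ℝ (unitNormal c.fn) x = fderiv ℝ c.ν (c.proj x) ∘L c.T := by
    rw [unitNormal_fn]
    exact ((c.differentiable_ν _).hasFDerivAt.comp x (c.hasFDerivAt_proj x)).fderiv
  rw [meanCurvature, h1, unitNormal_fn, ContinuousLinearMap.comp_apply, inner_fderiv_ν, sub_zero, tr]
  exact LinearMap.trace_comp_comm' (c.T : Ambient n →ₗ[ℝ] Param n)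
    (fderiv ℝ c.ν (c.proj x) : Param n →ₗ[ℝ] Ambient n)

theorem shrinker_eq (hS : SatisfiesShrinkerEquation S) {w : Param n}
    (hw : w ∈ Metric.ball 0 c.r) :
    tr (c.T ∘L fderiv ℝ c.ν w) = inner ℝ (c.param w) (c.ν w) / 2 := by
  have := hS c.dom c.fn c.isDefiningFunction (c.param w) ⟨c.param_mem hw, c.param_mem_dom hw⟩
  rw [meanCurvature_fn, unitNormal_fn, proj_param] at this
  simpa using this

end GraphChart

end

/-! ### Unit normals and the corrected divergence -/

section

variable {n : ℕ} {S : Set (Ambient n)} {p : Ambient n}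

/-- Unit normals given by different defining functions agree up to sign. -/
theorem unitNormal_eq_or_neg {U V : Set (Ambient n)} {f g : Ambient n → ℝ}
    (hf : IsDefiningFunction S U f) (hg : IsDefiningFunction S V g) {x : Ambient n} (hx : x ∈ S)
    (hxU : x ∈ U) (hxV : x ∈ V) :
    unitNormal f x = unitNormal g x ∨ unitNormal f x = -unitNormal g x := by
  obtain ⟨c, hc⟩ := hg.exists_graphChart ⟨hx, hxV⟩
  rw [← hc]
  have hfN := norm_unitNormal (hf.gradient_ne_zero x hxU)
  have h1 : HasFDerivAt (fun w => f (c.param w))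
      -- As `Du(0) = 0`, the derivative of the parametrization at `0` is `ι`. Differentiating `f ∘
      -- param = 0` shows that `∇f` has no component in the range of `ι`, hence is a multiple of
      -- `e`.
      (fderiv ℝ f x ∘L (c.ι.toContinuousLinearMap + (fderiv ℝ c.u 0).smulRight c.e)) 0 := by
    have : HasFDerivAt f (fderiv ℝ f x) (c.param 0) := by
      rw [c.param_zero]; exact (hf.differentiableAt hxU).hasFDerivAt
    exact this.comp 0 (c.hasFDerivAt_param 0)
  have h2 : (fun w => f (c.param w)) =ᶠ[𝓝 0] fun _ => 0 := by
    have hU : ∀ᶠ w in 𝓝 (0 : Param n), c.param w ∈ U :=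
      c.contDiff_param.continuous.continuousAt.eventually
        (by rw [c.param_zero]; exact hf.isOpen.mem_nhds hxU)
    filter_upwards [hU, Metric.ball_mem_nhds 0 c.r_pos] with w hw hwr
    exact (hf.mem_iff hw).1 (c.param_mem hwr)
  have h3 := h1.unique ((hasFDerivAt_const (0 : ℝ) _).congr_of_eventuallyEq h2)
  have h4 : c.T (gradient f x) = 0 := by
    apply ext_inner_right ℝ
    intro ξ
    have := congrArg (fun A : Param n →L[ℝ] ℝ => A ξ) h3
    simp only [c.fderiv_u_zero] at this
    rw [c.inner_T, inner_gradient_left, inner_zero_left]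
    simpa using this
  have h5 : unitNormal f x = (inner ℝ (unitNormal f x) c.e : ℝ) • c.e := by
    conv_lhs => rw [c.decomp' (unitNormal f x)]
    rw [unitNormal, map_smul, h4, smul_zero, map_zero, zero_add]
  set a : ℝ := inner ℝ (unitNormal f x) c.e
  have h6 : |a| = 1 := by
    rw [h5, norm_smul, c.norm_e, mul_one, Real.norm_eq_abs] at hfN
    exact hfN
  rcases (abs_eq zero_le_one).1 h6 with h | h
  · left; rw [h5, h, one_smul]
  · right; rw [h5, h, neg_one_smul]

open Classical in
/-- A (possibly discontinuous) choice of a unit normal of `S`. -/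
def normal (S : Set (Ambient n)) (x : Ambient n) : Ambient n :=
  if h : ∃ (U : Set (Ambient n)) (f : Ambient n → ℝ), x ∈ S ∧ x ∈ U ∧ IsDefiningFunction S U f then
    unitNormal h.choose_spec.choose x
  else 0

theorem normal_eq_or_neg {V : Set (Ambient n)} {g : Ambient n → ℝ}
    (hg : IsDefiningFunction S V g) {x : Ambient n} (hx : x ∈ S) (hxV : x ∈ V) :
    normal S x = unitNormal g x ∨ normal S x = -unitNormal g x := by
  have h : ∃ (U : Set (Ambient n)) (f : Ambient n → ℝ), x ∈ S ∧ x ∈ U ∧ IsDefiningFunction S U f :=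
    ⟨V, g, hx, hxV, hg⟩
  rw [normal, dif_pos h]
  exact unitNormal_eq_or_neg h.choose_spec.choose_spec.2.2 hg hx h.choose_spec.choose_spec.2.1 hxV

theorem norm_normal (hS : IsEmbeddedHypersurface S) {x : Ambient n} (hx : x ∈ S) :
    ‖normal S x‖ = 1 := by
  obtain ⟨U, f, hxU, hf⟩ := hS x hx
  have h := norm_unitNormal (hf.gradient_ne_zero x hxU)
  rcases normal_eq_or_neg hf hx hxU with h1 | h1
  · rw [h1, h]
  · rw [h1, norm_neg, h]

/-- The divergence along `S` of `W`, corrected by the mean curvature of a self-shrinker. -/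
def shrinkerDiv (S : Set (Ambient n)) (W : Ambient n → Ambient n) (x : Ambient n) : ℝ :=
  tr (fderiv ℝ W x) - inner ℝ (fderiv ℝ W x (normal S x)) (normal S x) -
    inner ℝ x (normal S x) * inner ℝ (W x) (normal S x) / 2

/-- The expression is quadratic in the normal, so the arbitrary signs in `normal` are harmless. -/
theorem shrinkerDiv_eq_of_normal_eq_or_neg {W : Ambient n → Ambient n} {x N : Ambient n}
    (h : normal S x = N ∨ normal S x = -N) :
    shrinkerDiv S W x = tr (fderiv ℝ W x) - inner ℝ (fderiv ℝ W x N) N -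
      inner ℝ x N * inner ℝ (W x) N / 2 := by
  rcases h with h | h <;> rw [shrinkerDiv, h]
  simp

theorem tr_add {E : Type*} [NormedAddCommGroup E] [NormedSpace ℝ E] (A B : E →L[ℝ] E) :
    tr (A + B) = tr A + tr B := by
  simp [tr]

theorem tr_sub {E : Type*} [NormedAddCommGroup E] [NormedSpace ℝ E] (A B : E →L[ℝ] E) :
    tr (A - B) = tr A - tr B := by
  simp [tr]

theorem tr_smul {E : Type*} [NormedAddCommGroup E] [NormedSpace ℝ E] (a : ℝ) (A : E →L[ℝ] E) :
    tr (a • A) = a * tr A := by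
  simp [tr]

theorem tr_smulRight {E : Type*} [NormedAddCommGroup E] [NormedSpace ℝ E] [FiniteDimensional ℝ E]
    (l : E →L[ℝ] ℝ) (v : E) : tr (l.smulRight v) = l v := by
  have : (l.smulRight v : E →ₗ[ℝ] E) = (l : E →ₗ[ℝ] ℝ).smulRight v := rfl
  rw [tr, this, LinearMap.trace_smulRight]
  rfl

theorem tr_comp_comm {E F : Type*} [NormedAddCommGroup E] [NormedSpace ℝ E] [FiniteDimensional ℝ E]
    [NormedAddCommGroup F] [NormedSpace ℝ F] [FiniteDimensional ℝ F]
    (A : E →L[ℝ] F) (B : F →L[ℝ] E) : tr (A ∘L B) = tr (B ∘L A) :=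
  LinearMap.trace_comp_comm' (B : F →ₗ[ℝ] E) (A : E →ₗ[ℝ] F)

namespace GraphChart

variable (c : GraphChart S p)

theorem normal_param {w : Param n} (hw : w ∈ Metric.ball 0 c.r) :
    normal S (c.param w) = c.ν w ∨ normal S (c.param w) = -c.ν w := by
  have := normal_eq_or_neg c.isDefiningFunction (c.param_mem hw) (c.param_mem_dom hw)
  simpa only [unitNormal_fn, proj_param] using this

/-- The divergence along the graph, in terms of the derivative in the parameter. -/
theorem tr_sub_inner_eq (A : Ambient n →L[ℝ] Ambient n) (w : Param n) :
    tr A - inner ℝ (A (c.ν w)) (c.ν w) =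
      tr (c.T ∘L (A ∘L fderiv ℝ c.param w)) -
        inner ℝ (A (fderiv ℝ c.param w (c.T (c.ν w)))) (c.ν w) := by
  have hJ := c.J_pos w
  have hDΦ : fderiv ℝ c.param w =
      c.ι.toContinuousLinearMap + (fderiv ℝ c.u w).smulRight c.e := (c.hasFDerivAt_param w).fderiv
  have h1 : tr A = tr (c.T ∘L (A ∘L c.ι.toContinuousLinearMap)) + inner ℝ (A c.e) c.e := by
    have hA : A = (A ∘L c.ι.toContinuousLinearMap) ∘L c.T + (innerSL ℝ c.e).smulRight (A c.e) := by
      ext1 v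
      conv_lhs => rw [c.decomp' v]
      rw [map_add, map_smul, real_inner_comm]
      rfl
    conv_lhs => rw [hA]
    rw [tr_add, tr_smulRight, tr_comp_comm, innerSL_apply_apply, real_inner_comm]
  have h2 : c.T ∘L (A ∘L fderiv ℝ c.param w) = c.T ∘L (A ∘L c.ι.toContinuousLinearMap) +
      (fderiv ℝ c.u w).smulRight (c.T (A c.e)) := by
    rw [hDΦ]
    ext1 v
    simp
  -- The tangent vector of the graph lying over `T ν` differs from `ν` by a multiple of `e`, and the
  -- multiple must be `J` since `⟨ν, e⟩ = 1/J` and `Du(∇u) = J² - 1`.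
  have h3 : fderiv ℝ c.param w (c.T (c.ν w)) = c.ν w - c.J w • c.e := by
    have hT : c.T (c.ν w) = -((c.J w)⁻¹ • gradient c.u w) := by
      rw [ν, map_smul, T_conormal, smul_neg]
    have hu : fderiv ℝ c.u w (gradient c.u w) = c.J w ^ 2 - 1 := by
      rw [← inner_gradient_left, real_inner_self_eq_norm_sq, J_sq]; ring
    have h : (c.J w)⁻¹ * (c.J w ^ 2 - 1) = c.J w - (c.J w)⁻¹ := by field_simp
    rw [fderiv_param_apply, hT, map_neg, map_neg, map_smul, map_smul, hu, ν, conormal,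
      smul_eq_mul, h]
    module
  have h4 : c.J w * inner ℝ (A c.e) (c.ν w) =
      inner ℝ (A c.e) c.e - fderiv ℝ c.u w (c.T (A c.e)) := by
    rw [← real_inner_smul_right, J_smul_ν, conormal, inner_sub_right, ← inner_T,
      ← inner_gradient_left, real_inner_comm (c.T _)]
  rw [h1, h2, tr_add, tr_smulRight, h3, map_sub, map_smul, inner_sub_left, real_inner_smul_left, h4]
  ring

/-- The parameter components of the tangential part of a field along the graph. -/
def tang (Y : Param n → Ambient n) (w : Param n) : Param n :=
  c.T (Y w - (inner ℝ (Y w) (c.ν w) : ℝ) • c.ν w)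

/-- The derivative of the gradient is the Hessian of `u`, which is symmetric because `u` is smooth.
-/
theorem inner_fderiv_gradient_symm (w ξ η : Param n) :
    (inner ℝ (fderiv ℝ (gradient c.u) w ξ) η : ℝ) = inner ℝ (fderiv ℝ (gradient c.u) w η) ξ := by
  have hd : HasFDerivAt (gradient c.u) (fderiv ℝ (gradient c.u) w) w :=
    (c.contDiff_gradient.differentiable (by simp)).differentiableAt.hasFDerivAt
  have key : ∀ ζ z : Param n, (inner ℝ (fderiv ℝ (gradient c.u) w ζ) z : ℝ) =
      fderiv ℝ (fderiv ℝ c.u) w ζ z := by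
    intro ζ z
    have h1 : HasFDerivAt (fun v => fderiv ℝ c.u v z) ((fderiv ℝ (fderiv ℝ c.u) w).flip z) w := by
      have : HasFDerivAt (fderiv ℝ c.u) (fderiv ℝ (fderiv ℝ c.u) w) w :=
        ((c.smooth.fderiv_right (m := ∞) (by simp)).differentiable (by simp)).differentiableAt.hasFDerivAt
      have := this.clm_apply (hasFDerivAt_const z w)
      simpa using this
    have h2 : HasFDerivAt (fun v => (inner ℝ (gradient c.u v) z : ℝ))
        ((innerSL ℝ z) ∘L (fderiv ℝ (gradient c.u) w)) w := by
      have := (innerSL ℝ z).hasFDerivAt.comp w hd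
      have h : (fun v => (inner ℝ (gradient c.u v) z : ℝ)) = innerSL ℝ z ∘ gradient c.u := by
        ext v
        rw [Function.comp_apply, innerSL_apply_apply, real_inner_comm]
      rwa [h]
    have h3 : (fun v => fderiv ℝ c.u v z) = fun v => (inner ℝ (gradient c.u v) z : ℝ) := by
      ext v; rw [inner_gradient_left]
    rw [h3] at h1
    have := congrArg (fun A : Param n →L[ℝ] ℝ => A ζ) (h1.unique h2)
    simp only [ContinuousLinearMap.flip_apply, ContinuousLinearMap.comp_apply,
      innerSL_apply_apply] at this
    rw [this, real_inner_comm]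
  rw [key, key]
  exact (c.smooth.contDiffAt.isSymmSndFDerivAt (by
    rw [minSmoothness_of_isRCLikeNormedField]; exact WithTop.coe_le_coe.2 le_top)) ξ η

/-- Symmetry of the second fundamental form, in the form needed for the divergence of tangential
fields. -/
theorem J_mul_inner_fderiv_ν (Y : Param n → Ambient n) (w : Param n) :
    c.J w * inner ℝ (Y w) (fderiv ℝ c.ν w (c.T (c.ν w))) = fderiv ℝ c.J w (c.tang Y w) := by
  have hJd : HasFDerivAt c.J (fderiv ℝ c.J w) w :=
    (c.contDiff_J.differentiable (by simp)).differentiableAt.hasFDerivAt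
  have hνd : HasFDerivAt c.ν (fderiv ℝ c.ν w) w := (c.differentiable_ν w).hasFDerivAt
  have hgd : HasFDerivAt (gradient c.u) (fderiv ℝ (gradient c.u) w) w :=
    (c.contDiff_gradient.differentiable (by simp)).differentiableAt.hasFDerivAt
  -- This is the derivative of `J ν = e - ι ∇u`. Its component along `ν` gives `DJ`, its component
  -- along the tangential vector `τ` gives the left-hand side of the claim, and the two agree by
  -- symmetry of the Hessian.
  have hm : ∀ ξ, c.J w • fderiv ℝ c.ν w ξ + fderiv ℝ c.J w ξ • c.ν w =
      -c.ι (fderiv ℝ (gradient c.u) w ξ) := by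
    intro ξ
    have h1 := hJd.smul hνd
    have h2 : HasFDerivAt c.conormal
        (-(c.ι.toContinuousLinearMap ∘L fderiv ℝ (gradient c.u) w)) w := by
      have := (c.ι.toContinuousLinearMap.hasFDerivAt.comp w hgd).const_sub c.e
      exact this
    have h3 : (fun w => c.J w • c.ν w) = c.conormal := by ext1 w; exact c.J_smul_ν w
    have h1' : HasFDerivAt (fun w => c.J w • c.ν w)
      (c.J w • fderiv ℝ c.ν w + (fderiv ℝ c.J w).smulRight (c.ν w)) w := h1
    rw [h3] at h1'
    have := congrArg (fun A : Param n →L[ℝ] Ambient n => A ξ) (h1'.unique h2)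
    simpa using this
  have hνν : (inner ℝ (c.ν w) (c.ν w) : ℝ) = 1 := by
    rw [real_inner_self_eq_norm_sq, norm_ν, one_pow]
  set τ := Y w - (inner ℝ (Y w) (c.ν w) : ℝ) • c.ν w with hτ
  have hτν : (inner ℝ τ (c.ν w) : ℝ) = 0 := by
    rw [hτ, inner_sub_left, real_inner_smul_left, hνν]; ring
  have hdJ : ∀ ξ, fderiv ℝ c.J w ξ = -inner ℝ (fderiv ℝ (gradient c.u) w ξ) (c.T (c.ν w)) := by
    intro ξ
    have h := congrArg (fun v => (inner ℝ v (c.ν w) : ℝ)) (hm ξ)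
    simp only [inner_add_left, real_inner_smul_left, inner_fderiv_ν, hνν, inner_neg_left] at h
    rw [real_inner_comm (c.T _), inner_T, real_inner_comm (c.ι _)]
    linarith
  have h1 : (inner ℝ (Y w) (fderiv ℝ c.ν w (c.T (c.ν w))) : ℝ) =
      inner ℝ τ (fderiv ℝ c.ν w (c.T (c.ν w))) := by
    rw [hτ, inner_sub_left, real_inner_smul_left, real_inner_comm (fderiv ℝ c.ν w _) (c.ν w),
      inner_fderiv_ν]
    ring
  have h2 := congrArg (fun v => (inner ℝ τ v : ℝ)) (hm (c.T (c.ν w)))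
  simp only [inner_add_right, real_inner_smul_right, hτν, inner_neg_right] at h2
  rw [h1, tang, ← hτ, hdJ, c.inner_fderiv_gradient_symm, real_inner_comm (c.T τ), inner_T]
  linarith

/-- In the parameter of a graph chart, the corrected divergence along a self-shrinker becomes a
Euclidean divergence. -/
theorem J_mul_shrinkerDiv (hS : SatisfiesShrinkerEquation S) {W : Ambient n → Ambient n}
    (hW : Differentiable ℝ W) {w : Param n} (hw : w ∈ Metric.ball 0 c.r) :
    c.J w * shrinkerDiv S W (c.param w) =
      tr (fderiv ℝ (fun z => c.J z • c.tang (fun z => W (c.param z)) z) w) := by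
  set Y : Param n → Ambient n := fun z => W (c.param z) with hY
  set A := fderiv ℝ W (c.param w) with hA
  have hY_d : HasFDerivAt Y (A ∘L fderiv ℝ c.param w) w := by
    refine (hW _).hasFDerivAt.comp w ?_
    exact (c.contDiff_param.differentiable (by simp)).differentiableAt.hasFDerivAt
  have hνd : HasFDerivAt c.ν (fderiv ℝ c.ν w) w := (c.differentiable_ν w).hasFDerivAt
  have hJd : HasFDerivAt c.J (fderiv ℝ c.J w) w :=
    (c.contDiff_J.differentiable (by simp)).differentiableAt.hasFDerivAt
  set B := A ∘L fderiv ℝ c.param w with hB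
  set hh : Param n → ℝ := fun z => inner ℝ (Y z) (c.ν z) with hhh
  obtain ⟨dh, hdh, hdhv⟩ : ∃ dh : Param n →L[ℝ] ℝ, HasFDerivAt hh dh w ∧
      ∀ ξ, dh ξ = inner ℝ (Y w) (fderiv ℝ c.ν w ξ) + inner ℝ (B ξ) (c.ν w) :=
    ⟨_, hY_d.inner ℝ hνd, fun ξ => by simp⟩
  have htang : HasFDerivAt (c.tang Y)
      (c.T ∘L (B - (hh w • fderiv ℝ c.ν w + dh.smulRight (c.ν w)))) w :=
    c.T.hasFDerivAt.comp w (hY_d.sub (hdh.smul hνd))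
  have hX : HasFDerivAt (fun z => c.J z • c.tang Y z)
      (c.J w • (c.T ∘L (B - (hh w • fderiv ℝ c.ν w + dh.smulRight (c.ν w)))) +
        (fderiv ℝ c.J w).smulRight (c.tang Y w)) w := hJd.smul htang
  have hT : c.T ∘L (B - (hh w • fderiv ℝ c.ν w + dh.smulRight (c.ν w))) =
      c.T ∘L B - (hh w • (c.T ∘L fderiv ℝ c.ν w) + dh.smulRight (c.T (c.ν w))) := by
    ext1 v
    simp
  rw [hX.fderiv, tr_add, tr_smul, tr_smulRight, hT, tr_sub, tr_add, tr_smul, tr_smulRight, hdhv,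
    shrinkerDiv_eq_of_normal_eq_or_neg (c.normal_param hw), c.tr_sub_inner_eq, ← c.J_mul_inner_fderiv_ν]
  simp only [hB, hhh, ContinuousLinearMap.comp_apply, hY]
  have hsh := c.shrinker_eq hS hw
  -- After expansion the two sides differ only in the normal component of `W`, which appears with
  -- the mean curvature on one side and with `⟨x, ν⟩ / 2` on the other.
  linear_combination (c.J w * inner ℝ (W (c.param w)) (c.ν w)) * hsh

end GraphChart

end

/-! ### First variation inside one chart -/

section

variable {n : ℕ} {S : Set (Ambient n)} {p : Ambient n}

theorem tr_zero {E : Type*} [NormedAddCommGroup E] [NormedSpace ℝ E] :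
    tr (0 : E →L[ℝ] E) = 0 := by
  simp [tr]

theorem support_shrinkerDiv_subset (W : Ambient n → Ambient n) :
    Function.support (shrinkerDiv S W) ⊆ tsupport W := by
  intro x hx
  by_contra h
  apply hx
  have h1 : fderiv ℝ W x = 0 := by
    rw [(notMem_tsupport_iff_eventuallyEq.1 h).fderiv_eq]
    simp
  rw [shrinkerDiv, h1, image_eq_zero_of_notMem_tsupport h]
  simp [tr_zero]

namespace GraphChart

variable (c : GraphChart S p)

theorem norm_tang_le (Y : Param n → Ambient n) (w : Param n) : ‖c.tang Y w‖ ≤ ‖Y w‖ := by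
  refine (c.norm_T_le _).trans ?_
  have h : ‖Y w - (inner ℝ (Y w) (c.ν w) : ℝ) • c.ν w‖ ^ 2 =
      ‖Y w‖ ^ 2 - (inner ℝ (Y w) (c.ν w) : ℝ) ^ 2 := by
    rw [norm_sub_sq_real, real_inner_smul_right, norm_smul, norm_ν, mul_one, Real.norm_eq_abs,
      sq_abs]
    ring
  refine (sq_le_sq₀ (norm_nonneg _) (norm_nonneg _)).1 ?_
  rw [h]
  linarith [sq_nonneg (inner ℝ (Y w) (c.ν w) : ℝ)]

theorem contDiff_tang {Y : Param n → Ambient n} (hY : ContDiff ℝ 1 Y) : ContDiff ℝ 1 (c.tang Y) := by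
  have hν : ContDiff ℝ 1 c.ν := c.contDiff_ν.of_le (by simp)
  exact c.T.contDiff.comp (hY.sub ((hY.inner ℝ hν).smul hν))

/-- The first variation formula for a field supported in the domain of a graph chart, tested
against a function that is Lipschitz along `S`. -/
theorem abs_integral_mul_shrinkerDiv_le (hS : SatisfiesShrinkerEquation S)
    {W : Ambient n → Ambient n} (hW : ContDiff ℝ 1 W) (hsub : tsupport W ⊆ c.dom)
    {η : Ambient n → ℝ} {K : NNReal}
    (hη : LipschitzOnWith K (fun w => η (c.param w)) (Metric.ball 0 c.r)) :
    |∫ x, η x * shrinkerDiv S W x ∂(areaMeasure S)| ≤ K * ∫ x, ‖W x‖ ∂(areaMeasure S) := by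
  set Y : Param n → Ambient n := fun z => W (c.param z) with hY
  set X : Param n → Param n := fun z => c.J z • c.tang Y z with hX
  have hYc : ContDiff ℝ 1 Y := hW.comp (c.contDiff_param.of_le (by simp))
  have hXc : ContDiff ℝ 1 X := (c.contDiff_J.of_le (by simp)).smul (c.contDiff_tang hYc)
  set Z : Set (Param n) := c.param ⁻¹' tsupport W with hZ
  have hZc : IsClosed Z := (isClosed_tsupport W).preimage c.contDiff_param.continuous
  have hZb : Z ⊆ Metric.ball 0 c.r := by
    intro w hw
    have := (hsub hw).1
    rwa [proj_param] at this
  have hZk : IsCompact Z := Metric.isCompact_of_isClosed_isBounded hZc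
    (Metric.isBounded_ball.subset hZb)
  have hY0 : ∀ w, w ∉ Z → Y w = 0 := fun w hw =>
    image_eq_zero_of_notMem_tsupport (f := W) hw
  have hX0 : ∀ w, w ∉ Z → X w = 0 := by
    intro w hw
    have : c.tang Y w = 0 := by
      have := c.norm_tang_le Y w
      rw [hY0 w hw, norm_zero] at this
      exact norm_le_zero_iff.1 this
    rw [hX]
    simp only [this, smul_zero]
  have hXs : HasCompactSupport X := HasCompactSupport.intro hZk hX0
  have hDX0 : ∀ w, w ∉ Metric.ball 0 c.r → fderiv ℝ X w = 0 := by
    intro w hw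
    have h1 : X =ᶠ[𝓝 w] fun _ => 0 := by
      filter_upwards [hZc.isOpen_compl.mem_nhds (fun h => hw (hZb h))] with z hz using hX0 z hz
    rw [h1.fderiv_eq]
    simp
  -- `η` is controlled only over the ball. A Lipschitz extension with the same constant may replace
  -- it, since the field vanishes off a compact part of the ball.
  obtain ⟨g, hg, hgη⟩ := hη.extend_real
  have hleft : ∫ x, η x * shrinkerDiv S W x ∂(areaMeasure S) =
      ∫ w, g w * tr (fderiv ℝ X w) := by
    have h1 := setIntegral_eq_integral_of_forall_compl_eq_zero (s := c.dom) (μ := areaMeasure S)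
      (f := fun x => η x * shrinkerDiv S W x) (fun x hx => by
        have : shrinkerDiv S W x = 0 := by
          by_contra h
          exact hx (hsub (support_shrinkerDiv_subset W h))
        rw [this, mul_zero])
    have h2 := setIntegral_eq_integral_of_forall_compl_eq_zero (s := Metric.ball 0 c.r)
      (μ := volume) (f := fun w => g w * tr (fderiv ℝ X w)) (fun w hw => by
        rw [hDX0 w hw, tr_zero, mul_zero])
    rw [← h1, c.setIntegral_dom, ← h2]
    refine setIntegral_congr_fun measurableSet_ball fun w hw => ?_
    have h3 := hgη hw
    simp only at h3
    rw [mul_left_comm, c.J_mul_shrinkerDiv hS (hW.differentiable (by simp)) hw, h3]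
  have hright : ∫ x, ‖W x‖ ∂(areaMeasure S) = ∫ w, c.J w * ‖Y w‖ := by
    have h1 := setIntegral_eq_integral_of_forall_compl_eq_zero (s := c.dom) (μ := areaMeasure S)
      (f := fun x => ‖W x‖) (fun x hx => by
        rw [image_eq_zero_of_notMem_tsupport (fun h => hx (hsub h)), norm_zero])
    have h2 := setIntegral_eq_integral_of_forall_compl_eq_zero (s := Metric.ball 0 c.r)
      (μ := volume) (f := fun w => c.J w * ‖Y w‖) (fun w hw => by
        rw [hY0 w (fun h => hw (hZb h)), norm_zero, mul_zero])
    rw [← h1, c.setIntegral_dom, ← h2]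
  rw [hleft, hright]
  refine (abs_integral_mul_divergence_le hXc hXs hg).trans ?_
  refine mul_le_mul_of_nonneg_left ?_ K.coe_nonneg
  refine integral_mono (hXc.continuous.norm.integrable_of_hasCompactSupport hXs.norm) ?_ ?_
  · apply Continuous.integrable_of_hasCompactSupport
    · exact c.contDiff_J.continuous.mul hYc.continuous.norm
    · exact HasCompactSupport.intro hZk fun w hw => by rw [hY0 w hw, norm_zero, mul_zero]
  · intro w
    simp only [hX, norm_smul, Real.norm_eq_abs, abs_of_pos (c.J_pos w)]
    exact mul_le_mul_of_nonneg_left (c.norm_tang_le Y w) (c.J_pos w).le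

end GraphChart

end

/-! ### Path length and the intrinsic distance -/

section

variable {n : ℕ} {S : Set (Ambient n)} {p : Ambient n}

/-- The length of a curve on `[a, b]`. -/
def pathLength (γ : ℝ → Ambient n) (a b : ℝ) : ℝ≥0∞ := ∫⁻ t in Icc a b, ‖deriv γ t‖ₑ

section PathLength

variable {γ γ' : ℝ → Ambient n} {a b c : ℝ}

theorem pathLength_eq_lintegral_Ioo : pathLength γ a b = ∫⁻ t in Ioo a b, ‖deriv γ t‖ₑ := by
  rw [pathLength, restrict_Ioo_eq_restrict_Icc]

theorem pathLength_eq_lintegral_derivWithin :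
    pathLength γ a b = ∫⁻ t in Icc a b, ‖derivWithin γ (Icc a b) t‖ₑ := by
  rw [pathLength_eq_lintegral_Ioo, ← restrict_Ioo_eq_restrict_Icc]
  refine setLIntegral_congr_fun measurableSet_Ioo fun t ht => ?_
  rw [derivWithin_of_mem_nhds (Icc_mem_nhds ht.1 ht.2)]

theorem curveLength_eq_pathLength : curveLength γ = pathLength γ 0 1 :=
  pathLength_eq_lintegral_derivWithin.symm

theorem pathLength_congr_Ioo (h : EqOn γ γ' (Ioo a b)) : pathLength γ a b = pathLength γ' a b := by
  simp only [pathLength_eq_lintegral_Ioo]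
  refine setLIntegral_congr_fun measurableSet_Ioo fun t ht => ?_
  have : γ =ᶠ[𝓝 t] γ' := by
    filter_upwards [Ioo_mem_nhds ht.1 ht.2] with s hs using h hs
  rw [this.deriv_eq]

theorem pathLength_add (h : a ≤ b) (h' : b ≤ c) :
    pathLength γ a b + pathLength γ b c = pathLength γ a c := by
  symm
  have : Icc a c = Icc a b ∪ Ioc b c := (Icc_union_Ioc_eq_Icc h h').symm
  rw [pathLength, this, lintegral_union measurableSet_Ioc]
  · simp [restrict_Ioc_eq_restrict_Icc, pathLength]
  · exact disjoint_iff_forall_ne.mpr (fun a ha b hb ↦ (ha.2.trans_lt hb.1).ne)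

theorem pathLength_comp_of_monotoneOn {f : ℝ → ℝ} (h : a ≤ b) (hf : MonotoneOn f (Icc a b))
    (h'f : DifferentiableOn ℝ f (Icc a b)) (hγ : DifferentiableOn ℝ γ (Icc (f a) (f b))) :
    pathLength (γ ∘ f) a b = pathLength γ (f a) (f b) := by
  rcases h.eq_or_lt with rfl | h
  · simp [pathLength]
  have f_im : f '' (Icc a b) = Icc (f a) (f b) := h'f.continuousOn.image_Icc_of_monotoneOn h.le hf
  have B (t) (ht : t ∈ Icc a b) : HasDerivWithinAt f (derivWithin f (Icc a b) t) (Icc a b) t :=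
    (h'f t ht).hasDerivWithinAt
  simp only [pathLength_eq_lintegral_derivWithin]
  rw [← f_im, lintegral_image_eq_lintegral_deriv_mul_of_monotoneOn measurableSet_Icc B hf]
  refine setLIntegral_congr_fun measurableSet_Icc fun t ht => ?_
  have h1 : derivWithin (γ ∘ f) (Icc a b) t =
      derivWithin f (Icc a b) t • derivWithin γ (f '' Icc a b) (f t) := by
    rw [← f_im] at hγ
    have h2 := (hγ (f t) (mem_image_of_mem f ht)).hasDerivWithinAt
    have h3 := h2.scomp t (B t ht) (mapsTo_image f _)
    exact h3.derivWithin (uniqueDiffOn_Icc h t ht)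
  have h4 : 0 ≤ derivWithin f (Icc a b) t := hf.derivWithin_nonneg
  rw [h1, enorm_smul, Real.enorm_of_nonneg h4]

theorem pathLength_comp_of_antitoneOn {f : ℝ → ℝ} (h : a ≤ b) (hf : AntitoneOn f (Icc a b))
    (h'f : DifferentiableOn ℝ f (Icc a b)) (hγ : DifferentiableOn ℝ γ (Icc (f b) (f a))) :
    pathLength (γ ∘ f) a b = pathLength γ (f b) (f a) := by
  rcases h.eq_or_lt with rfl | h
  · simp [pathLength]
  have f_im : f '' (Icc a b) = Icc (f b) (f a) := h'f.continuousOn.image_Icc_of_antitoneOn h.le hf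
  have B (t) (ht : t ∈ Icc a b) : HasDerivWithinAt f (derivWithin f (Icc a b) t) (Icc a b) t :=
    (h'f t ht).hasDerivWithinAt
  simp only [pathLength_eq_lintegral_derivWithin]
  rw [← f_im, lintegral_image_eq_lintegral_deriv_mul_of_antitoneOn measurableSet_Icc B hf]
  refine setLIntegral_congr_fun measurableSet_Icc fun t ht => ?_
  have h1 : derivWithin (γ ∘ f) (Icc a b) t =
      derivWithin f (Icc a b) t • derivWithin γ (f '' Icc a b) (f t) := by
    rw [← f_im] at hγ
    have h2 := (hγ (f t) (mem_image_of_mem f ht)).hasDerivWithinAt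
    have h3 := h2.scomp t (B t ht) (mapsTo_image f _)
    exact h3.derivWithin (uniqueDiffOn_Icc h t ht)
  have h4 : 0 ≤ -derivWithin f (Icc a b) t := by simp [hf.derivWithin_nonpos]
  rw [h1, enorm_smul, ← Real.enorm_of_nonneg h4, enorm_neg]

theorem pathLength_le_of_norm_deriv_le {M : ℝ} (h : ∀ t ∈ Ioo a b, ‖deriv γ t‖ ≤ M) (hab : a ≤ b) :
    pathLength γ a b ≤ ENNReal.ofReal (M * (b - a)) := by
  rcases hab.eq_or_lt with rfl | hab'
  · simp [pathLength]
  have hM : 0 ≤ M := by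
    obtain ⟨t, ht⟩ := nonempty_Ioo.2 hab'
    exact (norm_nonneg _).trans (h t ht)
  rw [pathLength_eq_lintegral_Ioo]
  calc ∫⁻ t in Ioo a b, ‖deriv γ t‖ₑ ≤ ∫⁻ _ in Ioo a b, ENNReal.ofReal M := by
        refine setLIntegral_mono' measurableSet_Ioo fun t ht => ?_
        rw [← ofReal_norm]
        exact ENNReal.ofReal_le_ofReal (h t ht)
    _ = _ := by
      rw [setLIntegral_const, Real.volume_Ioo, ← ENNReal.ofReal_mul hM]

end PathLength

theorem intrinsicEDist_le_pathLength {γ : ℝ → Ambient n} {a b : ℝ} (hab : a ≤ b)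
    (hγ : ContDiffOn ℝ 1 γ (Icc a b)) (hS : MapsTo γ (Icc a b) S) :
    intrinsicEDist S (γ a) (γ b) ≤ pathLength γ a b := by
  set f : ℝ → ℝ := fun t => a + (b - a) * t with hf
  have f0 : f 0 = a := by simp [hf]
  have f1 : f 1 = b := by simp [hf]
  have hmono : Monotone f := fun s t hst => by
    simp only [hf]
    have : 0 ≤ b - a := by linarith
    gcongr
  have hfd : ContDiff ℝ 1 f := by fun_prop
  have hmaps : MapsTo f (Icc 0 1) (Icc a b) := fun t ht =>
    ⟨f0 ▸ hmono ht.1, f1 ▸ hmono ht.2⟩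
  have hc : IsCurveIn S (γ a) (γ b) (γ ∘ f) :=
    ⟨hγ.comp hfd.contDiffOn hmaps, hS.comp hmaps, by simp [f0], by simp [f1]⟩
  refine (iInf₂_le _ hc).trans ?_
  rw [curveLength_eq_pathLength, pathLength_comp_of_monotoneOn zero_le_one (hmono.monotoneOn _)
    (hfd.differentiable (by simp)).differentiableOn]
  · rw [f0, f1]
  · rw [f0, f1]; exact hγ.differentiableOn (by simp)

/-- Precomposition with the smooth step function keeps the length and makes the curve constant
outside `[0, 1]`, so that curves can be concatenated without losing `C¹` regularity. -/
theorem exists_locally_constant_of_intrinsicEDist_lt {x y : Ambient n} {r : ℝ≥0∞}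
    (hr : intrinsicEDist S x y < r) :
    ∃ γ : ℝ → Ambient n, ContDiff ℝ 1 γ ∧ (∀ t, γ t ∈ S) ∧ (∀ t ≤ 0, γ t = x) ∧
      (∀ t, 1 ≤ t → γ t = y) ∧ pathLength γ 0 1 < r := by
  simp only [intrinsicEDist, iInf_lt_iff, exists_prop] at hr
  obtain ⟨γ, hγ, hlen⟩ := hr
  rw [curveLength_eq_pathLength] at hlen
  have hη : ContDiff ℝ 1 Real.smoothTransition := Real.smoothTransition.contDiff
  have hmaps : ∀ t, Real.smoothTransition t ∈ Icc (0 : ℝ) 1 := fun t =>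
    ⟨Real.smoothTransition.nonneg t, Real.smoothTransition.le_one t⟩
  refine ⟨γ ∘ Real.smoothTransition, ?_, fun t => hγ.mapsTo (hmaps t), fun t ht => ?_,
    fun t ht => ?_, ?_⟩
  · rw [← contDiffOn_univ]
    exact hγ.contDiffOn.comp hη.contDiffOn fun t _ => hmaps t
  · rw [Function.comp_apply, Real.smoothTransition.zero_of_nonpos ht, hγ.source]
  · rw [Function.comp_apply, Real.smoothTransition.one_of_one_le ht, hγ.target]
  · rw [pathLength_comp_of_monotoneOn zero_le_one (Real.smoothTransition.monotone.monotoneOn _)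
      (hη.differentiable (by simp)).differentiableOn]
    · rwa [Real.smoothTransition.zero, Real.smoothTransition.one]
    · rw [Real.smoothTransition.zero, Real.smoothTransition.one]
      exact hγ.contDiffOn.differentiableOn (by simp)

theorem intrinsicEDist_self {x : Ambient n} (hx : x ∈ S) : intrinsicEDist S x x = 0 := by
  refine le_antisymm ?_ bot_le
  have := intrinsicEDist_le_pathLength (γ := fun _ => x) (le_refl (0 : ℝ)) contDiffOn_const
    (fun _ _ => hx)
  simpa [pathLength] using this

theorem intrinsicEDist_comm_le (x y : Ambient n) : intrinsicEDist S y x ≤ intrinsicEDist S x y := by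
  refine le_of_forall_gt fun r hr => ?_
  obtain ⟨γ, hγ, hS, h0, h1, hlen⟩ := exists_locally_constant_of_intrinsicEDist_lt hr
  set f : ℝ → ℝ := fun t => 1 - t
  have hf : ContDiff ℝ 1 f := by fun_prop
  have h := intrinsicEDist_le_pathLength (γ := γ ∘ f) (S := S) zero_le_one
    (hγ.comp hf).contDiffOn (fun t _ => hS _)
  have hanti : Antitone f := fun s t hst => by simp only [f]; linarith
  rw [pathLength_comp_of_antitoneOn zero_le_one (hanti.antitoneOn _)
    (hf.differentiable (by simp)).differentiableOn
    (hγ.differentiable (by simp)).differentiableOn] at h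
  simp only [Function.comp_apply, f, sub_zero, sub_self, h0 0 le_rfl, h1 1 le_rfl] at h
  exact h.trans_lt hlen

theorem intrinsicEDist_comm (x y : Ambient n) : intrinsicEDist S x y = intrinsicEDist S y x :=
  le_antisymm (intrinsicEDist_comm_le y x) (intrinsicEDist_comm_le x y)

theorem intrinsicEDist_triangle (x y z : Ambient n) :
    intrinsicEDist S x z ≤ intrinsicEDist S x y + intrinsicEDist S y z := by
  refine le_of_forall_gt fun r hr => ?_
  obtain ⟨u, hu, v, hv, huv⟩ := ENNReal.exists_add_lt_of_add_lt hr
  obtain ⟨γ₁, hγ₁, hS₁, h0₁, h1₁, hlen₁⟩ := exists_locally_constant_of_intrinsicEDist_lt hu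
  obtain ⟨γ₂, hγ₂, hS₂, h0₂, h1₂, hlen₂⟩ := exists_locally_constant_of_intrinsicEDist_lt hv
  -- The second curve is run on `[2, 3]`, so that the two curves are constant where they are glued.
  set γ : ℝ → Ambient n := fun t => γ₁ t + γ₂ (t - 2) - y with hγ
  have hγc : ContDiff ℝ 1 γ := by fun_prop
  have heq1 : ∀ t ≤ 2, γ t = γ₁ t := fun t ht => by
    simp only [hγ]; rw [h0₂ _ (by linarith)]; abel
  have heq2 : ∀ t, 1 ≤ t → γ t = γ₂ (t - 2) := fun t ht => by
    simp only [hγ]; rw [h1₁ _ ht]; abel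
  have hS : ∀ t, γ t ∈ S := by
    intro t
    rcases le_total t 2 with h | h
    · rw [heq1 t h]; exact hS₁ t
    · rw [heq2 t (by linarith)]; exact hS₂ _
  have h := intrinsicEDist_le_pathLength (S := S) (show (0 : ℝ) ≤ 3 by norm_num)
    hγc.contDiffOn (fun t _ => hS t)
  have e0 : γ 0 = x := by rw [heq1 0 (by norm_num), h0₁ 0 le_rfl]
  have e3 : γ 3 = z := by rw [heq2 3 (by norm_num), h1₂ _ (by norm_num)]
  rw [e0, e3, ← pathLength_add (show (0 : ℝ) ≤ 1 by norm_num) (show (1 : ℝ) ≤ 3 by norm_num),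
    ← pathLength_add (show (1 : ℝ) ≤ 2 by norm_num) (show (2 : ℝ) ≤ 3 by norm_num)] at h
  have l1 : pathLength γ 0 1 = pathLength γ₁ 0 1 :=
    pathLength_congr_Ioo fun t ht => heq1 t (by linarith [ht.2])
  have l2 : pathLength γ 1 2 = 0 := by
    rw [pathLength_congr_Ioo (γ' := fun _ => y)]
    · simp [pathLength]
    · intro t ht
      rw [heq1 t ht.2.le, h1₁ t ht.1.le]
  have l3 : pathLength γ 2 3 = pathLength γ₂ 0 1 := by
    have h5 : pathLength γ 2 3 = pathLength (γ₂ ∘ fun t => t - 2) 2 3 :=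
      pathLength_congr_Ioo fun t ht => heq2 t (by linarith [ht.1])
    rw [h5, pathLength_comp_of_monotoneOn (by norm_num)]
    · norm_num
    · intro s _ t _ hst; simpa using hst
    · fun_prop
    · exact (hγ₂.differentiable (by simp)).differentiableOn
  rw [l1, l2, l3, zero_add] at h
  exact h.trans_lt ((ENNReal.add_lt_add hlen₁ hlen₂).trans huv)

theorem edist_le_intrinsicEDist (x y : Ambient n) : edist x y ≤ intrinsicEDist S x y := by
  refine le_iInf₂ fun γ hγ => ?_
  have := enorm_sub_le_lintegral_derivWithin_Icc_of_contDiffOn_Icc hγ.contDiffOn zero_le_one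
  rw [hγ.source, hγ.target] at this
  rw [edist_comm, edist_eq_enorm_sub]
  exact this

/-- A nearly shortest curve is cut at a suitable point. This length-space property is what
Hopf–Rinow uses in place of geodesics. -/
theorem exists_between_of_intrinsicEDist_lt {x y : Ambient n} {r s : ℝ} (hr : 0 < r) (hs : 0 < s)
    (h : intrinsicEDist S x y < ENNReal.ofReal (r + s)) :
    ∃ z ∈ S, intrinsicEDist S x z < ENNReal.ofReal r ∧ intrinsicEDist S z y < ENNReal.ofReal s := by
  obtain ⟨γ, hγ, hS, h0, h1, hlen⟩ := exists_locally_constant_of_intrinsicEDist_lt h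
  have hc : Continuous (fun t => ‖deriv γ t‖) := (hγ.continuous_deriv (by simp)).norm
  have hint : ∀ a b, IntervalIntegrable (fun t => ‖deriv γ t‖) volume a b := fun a b =>
    hc.intervalIntegrable a b
  have hreal : ∀ a b, a ≤ b → pathLength γ a b = ENNReal.ofReal (∫ t in a..b, ‖deriv γ t‖) := by
    intro a b hab
    rw [intervalIntegral.integral_of_le hab, ← integral_Icc_eq_integral_Ioc,
      ofReal_integral_eq_lintegral_ofReal]
    · simp_rw [ofReal_norm]; rfl
    · exact hc.continuousOn.integrableOn_Icc
    · exact Eventually.of_forall fun t => norm_nonneg _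
  set F : ℝ → ℝ := fun t => ∫ s in (0 : ℝ)..t, ‖deriv γ s‖ with hF
  have hFc : Continuous F := intervalIntegral.continuous_primitive hint 0
  have hF0 : F 0 = 0 := by simp [hF]
  have hF1n : 0 ≤ F 1 := intervalIntegral.integral_nonneg zero_le_one fun t _ => norm_nonneg _
  have hF1 : F 1 < r + s := by
    rw [hreal 0 1 zero_le_one, ENNReal.ofReal_lt_ofReal_iff (by positivity)] at hlen
    exact hlen
  have hrs : 0 < r + s := by positivity
  -- The total length `F 1 < r + s` is divided in the ratio `r : s`, so the pieces are shorter than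
  -- `r` and `s`.
  obtain ⟨t, ht, hFt⟩ : F 1 * (r / (r + s)) ∈ F '' Icc 0 1 := by
    apply intermediate_value_Icc zero_le_one hFc.continuousOn
    rw [hF0]
    refine ⟨by positivity, mul_le_of_le_one_right hF1n ?_⟩
    rw [div_le_one hrs]; linarith
  refine ⟨γ t, hS t, ?_, ?_⟩
  · have h2 := intrinsicEDist_le_pathLength (S := S) ht.1 hγ.contDiffOn (fun t _ => hS t)
    rw [h0 0 le_rfl, hreal _ _ ht.1] at h2
    refine h2.trans_lt ((ENNReal.ofReal_lt_ofReal_iff hr).2 ?_)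
    change F t < r
    rw [hFt, mul_div_assoc', div_lt_iff₀ hrs]
    nlinarith
  · have h2 := intrinsicEDist_le_pathLength (S := S) ht.2 hγ.contDiffOn (fun t _ => hS t)
    rw [h1 1 le_rfl, hreal _ _ ht.2] at h2
    refine h2.trans_lt ((ENNReal.ofReal_lt_ofReal_iff hs).2 ?_)
    have h3 : ∫ x in t..1, ‖deriv γ x‖ = F 1 - F t := by
      have := intervalIntegral.integral_add_adjacent_intervals (hint 0 t) (hint t 1)
      simp only [hF]
      linarith
    rw [h3, hFt]
    have : F 1 - F 1 * (r / (r + s)) = F 1 * s / (r + s) := by field_simp; ring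
    rw [this, div_lt_iff₀ hrs]
    nlinarith

/-- The segment of parameters is lifted to the graph. The slope is at most `1`, so its speed is at
most `(1 + 1) ‖z - w‖`. -/
theorem GraphChart.intrinsicEDist_param_le (c : GraphChart S p) {w z : Param n}
    (hw : w ∈ Metric.ball 0 c.r) (hz : z ∈ Metric.ball 0 c.r) :
    intrinsicEDist S (c.param w) (c.param z) ≤ ENNReal.ofReal (2 * ‖z - w‖) := by
  set γ : ℝ → Ambient n := fun t => c.param (w + t • (z - w)) with hγ
  have hseg : ∀ t ∈ Icc (0 : ℝ) 1, w + t • (z - w) ∈ Metric.ball (0 : Param n) c.r := fun t ht =>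
    (convex_ball _ _).add_smul_sub_mem hw hz ht
  have hγc : ContDiff ℝ 1 γ := (c.contDiff_param.of_le (by simp)).comp (by fun_prop)
  have h := intrinsicEDist_le_pathLength (S := S) zero_le_one hγc.contDiffOn
    (fun t ht => c.param_mem (hseg t ht))
  have e0 : γ 0 = c.param w := by simp [hγ]
  have e1 : γ 1 = c.param z := by simp [hγ]
  rw [e0, e1] at h
  refine h.trans ?_
  have := pathLength_le_of_norm_deriv_le (γ := γ) (a := 0) (b := 1) (M := 2 * ‖z - w‖) ?_ zero_le_one
  · simpa using this
  · intro t ht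
    have h1 : HasDerivAt (fun t : ℝ => w + t • (z - w)) (z - w) t := by
      simpa using ((hasDerivAt_id t).smul_const (z - w)).const_add w
    have h2 := (c.hasFDerivAt_param (w + t • (z - w))).comp_hasDerivAt t h1
    have h3 : deriv γ t = c.ι (z - w) + fderiv ℝ c.u (w + t • (z - w)) (z - w) • c.e := h2.deriv
    rw [h3]
    have h4 := c.norm_fderiv_le _ (hseg t ⟨ht.1.le, ht.2.le⟩)
    calc _ ≤ ‖c.ι (z - w)‖ + ‖fderiv ℝ c.u (w + t • (z - w)) (z - w) • c.e‖ := norm_add_le _ _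
      _ ≤ ‖z - w‖ + 1 * ‖z - w‖ := by
        rw [LinearIsometry.norm_map, norm_smul, c.norm_e, mul_one]
        gcongr
        exact ((fderiv ℝ c.u _).le_opNorm _).trans (by gcongr)
      _ = _ := by ring

end

/-! ### Hopf–Rinow -/

section

variable {n : ℕ} {S : Set (Ambient n)} {p : Ambient n}

/-- The points of `S`, with the intrinsic distance. -/
def IntrinsicSpace (S : Set (Ambient n)) : Type := S

namespace IntrinsicSpace

/-- The position in the ambient space. -/
def val (x : IntrinsicSpace S) : Ambient n := Subtype.val (p := (· ∈ S)) x

/-- A point of `S`, seen in the intrinsic space. -/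
def mk (x : Ambient n) (hx : x ∈ S) : IntrinsicSpace S := ⟨x, hx⟩

theorem val_mem (x : IntrinsicSpace S) : x.val ∈ S := Subtype.prop (p := (· ∈ S)) x

instance : PseudoEMetricSpace (IntrinsicSpace S) where
  edist x y := intrinsicEDist S x.val y.val
  edist_self x := intrinsicEDist_self x.val_mem
  edist_comm x y := intrinsicEDist_comm _ _
  edist_triangle x y z := intrinsicEDist_triangle _ _ _

theorem edist_def (x y : IntrinsicSpace S) : edist x y = intrinsicEDist S x.val y.val := rfl

theorem lipschitzWith_val : LipschitzWith 1 (val : IntrinsicSpace S → Ambient n) := fun x y => by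
  rw [ENNReal.coe_one, one_mul]
  exact edist_le_intrinsicEDist _ _

theorem completeSpace (h : IsIntrinsicallyComplete S) : CompleteSpace (IntrinsicSpace S) := by
  apply EMetric.complete_of_cauchySeq_tendsto
  intro u hu
  rw [EMetric.cauchySeq_iff] at hu
  obtain ⟨q, hq, hlim⟩ := h (fun k => (u k).val) (fun k => (u k).val_mem) hu
  refine ⟨mk q hq, ?_⟩
  rw [tendsto_iff_edist_tendsto_0]
  exact hlim

theorem exists_between {x y : IntrinsicSpace S} {r s : ℝ} (hr : 0 < r) (hs : 0 < s)
    (h : edist x y < ENNReal.ofReal (r + s)) :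
    ∃ z, edist x z < ENNReal.ofReal r ∧ edist z y < ENNReal.ofReal s := by
  obtain ⟨z, hz, h1, h2⟩ := exists_between_of_intrinsicEDist_lt hr hs h
  exact ⟨mk z hz, h1, h2⟩

/-- A small intrinsic ball lies in the image of a compact ball of parameters, and the
parametrization is Lipschitz for the intrinsic distance. -/
theorem exists_totallyBounded_ball (hS : IsEmbeddedHypersurface S) (x : IntrinsicSpace S) :
    ∃ ρ : ℝ, 0 < ρ ∧ TotallyBounded (Metric.eball x (ENNReal.ofReal ρ)) := by
  obtain ⟨c⟩ := hS.nonempty_graphChart x.val_mem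
  have hr := c.r_pos
  have hh := c.h_pos
  -- Ambient distance is at most intrinsic distance, so this radius keeps the foot point within `r /
  -- 2` and the height below `h`.
  refine ⟨min (c.r / 2) c.h, by positivity, ?_⟩
  have hsub : Metric.closedBall (0 : Param n) (c.r / 2) ⊆ Metric.ball 0 c.r :=
    Metric.closedBall_subset_ball (half_lt_self hr)
  set Ψ : Metric.closedBall (0 : Param n) (c.r / 2) → IntrinsicSpace S :=
    fun w => mk (c.param w) (c.param_mem (hsub w.2)) with hΨ
  have hΨl : LipschitzWith 2 Ψ := by
    intro w z
    have := c.intrinsicEDist_param_le (hsub w.2) (hsub z.2)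
    rw [edist_def]
    refine this.trans_eq ?_
    rw [ENNReal.ofReal_mul (by norm_num), Subtype.edist_eq, edist_comm, edist_dist, dist_eq_norm]
    norm_num
  have hcpt : IsCompact (range Ψ) := by
    have : CompactSpace (Metric.closedBall (0 : Param n) (c.r / 2)) :=
      isCompact_iff_compactSpace.1 (isCompact_closedBall _ _)
    exact isCompact_range hΨl.continuous
  refine hcpt.totallyBounded.subset fun y hy => ?_
  have h1 : ‖y.val - x.val‖ < min (c.r / 2) c.h := by
    have h2 : edist y.val x.val < ENNReal.ofReal (min (c.r / 2) c.h) :=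
      (edist_le_intrinsicEDist _ _).trans_lt hy
    rw [edist_dist, ENNReal.ofReal_lt_ofReal_iff (by positivity), dist_eq_norm] at h2
    exact h2
  have h3 : ‖c.proj y.val‖ ≤ c.r / 2 :=
    (c.norm_T_le _).trans (h1.le.trans (min_le_left _ _))
  have h4 : |c.height y.val| < c.h := by
    refine lt_of_le_of_lt ?_ (h1.trans_le (min_le_right _ _))
    have := abs_real_inner_le_norm (y.val - x.val) c.e
    rwa [c.norm_e, mul_one] at this
  have h5 : c.proj y.val ∈ Metric.closedBall (0 : Param n) (c.r / 2) := by simpa using h3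
  refine ⟨⟨c.proj y.val, h5⟩, ?_⟩
  have : c.param (c.proj y.val) = y.val := c.param_proj ⟨hsub h5, h4⟩ y.val_mem
  exact Subtype.ext this

/-- The **Hopf–Rinow theorem**: in a complete hypersurface, intrinsic balls are totally bounded. -/
theorem totallyBounded_ball (hS : IsEmbeddedHypersurface S) (hc : IsIntrinsicallyComplete S)
    (x : IntrinsicSpace S) (R : ℝ) : TotallyBounded (Metric.eball x (ENNReal.ofReal R)) := by
  have := completeSpace hc
  -- The set of good radii is closed downwards, nonempty, closed and open, hence all of `ℝ`.
  set T : Set ℝ := {r | TotallyBounded (Metric.eball x (ENNReal.ofReal r))} with hT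
  have hdown : ∀ r ∈ T, ∀ s ≤ r, s ∈ T := fun r hr s hs =>
    TotallyBounded.subset (Metric.eball_subset_eball (ENNReal.ofReal_le_ofReal hs)) hr
  have hneg : ∀ r ≤ 0, r ∈ T := fun r hr => by
    rw [hT, mem_ofPred_eq, ENNReal.ofReal_of_nonpos hr]
    simp
  have hclosed : ∀ r, (∀ s < r, s ∈ T) → r ∈ T := by
    intro r h
    rcases le_or_gt r 0 with hr | hr
    · exact hneg r hr
    rw [hT, mem_ofPred_eq, EMetric.totallyBounded_iff]
    intro ε hε
    obtain ⟨δ, hδ, hδε⟩ : ∃ δ : ℝ, 0 < δ ∧ ENNReal.ofReal (δ + δ) ≤ ε := by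
      rcases eq_or_ne ε ⊤ with rfl | hε'
      · exact ⟨1, one_pos, le_top⟩
      · refine ⟨ε.toReal / 2, by have := ENNReal.toReal_pos hε.ne' hε'; positivity, ?_⟩
        rw [add_halves, ENNReal.ofReal_toReal hε']
    -- The bound `r / 2` keeps `r - δ'` positive, as cutting a curve requires; points of the
    -- `r`-ball are within `δ'` of the ball of radius `r - δ'`.
    set δ' := min δ (r / 2) with hδ'
    have hδ'0 : 0 < δ' := by positivity
    have hδ'r : δ' ≤ r / 2 := min_le_right _ _
    obtain ⟨t, ht, hcov⟩ := EMetric.totallyBounded_iff.1 (h (r - δ') (by linarith))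
      (ENNReal.ofReal δ) (by simpa using hδ)
    refine ⟨t, ht, fun y hy => ?_⟩
    have hy' : edist x y < ENNReal.ofReal ((r - δ') + δ') := by
      rw [sub_add_cancel, edist_comm]; exact hy
    obtain ⟨z, hz1, hz2⟩ := exists_between (by linarith) hδ'0 hy'
    have hz3 : z ∈ Metric.eball x (ENNReal.ofReal (r - δ')) := by
      rw [Metric.mem_eball, edist_comm]; exact hz1
    obtain ⟨q, hq, hzq⟩ := mem_iUnion₂.1 (hcov hz3)
    refine mem_iUnion₂.2 ⟨q, hq, ?_⟩
    rw [Metric.mem_eball] at hzq ⊢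
    calc edist y q ≤ edist y z + edist z q := edist_triangle _ _ _
      _ < ENNReal.ofReal δ + ENNReal.ofReal δ := by
        refine ENNReal.add_lt_add ?_ hzq
        rw [edist_comm]
        exact hz2.trans_le (ENNReal.ofReal_le_ofReal (min_le_left _ _))
      _ = ENNReal.ofReal (δ + δ) := (ENNReal.ofReal_add hδ.le hδ.le).symm
      _ ≤ ε := hδε
  have hopen : ∀ r ∈ T, ∃ s > r, s ∈ T := by
    intro r hr
    rcases lt_or_ge 0 r with hr0 | hr0
    -- Completeness makes the closed ball compact. With a Lebesgue number `δ` of the cover by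
    -- totally bounded balls, finitely many `δ`-balls cover the ball of radius `r + d` as soon as `2
    -- d ≤ δ`.
    · have hK : IsCompact (closure (Metric.eball x (ENNReal.ofReal r))) :=
        isCompact_iff_totallyBounded_isComplete.2 ⟨TotallyBounded.closure hr,
          isClosed_closure.isComplete⟩
      choose ρ hρ hρT using exists_totallyBounded_ball hS
      obtain ⟨δ, hδ, hleb⟩ := lebesgue_number_lemma_of_emetric hK
        (c := fun y => Metric.eball y (ENNReal.ofReal (ρ y))) (fun y => Metric.isOpen_eball)
        (fun y _ => mem_iUnion.2 ⟨y, Metric.mem_eball_self (by simpa using hρ y)⟩)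
      obtain ⟨d, hd, hdδ⟩ : ∃ d : ℝ, 0 < d ∧ ENNReal.ofReal (d + d) ≤ δ := by
        rcases eq_or_ne δ ⊤ with rfl | hδ'
        · exact ⟨1, one_pos, le_top⟩
        · refine ⟨δ.toReal / 2, by have := ENNReal.toReal_pos hδ.ne' hδ'; positivity, ?_⟩
          rw [add_halves, ENNReal.ofReal_toReal hδ']
      obtain ⟨t, htsub, ht, hcov⟩ := EMetric.totallyBounded_iff'.1 hr (ENNReal.ofReal d)
        (by simpa using hd)
      refine ⟨r + d, by linarith, ?_⟩
      have hTB : TotallyBounded (⋃ q ∈ t, Metric.eball q δ) := by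
        rw [totallyBounded_biUnion ht]
        intro q hq
        obtain ⟨y, hy⟩ := hleb q (subset_closure (htsub hq))
        exact (hρT y).subset hy
      refine hTB.subset fun y hy => ?_
      have hy' : edist x y < ENNReal.ofReal (r + d) := by rw [edist_comm]; exact hy
      obtain ⟨z, hz1, hz2⟩ := exists_between hr0 hd hy'
      have hz3 : z ∈ Metric.eball x (ENNReal.ofReal r) := by
        rw [Metric.mem_eball, edist_comm]; exact hz1
      obtain ⟨q, hq, hzq⟩ := mem_iUnion₂.1 (hcov hz3)
      refine mem_iUnion₂.2 ⟨q, hq, ?_⟩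
      rw [Metric.mem_eball] at hzq ⊢
      calc edist y q ≤ edist y z + edist z q := edist_triangle _ _ _
        _ < ENNReal.ofReal d + ENNReal.ofReal d := by
          refine ENNReal.add_lt_add ?_ hzq
          rw [edist_comm]
          exact hz2
        _ = ENNReal.ofReal (d + d) := (ENNReal.ofReal_add hd.le hd.le).symm
        _ ≤ δ := hdδ
    · obtain ⟨ρ, hρ, hTB⟩ := exists_totallyBounded_ball hS x
      exact ⟨ρ, by linarith, hTB⟩
  have hTclosed : IsClosed T := by
    rw [← isOpen_compl_iff, Metric.isOpen_iff]
    intro r hr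
    obtain ⟨s, hs, hsT⟩ : ∃ s < r, s ∉ T := by
      by_contra! h
      exact hr (hclosed r h)
    refine ⟨r - s, by linarith, fun y hy hyT => hsT (hdown y hyT s ?_)⟩
    rw [Metric.mem_ball, Real.dist_eq, abs_lt] at hy
    linarith [hy.1]
  have hTopen : IsOpen T := by
    rw [Metric.isOpen_iff]
    intro r hr
    obtain ⟨s, hs, hsT⟩ := hopen r hr
    refine ⟨s - r, by linarith, fun y hy => hdown s hsT y ?_⟩
    rw [Metric.mem_ball, Real.dist_eq, abs_lt] at hy
    linarith [hy.2]
  have : T = univ := IsClopen.eq_univ ⟨hTclosed, hTopen⟩ ⟨0, hneg 0 le_rfl⟩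
  have hR : R ∈ T := by rw [this]; exact mem_univ R
  exact hR

end IntrinsicSpace

end

/-! ### Cutoff functions for the intrinsic distance -/

section

variable {n : ℕ} {S : Set (Ambient n)} {p : Ambient n}

/-- This is the Lindelöf property of the ambient space. The sets `dom` are chosen first, as a total
function of the point, because charts exist only at points of `S`. -/
theorem IsEmbeddedHypersurface.exists_seq_graphChart (hS : IsEmbeddedHypersurface S)
    (hne : S.Nonempty) :
    ∃ (q : ℕ → Ambient n) (c : ∀ k, GraphChart S (q k)), (∀ k, q k ∈ S) ∧ S ⊆ ⋃ k, (c k).dom := by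
  choose! d hd using fun (x : Ambient n) (hx : x ∈ S) =>
    (⟨((hS.nonempty_graphChart hx).some).dom, (hS.nonempty_graphChart hx).some, rfl⟩ :
      ∃ (U : Set (Ambient n)) (c : GraphChart S x), U = c.dom)
  obtain ⟨t, htS, htc, hcov⟩ := TopologicalSpace.countable_cover_nhdsWithin (f := d) (s := S)
    (fun x hx => by
      obtain ⟨c, hc⟩ := hd x hx
      rw [hc]
      exact mem_nhdsWithin_of_mem_nhds (c.isOpen_dom.mem_nhds c.mem_dom))
  have htne : t.Nonempty := by
    obtain ⟨x, hx⟩ := hne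
    obtain ⟨y, hy, -⟩ := mem_iUnion₂.1 (hcov hx)
    exact ⟨y, hy⟩
  obtain ⟨q, hq⟩ := htc.exists_eq_range htne
  have hqS : ∀ k, q k ∈ S := fun k => htS (hq ▸ mem_range_self k)
  choose c hc using fun k => hd (q k) (hqS k)
  refine ⟨q, c, hqS, fun x hx => ?_⟩
  obtain ⟨y, hy, hxy⟩ := mem_iUnion₂.1 (hcov hx)
  rw [hq] at hy
  obtain ⟨k, rfl⟩ := hy
  exact mem_iUnion.2 ⟨k, hc k ▸ hxy⟩

/-- `S` need not be closed, but countably many charts cut it into measurable pieces. -/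
theorem IsEmbeddedHypersurface.measurableSet (hS : IsEmbeddedHypersurface S) : MeasurableSet S := by
  rcases S.eq_empty_or_nonempty with rfl | hne
  · exact MeasurableSet.empty
  obtain ⟨q, c, -, hcov⟩ := hS.exists_seq_graphChart hne
  have : S = ⋃ k, S ∩ (c k).dom := by
    rw [← inter_iUnion, inter_eq_self_of_subset_left hcov]
  rw [this]
  exact MeasurableSet.iUnion fun k => (c k).measurableSet_inter_dom

/-- The intrinsic distance of a point to a set. -/
def intrinsicInfEDist (S t : Set (Ambient n)) (x : Ambient n) : ℝ≥0∞ :=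
  ⨅ q ∈ t, intrinsicEDist S q x

theorem intrinsicInfEDist_le_add (t : Set (Ambient n)) (x y : Ambient n) :
    intrinsicInfEDist S t y ≤ intrinsicInfEDist S t x + intrinsicEDist S x y := by
  rw [intrinsicInfEDist, intrinsicInfEDist]
  simp_rw [ENNReal.iInf_add]
  exact iInf₂_mono fun q _ => intrinsicEDist_triangle q x y

theorem intrinsicEDist_eq_top_of_notMem {q x : Ambient n} (hx : x ∉ S) :
    intrinsicEDist S q x = ⊤ := by
  refine iInf₂_eq_top.2 fun γ hγ => absurd ?_ hx
  rw [← hγ.target]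
  exact hγ.mapsTo (right_mem_Icc.2 zero_le_one)

/-- The cutoff function that decreases from `1` on `t` to `0` at intrinsic distance `R`. -/
def cutoff (S t : Set (Ambient n)) (R : ℝ) (x : Ambient n) : ℝ :=
  (1 - intrinsicInfEDist S t x / ENNReal.ofReal R).toReal

theorem cutoff_nonneg (t : Set (Ambient n)) (R : ℝ) (x : Ambient n) : 0 ≤ cutoff S t R x :=
  ENNReal.toReal_nonneg

theorem cutoff_le_one (t : Set (Ambient n)) (R : ℝ) (x : Ambient n) : cutoff S t R x ≤ 1 :=
  ENNReal.toReal_le_of_le_ofReal zero_le_one (by simp)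

/-- This is the triangle inequality, carried out in `ℝ≥0∞` because the distance to `t` may be
infinite; truncated subtraction handles that case. -/
theorem cutoff_sub_le {t : Set (Ambient n)} {R d : ℝ} (hR : 0 < R) (hd : 0 ≤ d) {x y : Ambient n}
    (h : intrinsicEDist S x y ≤ ENNReal.ofReal d) : cutoff S t R x - cutoff S t R y ≤ d / R := by
  have h1 : (1 : ℝ≥0∞) - intrinsicInfEDist S t x / ENNReal.ofReal R ≤
      (1 - intrinsicInfEDist S t y / ENNReal.ofReal R) + ENNReal.ofReal (d / R) := by
    rw [tsub_le_iff_right]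
    have h2 : intrinsicInfEDist S t y / ENNReal.ofReal R ≤
        intrinsicInfEDist S t x / ENNReal.ofReal R + ENNReal.ofReal (d / R) := by
      rw [ENNReal.ofReal_div_of_pos hR, ← ENNReal.add_div]
      gcongr
      exact (intrinsicInfEDist_le_add t x y).trans (by gcongr)
    calc (1 : ℝ≥0∞) ≤ (1 - intrinsicInfEDist S t y / ENNReal.ofReal R) +
          intrinsicInfEDist S t y / ENNReal.ofReal R := le_tsub_add
      _ ≤ (1 - intrinsicInfEDist S t y / ENNReal.ofReal R) +
          (intrinsicInfEDist S t x / ENNReal.ofReal R + ENNReal.ofReal (d / R)) := by gcongr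
      _ = _ := by ring
  have h3 : (1 : ℝ≥0∞) - intrinsicInfEDist S t y / ENNReal.ofReal R ≠ ⊤ :=
    ne_top_of_le_ne_top ENNReal.one_ne_top tsub_le_self
  have h4 := ENNReal.toReal_mono (ENNReal.add_ne_top.2 ⟨h3, ENNReal.ofReal_ne_top⟩) h1
  rw [ENNReal.toReal_add h3 ENNReal.ofReal_ne_top, ENNReal.toReal_ofReal (by positivity)] at h4
  rw [cutoff, cutoff]
  linarith

theorem lipschitzOnWith_cutoff_param (t : Set (Ambient n)) {R : ℝ} (hR : 0 < R)
    (c : GraphChart S p) :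
    LipschitzOnWith (Real.toNNReal (2 / R)) (fun w => cutoff S t R (c.param w))
      (Metric.ball 0 c.r) := by
  apply LipschitzOnWith.of_le_add_mul
  intro w hw z hz
  have := cutoff_sub_le (t := t) hR (by positivity) (c.intrinsicEDist_param_le hw hz)
  rw [Real.coe_toNNReal _ (by positivity), dist_comm, dist_eq_norm]
  have h2 : 2 * ‖z - w‖ / R = 2 / R * ‖z - w‖ := by ring
  linarith

/-- The cutoff vanishes off finitely many intrinsic balls, which are totally bounded by Hopf–Rinow.
Their closure is intrinsically compact, and the position map is continuous. -/
theorem exists_compact_cutoff_eq_zero (hS : IsEmbeddedHypersurface S)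
    (hc : IsIntrinsicallyComplete S) {t : Set (Ambient n)} (ht : t.Finite) (htS : t ⊆ S)
    {R : ℝ} (hR : 0 < R) :
    ∃ K ⊆ S, IsCompact K ∧ ∀ x ∉ K, cutoff S t R x = 0 := by
  have := IntrinsicSpace.completeSpace hc
  set B : Set (IntrinsicSpace S) :=
    ⋃ q ∈ {q : IntrinsicSpace S | q.val ∈ t}, Metric.eball q (ENNReal.ofReal R) with hB
  have hfin : {q : IntrinsicSpace S | q.val ∈ t}.Finite :=
    ht.preimage (Subtype.val_injective.injOn)
  have hTB : TotallyBounded B := by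
    rw [hB, totallyBounded_biUnion hfin]
    exact fun q _ => IntrinsicSpace.totallyBounded_ball hS hc q R
  have hcomp : IsCompact (closure B) :=
    isCompact_iff_totallyBounded_isComplete.2 ⟨hTB.closure, isClosed_closure.isComplete⟩
  refine ⟨IntrinsicSpace.val '' closure B, ?_,
    hcomp.image IntrinsicSpace.lipschitzWith_val.continuous, fun x hx => ?_⟩
  · rintro _ ⟨y, -, rfl⟩
    exact y.val_mem
  · have h1 : ENNReal.ofReal R ≤ intrinsicInfEDist S t x := by
      refine le_iInf₂ fun q hq => ?_
      by_contra! hlt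
      have hxS : x ∈ S := by
        by_contra h
        rw [intrinsicEDist_eq_top_of_notMem h] at hlt
        exact not_top_lt hlt
      refine hx ⟨IntrinsicSpace.mk x hxS, subset_closure ?_, rfl⟩
      refine mem_iUnion₂.2 ⟨IntrinsicSpace.mk q (htS hq), hq, ?_⟩
      rw [Metric.mem_eball, edist_comm]
      exact hlt
    have h2 : (1 : ℝ≥0∞) ≤ intrinsicInfEDist S t x / ENNReal.ofReal R := by
      rw [ENNReal.le_div_iff_mul_le (Or.inl (by simpa using hR)) (Or.inl ENNReal.ofReal_ne_top)]
      simpa using h1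
    rw [cutoff, tsub_eq_zero_of_le h2, ENNReal.toReal_zero]

/-- On a complete hypersurface there are compactly supported cutoff functions converging to `1`
whose gradients converge uniformly to `0`. -/
theorem exists_cutoffs (hS : IsEmbeddedHypersurface S) (hc : IsIntrinsicallyComplete S)
    (hne : S.Nonempty) :
    ∃ η : ℕ → Ambient n → ℝ, (∀ k x, 0 ≤ η k x) ∧ (∀ k x, η k x ≤ 1) ∧
      (∀ k, ∃ K ⊆ S, IsCompact K ∧ ∀ x ∉ K, η k x = 0) ∧
      (∀ (k : ℕ) q (c : GraphChart S q), LipschitzOnWith (Real.toNNReal (2 / ((k : ℝ) + 1)))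
        (fun w => η k (c.param w)) (Metric.ball 0 c.r)) ∧
      ∀ x ∈ S, Tendsto (fun k => η k x) atTop (𝓝 1) := by
  obtain ⟨q, c, hqS, hcov⟩ := hS.exists_seq_graphChart hne
  -- `S` may have infinitely many components at infinite mutual distance, so one centre does not
  -- suffice: the number of centres grows together with the radius `k + 1`.
  set t : ℕ → Set (Ambient n) := fun k => q '' Iic k with ht
  have hR : ∀ k : ℕ, (0 : ℝ) < k + 1 := fun k => by positivity
  refine ⟨fun k => cutoff S (t k) (k + 1), fun k x => cutoff_nonneg _ _ _,
    fun k x => cutoff_le_one _ _ _, fun k => ?_, fun k _ c => ?_, fun x hx => ?_⟩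
  · refine exists_compact_cutoff_eq_zero hS hc ((finite_Iic k).image q) ?_ (hR k)
    rintro _ ⟨i, -, rfl⟩
    exact hqS i
  · exact lipschitzOnWith_cutoff_param _ (hR k) c
  · obtain ⟨i, hi⟩ := mem_iUnion.1 (hcov hx)
    have h1 := (c i).intrinsicEDist_param_le (Metric.mem_ball_self (c i).r_pos) hi.1
    rw [(c i).param_zero, (c i).param_proj hi hx] at h1
    set d := 2 * ‖(c i).proj x - 0‖ with hd
    have hlow : ∀ k ≥ i, 1 - d / (k + 1) ≤ cutoff S (t k) (k + 1) x := by
      intro k hk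
      have h2 : cutoff S (t k) (k + 1) (q i) = 1 := by
        have : intrinsicInfEDist S (t k) (q i) = 0 := by
          refine le_antisymm ?_ bot_le
          exact (iInf₂_le (q i) ⟨i, hk, rfl⟩).trans_eq (intrinsicEDist_self (hqS i))
        rw [cutoff, this]
        simp
      have h3 := cutoff_sub_le (t := t k) (hR k) (by positivity) h1
      linarith
    have hlim : Tendsto (fun k : ℕ => 1 - d / ((k : ℝ) + 1)) atTop (𝓝 1) := by
      have := (tendsto_const_div_atTop_nhds_zero_nat d).comp (tendsto_add_atTop_nat 1)
      have h4 := this.const_sub 1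
      simpa using h4
    refine tendsto_of_tendsto_of_tendsto_of_le_of_le' hlim tendsto_const_nhds ?_ ?_
    · filter_upwards [eventually_ge_atTop i] with k hk using hlow k hk
    · exact Eventually.of_forall fun k => cutoff_le_one _ _ _

end

/-! ### The divergence theorem on a complete shrinker -/

section

open scoped Manifold

variable {n : ℕ} {S : Set (Ambient n)} {p : Ambient n}

/-- Expressions that are even in the normal are continuous along `S`. -/
theorem continuousOn_normal (hS : IsEmbeddedHypersurface S) {Q : Ambient n → Ambient n → ℝ}
    (hQ : Continuous (Function.uncurry Q)) (heven : ∀ x N, Q x (-N) = Q x N) :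
    ContinuousOn (fun x => Q x (normal S x)) S := by
  intro x hx
  obtain ⟨c⟩ := hS.nonempty_graphChart hx
  have h1 : ContinuousAt (fun y => Q y (c.ν (c.proj y))) x := by
    have : Continuous (fun y => Function.uncurry Q (y, c.ν (c.proj y))) :=
      hQ.comp (continuous_id.prodMk (c.contDiff_ν.continuous.comp c.contDiff_proj.continuous))
    exact this.continuousAt
  have h2 : ∀ y ∈ S ∩ c.dom, Q y (normal S y) = Q y (c.ν (c.proj y)) := by
    rintro y ⟨hy, hyd⟩
    have := c.normal_param hyd.1
    rw [c.param_proj hyd hy] at this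
    rcases this with h | h <;> rw [h]
    rw [heven]
  refine h1.continuousWithinAt.congr_of_eventuallyEq ?_ (h2 x ⟨hx, c.mem_dom⟩)
  filter_upwards [self_mem_nhdsWithin, mem_nhdsWithin_of_mem_nhds (c.isOpen_dom.mem_nhds c.mem_dom)]
    with y hy hyd using h2 y ⟨hy, hyd⟩

theorem continuous_tr : Continuous (tr : (Ambient n →L[ℝ] Ambient n) → ℝ) := by
  let L : (Ambient n →L[ℝ] Ambient n) →ₗ[ℝ] ℝ :=
    { toFun := tr, map_add' := tr_add, map_smul' := tr_smul }
  exact L.continuous_of_finiteDimensional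

theorem continuousOn_shrinkerDiv (hS : IsEmbeddedHypersurface S) {W : Ambient n → Ambient n}
    (hW : ContDiff ℝ 1 W) : ContinuousOn (shrinkerDiv S W) S := by
  have hD : Continuous (fderiv ℝ W) := hW.continuous_fderiv (by simp)
  have hWc := hW.continuous
  refine continuousOn_normal hS (Q := fun x N => tr (fderiv ℝ W x) -
    inner ℝ (fderiv ℝ W x N) N - inner ℝ x N * inner ℝ (W x) N / 2) ?_ (fun x N => by simp)
  have h1 := continuous_tr (n := n)
  have h2 : Continuous (fun z : Ambient n × Ambient n => tr (fderiv ℝ W z.1)) :=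
    h1.comp (hD.comp continuous_fst)
  have h3 : Continuous (fun z : Ambient n × Ambient n => fderiv ℝ W z.1 z.2) :=
    (hD.comp continuous_fst).clm_apply continuous_snd
  have h4 : Continuous (fun z : Ambient n × Ambient n => W z.1) := hWc.comp continuous_fst
  exact (h2.sub (h3.inner continuous_snd)).sub
    (((continuous_fst.inner continuous_snd).mul (h4.inner continuous_snd)).div_const 2)

theorem shrinkerDiv_sum {ι : Type*} (s : Finset ι) {W : ι → Ambient n → Ambient n}
    {x : Ambient n} (hW : ∀ i ∈ s, DifferentiableAt ℝ (W i) x) :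
    shrinkerDiv S (fun y => ∑ i ∈ s, W i y) x = ∑ i ∈ s, shrinkerDiv S (W i) x := by
  have h1 : fderiv ℝ (fun y => ∑ i ∈ s, W i y) x = ∑ i ∈ s, fderiv ℝ (W i) x := fderiv_fun_sum hW
  have h2 : tr (∑ i ∈ s, fderiv ℝ (W i) x) = ∑ i ∈ s, tr (fderiv ℝ (W i) x) := by
    let L : (Ambient n →L[ℝ] Ambient n) →ₗ[ℝ] ℝ :=
      { toFun := tr, map_add' := tr_add, map_smul' := tr_smul }
    exact _root_.map_sum L _ _
  simp only [shrinkerDiv, h1, h2, Finset.sum_sub_distrib, _root_.sum_apply, sum_inner,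
    Finset.mul_sum, Finset.sum_div]

theorem isFiniteMeasureOnCompacts_areaMeasure (hg : HasPolynomialVolumeGrowth S) :
    IsFiniteMeasureOnCompacts (areaMeasure S) := by
  refine ⟨fun K hK => ?_⟩
  obtain ⟨C, d, h⟩ := hg
  obtain ⟨R, hR⟩ := hK.isBounded.subset_ball (0 : Ambient n)
  have h1 : K ⊆ Metric.ball 0 (max R 1) := hR.trans (Metric.ball_subset_ball (le_max_left _ _))
  exact (measure_mono h1).trans_lt ((h _ (le_max_right _ _)).trans_lt ENNReal.ofReal_lt_top)

/-- A function that is Lipschitz in all graph charts is continuous along `S`. -/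
theorem continuousOn_of_lipschitzOnWith_param (hS : IsEmbeddedHypersurface S) {η : Ambient n → ℝ}
    {L : NNReal}
    (hη : ∀ q (c : GraphChart S q), LipschitzOnWith L (fun w => η (c.param w)) (Metric.ball 0 c.r)) :
    ContinuousOn η S := by
  intro x hx
  obtain ⟨c⟩ := hS.nonempty_graphChart hx
  have h1 : ContinuousAt (fun w => η (c.param w)) (c.proj x) :=
    ((hη x c).continuousOn).continuousAt (Metric.isOpen_ball.mem_nhds c.mem_dom.1)
  have h2 : ContinuousAt (fun y => η (c.param (c.proj y))) x :=
    ContinuousAt.comp (f := c.proj) h1 c.contDiff_proj.continuous.continuousAt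
  refine h2.continuousWithinAt.congr_of_eventuallyEq ?_ (by rw [c.param_proj c.mem_dom hx])
  filter_upwards [self_mem_nhdsWithin,
    mem_nhdsWithin_of_mem_nhds (c.isOpen_dom.mem_nhds c.mem_dom)] with y hy hyd
  rw [c.param_proj hyd hy]

/-- The first variation formula tested against a compactly supported Lipschitz function. -/
theorem abs_integral_cutoff_mul_shrinkerDiv_le (hS : IsSelfShrinker S)
    [IsFiniteMeasureOnCompacts (areaMeasure S)] {W : Ambient n → Ambient n}
    (hW : ContDiff ℝ 1 W) (hWi : Integrable W (areaMeasure S))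
    {η : Ambient n → ℝ} {L : NNReal} {K : Set (Ambient n)} (hK : IsCompact K) (hKS : K ⊆ S)
    (hη0 : ∀ x ∉ K, η x = 0)
    (hη : ∀ q (c : GraphChart S q), LipschitzOnWith L (fun w => η (c.param w)) (Metric.ball 0 c.r)) :
    |∫ x, η x * shrinkerDiv S W x ∂(areaMeasure S)| ≤ L * ∫ x, ‖W x‖ ∂(areaMeasure S) := by
  have hemb := hS.isEmbeddedHypersurface
  have hηc : ContinuousOn η S := continuousOn_of_lipschitzOnWith_param hemb hη
  let c : ∀ x : S, GraphChart S x := fun x => (hemb.nonempty_graphChart x.2).some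
  obtain ⟨t, ht⟩ := hK.elim_finite_subcover (fun x : S => (c x).dom)
    (fun x => (c x).isOpen_dom)
    (fun x hx => mem_iUnion.2 ⟨⟨x, hKS hx⟩, (c ⟨x, hKS hx⟩).mem_dom⟩)
  obtain ⟨ψ, hψ⟩ := SmoothPartitionOfUnity.exists_isSubordinate 𝓘(ℝ, Ambient n) hK.isClosed
    (fun i : t => (c i.1).dom) (fun i => (c i.1).isOpen_dom)
    (by
      intro x hx
      obtain ⟨i, hi, hxi⟩ := mem_iUnion₂.1 (ht hx)
      exact mem_iUnion.2 ⟨⟨i, hi⟩, hxi⟩)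
  have hψc : ∀ i, ContDiff ℝ 1 (ψ i) := fun i => ((ψ i).contMDiff.contDiff).of_le (by simp)
  have hψsum : ∀ x, ∑ᶠ i, ψ i x = ∑ i, ψ i x := fun x => finsum_eq_sum_of_fintype _
  have hψ1 : ∀ x ∈ K, ∑ i, ψ i x = 1 := fun x hx => by rw [← hψsum]; exact ψ.sum_eq_one hx
  have hψle : ∀ x, ∑ i, ψ i x ≤ 1 := fun x => by rw [← hψsum]; exact ψ.sum_le_one x
  have hWi1 : ∀ i, ContDiff ℝ 1 (fun x => ψ i x • W x) := fun i => (hψc i).smul hW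
  have hdec : ∀ x, η x * shrinkerDiv S W x =
      ∑ i, η x * shrinkerDiv S (fun y => ψ i y • W y) x := by
    intro x
    by_cases hx : x ∈ K
    · rw [← Finset.mul_sum, ← shrinkerDiv_sum _
        (fun i _ => ((hWi1 i).differentiable (by simp)).differentiableAt)]
      congr 1
      simp_rw [← Finset.sum_smul]
      have hΨd : DifferentiableAt ℝ (fun y => ∑ i, ψ i y) x :=
        (ContDiff.sum (fun i _ => hψc i)).differentiable (by simp) |>.differentiableAt
      -- The sum is at most `1` everywhere and equals `1` on `K`, so each point of `K` is a maximum;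
      -- no neighbourhood of `K` on which the sum is constant is needed.
      have hΨ0 : fderiv ℝ (fun y => ∑ i, ψ i y) x = 0 := by
        apply IsLocalMax.fderiv_eq_zero
        exact Eventually.of_forall fun y => (hψle y).trans_eq (hψ1 x hx).symm
      have hWd : DifferentiableAt ℝ W x := (hW.differentiable (by simp)).differentiableAt
      have hD : fderiv ℝ (fun y => (∑ i, ψ i y) • W y) x = fderiv ℝ W x := by
        rw [fderiv_fun_smul hΨd hWd, hΨ0, hψ1 x hx]
        ext v
        simp
      rw [shrinkerDiv, shrinkerDiv, hD, hψ1 x hx, one_smul]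
    · rw [hη0 x hx]
      simp
  have hint : ∀ i, Integrable (fun x => η x * shrinkerDiv S (fun y => ψ i y • W y) x)
      (areaMeasure S) := by
    intro i
    have h1 : IntegrableOn (fun x => η x * shrinkerDiv S (fun y => ψ i y • W y) x) K
        (areaMeasure S) :=
      ((hηc.mul (continuousOn_shrinkerDiv hemb (hWi1 i))).mono hKS).integrableOn_compact hK
    refine h1.integrable_of_forall_notMem_eq_zero fun x hx => ?_
    rw [hη0 x hx, zero_mul]
  simp_rw [hdec]
  rw [integral_finsetSum _ fun i _ => hint i]
  have hnorm : ∀ i, Integrable (fun x => ‖ψ i x • W x‖) (areaMeasure S) := by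
    intro i
    refine hWi.norm.mono ((hWi1 i).continuous.norm.aestronglyMeasurable) (Eventually.of_forall ?_)
    intro x
    rw [norm_norm, norm_norm, norm_smul]
    refine mul_le_of_le_one_left (norm_nonneg _) ?_
    rw [Real.norm_of_nonneg (ψ.nonneg i x)]
    exact ψ.le_one i x
  -- The partition is applied to `W` and not to `η`. The local bounds then involve `‖ψ i • W‖` and
  -- add up to at most `‖W‖`, so the constant `L` does not depend on the number of charts.
  calc |∑ i, ∫ x, η x * shrinkerDiv S (fun y => ψ i y • W y) x ∂(areaMeasure S)|
      ≤ ∑ i, |∫ x, η x * shrinkerDiv S (fun y => ψ i y • W y) x ∂(areaMeasure S)| :=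
        Finset.abs_sum_le_sum_abs _ _
    _ ≤ ∑ i, L * ∫ x, ‖ψ i x • W x‖ ∂(areaMeasure S) := by
        refine Finset.sum_le_sum fun i _ => ?_
        refine (c i.1).abs_integral_mul_shrinkerDiv_le hS.equation (hWi1 i) ?_ (hη _ _)
        exact (tsupport_smul_subset_left (ψ i) W).trans (hψ i)
    _ = L * ∫ x, ∑ i, ‖ψ i x • W x‖ ∂(areaMeasure S) := by
        rw [← Finset.mul_sum, integral_finsetSum _ fun i _ => hnorm i]
    _ ≤ L * ∫ x, ‖W x‖ ∂(areaMeasure S) := by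
        refine mul_le_mul_of_nonneg_left ?_ L.coe_nonneg
        refine integral_mono (integrable_finsetSum _ fun i _ => hnorm i) hWi.norm fun x => ?_
        simp only [norm_smul, ← Finset.sum_mul]
        refine mul_le_of_le_one_left (norm_nonneg _) ?_
        simp_rw [Real.norm_of_nonneg (ψ.nonneg _ x)]
        exact hψle x

/-- The divergence theorem on a complete self-shrinker: the corrected divergence of an integrable
field integrates to zero. -/
theorem integral_shrinkerDiv_eq_zero (hS : IsSelfShrinker S) (hc : IsIntrinsicallyComplete S)
    (hg : HasPolynomialVolumeGrowth S) {W : Ambient n → Ambient n} (hW : ContDiff ℝ 1 W)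
    (hWi : Integrable W (areaMeasure S)) (hDi : Integrable (shrinkerDiv S W) (areaMeasure S)) :
    ∫ x, shrinkerDiv S W x ∂(areaMeasure S) = 0 := by
  have hemb := hS.isEmbeddedHypersurface
  rcases S.eq_empty_or_nonempty with rfl | hne
  · simp [areaMeasure]
  have := isFiniteMeasureOnCompacts_areaMeasure hg
  obtain ⟨η, h0, h1, hK, hlip, hlim⟩ := exists_cutoffs hemb hc hne
  have hmeas : MeasurableSet S := hemb.measurableSet
  have hηm : ∀ k, AEStronglyMeasurable (η k) (areaMeasure S) := by
    intro k
    exact (continuousOn_of_lipschitzOnWith_param hemb (hlip k)).aestronglyMeasurable hmeas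
  have hae : ∀ᵐ x ∂(areaMeasure S), x ∈ S := ae_restrict_mem hmeas
  -- The same sequence has two limits: the wanted integral, by dominated convergence, and zero,
  -- because the Lipschitz constants `2 / (k + 1)` of the cutoffs tend to zero.
  have hconv : Tendsto (fun k => ∫ x, η k x * shrinkerDiv S W x ∂(areaMeasure S)) atTop
      (𝓝 (∫ x, shrinkerDiv S W x ∂(areaMeasure S))) := by
    refine tendsto_integral_of_dominated_convergence (fun x => ‖shrinkerDiv S W x‖)
      (fun k => (hηm k).mul hDi.aestronglyMeasurable) hDi.norm (fun k => ?_) ?_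
    · refine Eventually.of_forall fun x => ?_
      rw [norm_mul, Real.norm_of_nonneg (h0 k x)]
      exact mul_le_of_le_one_left (norm_nonneg _) (h1 k x)
    · filter_upwards [hae] with x hx
      simpa using (hlim x hx).mul_const (shrinkerDiv S W x)
  have hzero : Tendsto (fun k => ∫ x, η k x * shrinkerDiv S W x ∂(areaMeasure S)) atTop (𝓝 0) := by
    have hb : Tendsto (fun k : ℕ => (Real.toNNReal (2 / ((k : ℝ) + 1)) : ℝ) *
        ∫ x, ‖W x‖ ∂(areaMeasure S)) atTop (𝓝 0) := by
      have h2 : Tendsto (fun k : ℕ => 2 / ((k : ℝ) + 1)) atTop (𝓝 0) := by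
        have := (tendsto_const_div_atTop_nhds_zero_nat (2 : ℝ)).comp (tendsto_add_atTop_nat 1)
        simpa [Function.comp_def] using this
      have h3 := h2.mul_const (∫ x, ‖W x‖ ∂(areaMeasure S))
      rw [zero_mul] at h3
      refine h3.congr fun k => ?_
      rw [Real.coe_toNNReal _ (by positivity)]
    refine squeeze_zero_norm (fun k => ?_) hb
    obtain ⟨K, hKS, hKc, hK0⟩ := hK k
    exact abs_integral_cutoff_mul_shrinkerDiv_le hS hW hWi hKc hKS hK0 (hlip k)
  exact tendsto_nhds_unique hconv hzero

end

/-! ### Tangent affine fields split off a line -/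

section

variable {n : ℕ} {S : Set (Ambient n)} {p : Ambient n}

/-- If an affine field `y + c x` is tangent to `S`, then its integral line through a point of `S`
stays in `S` for a short time. -/
theorem eventually_add_smul_mem (hS : IsEmbeddedHypersurface S) {y : Ambient n} {a : ℝ}
    (htan : ∀ x ∈ S, inner ℝ (y + a • x) (normal S x) = (0 : ℝ)) (hp : p ∈ S) :
    ∀ᶠ ρ in 𝓝 (0 : ℝ), p + ρ • (y + a • p) ∈ S := by
  obtain ⟨c⟩ := hS.nonempty_graphChart hp
  set X := y + a • p with hX
  have hcon : ∀ w ∈ Metric.ball (0 : Param n) c.r,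
      (inner ℝ (y + a • c.param w) (c.conormal w) : ℝ) = 0 := by
    intro w hw
    have h1 := htan _ (c.param_mem hw)
    rw [← c.J_smul_ν, real_inner_smul_right]
    rcases c.normal_param hw with h | h
    · rw [h] at h1; rw [h1, mul_zero]
    · rw [h, inner_neg_right, neg_eq_zero] at h1; rw [h1, mul_zero]
  have hX0 : (inner ℝ X c.e : ℝ) = 0 := by
    have h1 := hcon 0 (Metric.mem_ball_self c.r_pos)
    have h2 : gradient c.u 0 = 0 := by rw [gradient, c.fderiv_u_zero, map_zero]
    rwa [GraphChart.conormal, h2, map_zero, sub_zero, c.param_zero] at h1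
  set b := c.T X with hb
  have hXb : X = c.ι b := by
    conv_lhs => rw [c.decomp' X, hX0, zero_smul, add_zero]
  -- Along the line, the height `θ` of the graph solves a linear homogeneous equation.
  set θ : ℝ → ℝ := fun ρ => c.u (ρ • b) with hθ
  have hθd : ∀ ρ, HasDerivAt θ (fderiv ℝ c.u (ρ • b) b) ρ := by
    intro ρ
    have h1 : HasDerivAt (fun ρ : ℝ => ρ • b) b ρ := by
      simpa using (hasDerivAt_id ρ).smul_const b
    have h2 : HasFDerivAt c.u (fderiv ℝ c.u (ρ • b)) (ρ • b) :=
      (c.smooth.differentiable (by simp)).differentiableAt.hasFDerivAt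
    exact h2.comp_hasDerivAt ρ h1
  -- This is tangency at the point of the graph over `ρ b`. It reads `a θ = (1 + a ρ) θ'`, so `θ /
  -- (1 + a ρ)` is constant near `0`, and `θ 0 = 0`.
  have hode : ∀ ρ : ℝ, ρ • b ∈ Metric.ball (0 : Param n) c.r →
      a * θ ρ = (1 + a * ρ) * fderiv ℝ c.u (ρ • b) b := by
    intro ρ hρ
    have h1 := hcon _ hρ
    have h2 : y + a • c.param (ρ • b) = c.ι ((1 + a * ρ) • b) + (a * θ ρ) • c.e := by
      have : y = c.ι b - a • p := by rw [← hXb, hX]; abel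
      rw [GraphChart.param, this, map_smul, map_smul]
      simp only [hθ]
      module
    rw [h2, GraphChart.conormal, inner_sub_right, inner_add_left, inner_add_left, c.inner_e,
      real_inner_smul_left, real_inner_smul_left, c.inner_e_e, LinearIsometry.inner_map_map,
      real_inner_comm (c.ι _) c.e, c.inner_e, real_inner_comm, inner_gradient_left, map_smul,
      smul_eq_mul] at h1
    linarith
  obtain ⟨δ, hδ, hball⟩ : ∃ δ > 0, ∀ ρ : ℝ, |ρ| < δ →
      ρ • b ∈ Metric.ball (0 : Param n) c.r ∧ 0 < 1 + a * ρ := by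
    have h1 : ∀ᶠ ρ in 𝓝 (0 : ℝ), ρ • b ∈ Metric.ball (0 : Param n) c.r := by
      have : ContinuousAt (fun ρ : ℝ => ρ • b) 0 := by fun_prop
      exact this.eventually (Metric.isOpen_ball.mem_nhds (by simpa using c.r_pos))
    have h2 : ∀ᶠ ρ in 𝓝 (0 : ℝ), 0 < 1 + a * ρ := by
      have : ContinuousAt (fun ρ : ℝ => 1 + a * ρ) 0 := by fun_prop
      exact this.eventually (lt_mem_nhds (by simp))
    obtain ⟨δ, hδ, h⟩ := Metric.eventually_nhds_iff.1 (h1.and h2)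
    exact ⟨δ, hδ, fun ρ hρ => h (by simpa [Real.dist_eq] using hρ)⟩
  have hzero : ∀ ρ ∈ Ioo (-δ) δ, θ ρ = 0 := by
    intro ρ hρ
    set q : ℝ → ℝ := fun ρ => θ ρ / (1 + a * ρ) with hq
    have hqd : ∀ z ∈ Ioo (-δ) δ, HasDerivAt q 0 z := by
      intro z hz
      obtain ⟨h1, h2⟩ := hball z (abs_lt.2 hz)
      have h3 : HasDerivAt (fun ρ : ℝ => 1 + a * ρ) a z := by
        simpa using ((hasDerivAt_id z).const_mul a).const_add 1
      have h4 := (hθd z).div h3 h2.ne'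
      have h5 : (fderiv ℝ c.u (z • b) b * (1 + a * z) - θ z * a) / (1 + a * z) ^ 2 = 0 := by
        rw [div_eq_zero_iff]
        left
        have := hode z h1
        linarith
      rw [h5] at h4
      exact h4
    have h5 : q ρ = q 0 := by
      refine (convex_Ioo (-δ) δ).is_const_of_fderivWithin_eq_zero (𝕜 := ℝ)
        (fun z hz => (hqd z hz).differentiableAt.differentiableWithinAt) (fun z hz => ?_) hρ
        ⟨by linarith, hδ⟩
      rw [fderivWithin_of_isOpen isOpen_Ioo hz]
      ext
      simpa using (hqd z hz).deriv
    have h6 : θ 0 = 0 := by simp [hθ, c.u_zero]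
    have h7 := (hball ρ (abs_lt.2 hρ)).2.ne'
    simp only [hq, h6, zero_div] at h5
    rcases div_eq_zero_iff.1 h5 with h | h
    · exact h
    · exact absurd h h7
  filter_upwards [Ioo_mem_nhds (show -δ < 0 by linarith) hδ] with ρ hρ
  have h1 := (hball ρ (abs_lt.2 hρ)).1
  have h2 := c.param_mem h1
  have h3 : c.param (ρ • b) = p + ρ • X := by
    rw [GraphChart.param, show c.u (ρ • b) = 0 from hzero ρ hρ, map_smul, ← hXb]
    simp
  rwa [h3] at h2

/-- The endpoint of a half-open segment contained in a complete hypersurface lies in it too. -/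
theorem segment_endpoint_mem (hc : IsIntrinsicallyComplete S) {v : Ambient n} {b : ℝ} (hb : 0 < b)
    (h : ∀ ρ ∈ Ico 0 b, p + ρ • v ∈ S) : p + b • v ∈ S := by
  -- The starting value is `s 0 = 0`. The points converge to the endpoint along the segment, hence
  -- are intrinsically Cauchy, and the intrinsic limit must be the ambient one.
  set s : ℕ → ℝ := fun k => b - b / (k + 1) with hs
  have hs1 : ∀ k, s k ∈ Ico 0 b := by
    intro k
    have h1 : b / ((k : ℝ) + 1) ≤ b := div_le_self hb.le (by linarith [(k.cast_nonneg : (0 : ℝ) ≤ k)])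
    have h2 : 0 < b / ((k : ℝ) + 1) := by positivity
    exact ⟨by simp only [hs]; linarith, by simp only [hs]; linarith⟩
  have hlim : Tendsto s atTop (𝓝 b) := by
    have := (tendsto_const_div_atTop_nhds_zero_nat b).comp (tendsto_add_atTop_nat 1)
    have h1 := this.const_sub b
    simpa [Function.comp_def] using h1
  have hdist : ∀ a ∈ Ico 0 b, ∀ d ∈ Ico 0 b, a ≤ d →
      intrinsicEDist S (p + a • v) (p + d • v) ≤ ENNReal.ofReal (‖v‖ * (d - a)) := by
    intro a ha d hd had
    have h1 := intrinsicEDist_le_pathLength (S := S) (γ := fun ρ => p + ρ • v) had (by fun_prop)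
      (fun ρ hρ => h ρ ⟨ha.1.trans hρ.1, hρ.2.trans_lt hd.2⟩)
    refine h1.trans (pathLength_le_of_norm_deriv_le (fun t _ => ?_) had)
    have : HasDerivAt (fun ρ : ℝ => p + ρ • v) v t := by
      simpa using ((hasDerivAt_id t).smul_const v).const_add p
    rw [this.deriv]
  have hdist' : ∀ a ∈ Ico 0 b, ∀ d ∈ Ico 0 b,
      intrinsicEDist S (p + a • v) (p + d • v) ≤ ENNReal.ofReal (‖v‖ * |d - a|) := by
    intro a ha d hd
    rcases le_total a d with h1 | h1
    · rw [abs_of_nonneg (by linarith)]; exact hdist a ha d hd h1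
    · rw [intrinsicEDist_comm, abs_sub_comm, abs_of_nonneg (by linarith)]; exact hdist d hd a ha h1
  obtain ⟨q, hq, hqlim⟩ := hc (fun k => p + s k • v) (fun k => h _ (hs1 k)) (by
    intro ε hε
    obtain ⟨d, hd, hdε⟩ : ∃ d : ℝ, 0 < d ∧ ENNReal.ofReal (‖v‖ * d) < ε := by
      have h1 : Tendsto (fun d : ℝ => ENNReal.ofReal (‖v‖ * d)) (𝓝[>] 0) (𝓝 0) := by
        have h2 : Continuous (fun d : ℝ => ENNReal.ofReal (‖v‖ * d)) :=
          ENNReal.continuous_ofReal.comp (by fun_prop)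
        have h3 := (h2.tendsto 0).mono_left (nhdsWithin_le_nhds (s := Ioi 0))
        simpa using h3
      obtain ⟨d, h4, h5⟩ := ((h1.eventually (gt_mem_nhds hε)).and self_mem_nhdsWithin).exists
      exact ⟨d, h5, h4⟩
    obtain ⟨N, hN⟩ := Metric.cauchySeq_iff.1 hlim.cauchySeq d hd
    refine ⟨N, fun k hk l hl => (hdist' _ (hs1 k) _ (hs1 l)).trans_lt (lt_of_le_of_lt ?_ hdε)⟩
    gcongr
    have := hN l hl k hk
    rw [Real.dist_eq] at this
    exact this.le)
  have h1 : Tendsto (fun k => p + s k • v) atTop (𝓝 q) := by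
    rw [tendsto_iff_edist_tendsto_0]
    exact tendsto_of_tendsto_of_tendsto_of_le_of_le tendsto_const_nhds hqlim (fun _ => bot_le)
      (fun k => edist_le_intrinsicEDist _ _)
  have h2 : Tendsto (fun k => p + s k • v) atTop (𝓝 (p + b • v)) :=
    (hlim.smul_const v).const_add p
  rw [← tendsto_nhds_unique h1 h2]
  exact hq

/-- Integral lines of a tangent affine field stay in a complete hypersurface as long as the field
does not vanish. -/
theorem add_smul_mem_of_pos (hS : IsEmbeddedHypersurface S) (hc : IsIntrinsicallyComplete S)
    {y : Ambient n} {a : ℝ} (htan : ∀ x ∈ S, inner ℝ (y + a • x) (normal S x) = (0 : ℝ))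
    (hp : p ∈ S) {v : Ambient n} {k : ℝ} (hv : k • v = y + a • p) {b : ℝ} (hb : 0 ≤ b)
    (hpos : ∀ ρ ∈ Ico 0 b, k + a * ρ ≠ 0) : p + b • v ∈ S := by
  rcases hb.eq_or_lt with rfl | hb0
  · simpa using hp
  set T : Set ℝ := {ρ | ∀ σ ∈ Icc 0 ρ, p + σ • v ∈ S} with hT
  have hTdown : ∀ r ∈ T, ∀ s ≤ r, s ∈ T := fun r hr s hs σ hσ => hr σ ⟨hσ.1, hσ.2.trans hs⟩
  have hTc : IsClosed T := by
    rw [← isOpen_compl_iff, Metric.isOpen_iff]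
    intro r hr
    obtain ⟨s, hs, hsT⟩ : ∃ s < r, s ∉ T := by
      by_contra! h
      apply hr
      intro σ hσ
      rcases hσ.2.lt_or_eq with h1 | rfl
      · exact h σ h1 σ ⟨hσ.1, le_rfl⟩
      rcases hσ.1.eq_or_lt with rfl | h2
      · simpa using hp
      · exact segment_endpoint_mem hc h2 fun ρ hρ => h ρ hρ.2 ρ ⟨hρ.1, le_rfl⟩
    refine ⟨r - s, by linarith, fun z hz hzT => hsT (hTdown z hzT s ?_)⟩
    rw [Metric.mem_ball, Real.dist_eq, abs_lt] at hz
    linarith [hz.1]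
  have h0T : (0 : ℝ) ∈ T := by
    intro σ hσ
    rw [le_antisymm hσ.2 hσ.1]
    simpa using hp
  have hsub : Icc 0 b ⊆ T := by
    refine IsClosed.Icc_subset_of_forall_mem_nhdsWithin (hTc.inter isClosed_Icc) h0T ?_
    rintro r ⟨hrT, hr⟩
    have hpr : p + r • v ∈ S := hrT r ⟨hr.1, le_rfl⟩
    have hkr := hpos r hr
    -- Along the line the field stays parallel to `v`. Where its coefficient is nonzero, the local
    -- statement extends the segment beyond `r`, after division of the time by that coefficient.
    have hdir : y + a • (p + r • v) = (k + a * r) • v := by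
      have : y = k • v - a • p := by rw [hv]; abel
      rw [this]; module
    have hev := eventually_add_smul_mem hS htan hpr
    rw [hdir] at hev
    obtain ⟨δ, hδ, hball⟩ := Metric.eventually_nhds_iff.1 hev
    have hδ' : 0 < δ * |k + a * r| := mul_pos hδ (abs_pos.2 hkr)
    filter_upwards [Ioo_mem_nhdsGT (show r < r + δ * |k + a * r| by linarith)] with z hz
    intro σ hσ
    rcases le_or_gt σ r with h1 | h1
    · exact hrT σ ⟨hσ.1, h1⟩
    · have h2 := hball (y := (σ - r) / (k + a * r)) (by
        rw [Real.dist_eq, sub_zero, abs_div, div_lt_iff₀ (abs_pos.2 hkr), abs_of_pos (by linarith)]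
        linarith [hz.2, hσ.2])
      rw [smul_smul, div_mul_cancel₀ _ hkr, add_assoc, ← add_smul, add_sub_cancel] at h2
      exact h2
  exact hsub ⟨hb, le_rfl⟩ b ⟨hb, le_rfl⟩

theorem splitsOffLine_of_add_smul_mem {v : Ambient n} (hv : ‖v‖ = 1)
    (h : ∀ x ∈ S, ∀ s : ℝ, x + s • v ∈ S) : SplitsOffLine S := by
  have hvv : (inner ℝ v v : ℝ) = 1 := by rw [real_inner_self_eq_norm_sq, hv, one_pow]
  refine ⟨v, {x ∈ S | inner ℝ x v = (0 : ℝ)}, hv, fun y hy => hy.2, ?_⟩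
  ext x
  constructor
  · intro hx
    refine ⟨x + (-(inner ℝ x v : ℝ)) • v, ⟨h x hx _, ?_⟩, inner ℝ x v, ?_⟩
    · rw [inner_add_left, real_inner_smul_left, hvv]; ring
    · module
  · rintro ⟨y, hy, s, rfl⟩
    exact h y hy.1 s

/-- A complete hypersurface to which a nonzero affine field `y + a x` is tangent splits off a
line. -/
theorem splitsOffLine_of_tangent (hn : 1 ≤ n) (hS : IsEmbeddedHypersurface S)
    (hc : IsIntrinsicallyComplete S) (hne : S.Nonempty) {y : Ambient n} {a : ℝ}
    (hya : y ≠ 0 ∨ a ≠ 0) (htan : ∀ x ∈ S, inner ℝ (y + a • x) (normal S x) = (0 : ℝ)) :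
    SplitsOffLine S := by
  rcases eq_or_ne a 0 with rfl | ha
  · have hy : y ≠ 0 := by simpa using hya
    have hy' : ‖y‖ ≠ 0 := norm_ne_zero_iff.2 hy
    refine splitsOffLine_of_add_smul_mem (v := ‖y‖⁻¹ • y)
      (by rw [norm_smul, norm_inv, norm_norm, inv_mul_cancel₀ hy']) fun x hx s => ?_
    rcases le_total 0 s with h | h
    · exact add_smul_mem_of_pos hS hc htan hx (k := ‖y‖)
        (by rw [smul_smul, mul_inv_cancel₀ hy']; simp) h (by simp [hy])
    · have := add_smul_mem_of_pos hS hc htan hx (v := -(‖y‖⁻¹ • y)) (k := -‖y‖)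
        (by rw [neg_smul_neg, smul_smul, mul_inv_cancel₀ hy']; simp)
        (b := -s) (by linarith) (by simp [hy])
      rwa [neg_smul_neg] at this
  -- The field is `a (x - q)`, so `S` is a cone with vertex `q`. The value `σ = 0` is allowed in
  -- `hcone`: the field vanishes only at the end of the inward ray, and completeness supplies that
  -- endpoint.
  · set q : Ambient n := -(a⁻¹ • y) with hq
    have hfield : ∀ x, y + a • x = a • (x - q) := by
      intro x
      rw [hq, sub_neg_eq_add, smul_add, smul_smul, mul_inv_cancel₀ ha, one_smul, add_comm]
    have hcone : ∀ x ∈ S, ∀ σ : ℝ, 0 ≤ σ → q + σ • (x - q) ∈ S := by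
      intro x hx σ hσ
      rcases le_total 1 σ with h | h
      · have := add_smul_mem_of_pos hS hc htan hx (v := x - q) (k := a) (hfield x).symm
          (b := σ - 1) (by linarith) (fun ρ hρ => by
            have : a + a * ρ = a * (1 + ρ) := by ring
            rw [this]
            exact mul_ne_zero ha (by linarith [hρ.1]))
        convert this using 1
        module
      · have := add_smul_mem_of_pos hS hc htan hx (v := -(x - q)) (k := -a)
          (by rw [neg_smul_neg, hfield x])
          (b := 1 - σ) (by linarith) (fun ρ hρ => by
            have : -a + a * ρ = a * (ρ - 1) := by ring
            rw [this]
            exact mul_ne_zero ha (by linarith [hρ.2]))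
        convert this using 1
        module
    have hqS : q ∈ S := by
      obtain ⟨x, hx⟩ := hne
      simpa using hcone x hx 0 le_rfl
    obtain ⟨c⟩ := hS.nonempty_graphChart hqS
    -- All of `S` lies in the tangent plane at the vertex.
    have hplane : ∀ x ∈ S, (inner ℝ (x - q) c.e : ℝ) = 0 := by
      intro x hx
      set z := x - q with hz
      have hev : ∀ᶠ σ in 𝓝[>] (0 : ℝ),
          σ * (inner ℝ z c.e : ℝ) = c.u (σ • c.T z) := by
        have h1 : ∀ᶠ σ in 𝓝 (0 : ℝ), q + σ • z ∈ c.dom := by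
          have : ContinuousAt (fun σ : ℝ => q + σ • z) 0 := by fun_prop
          exact this.eventually (c.isOpen_dom.mem_nhds (by simpa using c.mem_dom))
        filter_upwards [nhdsWithin_le_nhds h1, self_mem_nhdsWithin] with σ h2 h3
        have h4 := (c.mem_iff_of_dom h2).1 (hcone x hx σ (le_of_lt h3))
        rwa [GraphChart.height, GraphChart.proj, add_sub_cancel_left, real_inner_smul_left,
          map_smul] at h4
      have hd : HasDerivAt (fun σ : ℝ => c.u (σ • c.T z)) 0 0 := by
        have h1 : HasDerivAt (fun σ : ℝ => σ • c.T z) (c.T z) 0 := by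
          simpa using (hasDerivAt_id (0 : ℝ)).smul_const (c.T z)
        have h2 : HasFDerivAt c.u (fderiv ℝ c.u ((0 : ℝ) • c.T z)) ((0 : ℝ) • c.T z) :=
          (c.smooth.differentiable (by simp)).differentiableAt.hasFDerivAt
        have h3 := h2.comp_hasDerivAt 0 h1
        rw [zero_smul, c.fderiv_u_zero] at h3
        exact h3
      have h5 := hd.tendsto_slope_zero_right
      refine tendsto_nhds_unique (f := fun _ : ℝ => (inner ℝ z c.e : ℝ)) (l := 𝓝[>] (0 : ℝ))
        tendsto_const_nhds ?_
      refine h5.congr' ?_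
      filter_upwards [hev, self_mem_nhdsWithin] with σ h6 h7
      have h8 : σ ≠ 0 := ne_of_gt h7
      rw [zero_add, ← h6, zero_smul, c.u_zero, sub_zero, smul_eq_mul, inv_mul_cancel_left₀ h8]
    have hu0 : ∀ w ∈ Metric.ball (0 : Param n) c.r, c.u w = 0 := by
      intro w hw
      have := hplane _ (c.param_mem hw)
      rwa [← GraphChart.height, c.height_param] at this
    -- Near the vertex `S` is a flat disc; scaling it by the cone property fills the hyperplane.
    have hfull : ∀ w : Param n, q + c.ι w ∈ S := by
      intro w
      have hw : 0 < ‖w‖ + 1 := by positivity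
      set τ := c.r / (‖w‖ + 1) with hτ
      have hτ0 : 0 < τ := div_pos c.r_pos hw
      have h1 : τ • w ∈ Metric.ball (0 : Param n) c.r := by
        rw [mem_ball_zero_iff, norm_smul, Real.norm_of_nonneg hτ0.le, hτ, div_mul_eq_mul_div,
          div_lt_iff₀ hw]
        nlinarith [c.r_pos]
      have h2 := hcone _ (c.param_mem h1) τ⁻¹ (inv_nonneg.2 hτ0.le)
      rw [c.param_sub, hu0 _ h1, zero_smul, add_zero, map_smul, smul_smul,
        inv_mul_cancel₀ hτ0.ne', one_smul] at h2
      exact h2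
    -- Here `1 ≤ n` is essential: the hyperplane must contain a direction to split off.
    set i : Fin n := ⟨0, hn⟩
    refine splitsOffLine_of_add_smul_mem (v := c.ι (EuclideanSpace.single i 1))
      (by rw [LinearIsometry.norm_map]; simp) fun x hx s => ?_
    have h1 : x - q = c.ι (c.T (x - q)) := by
      conv_lhs => rw [c.decomp' (x - q), hplane x hx, zero_smul, add_zero]
    have h2 := hfull (c.T (x - q) + s • EuclideanSpace.single i 1)
    rw [map_add, map_smul, ← h1] at h2
    convert h2 using 1
    abel

end

/-! ### Gaussian integrals under polynomial volume growth -/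

section

variable {n : ℕ} {S : Set (Ambient n)}

/-- Gaussians are integrable on sets of polynomial volume growth. -/
theorem integrable_exp_neg_mul_sq (hg : HasPolynomialVolumeGrowth S) {c : ℝ} (hc : 0 < c) :
    Integrable (fun x => Real.exp (-c * ‖x‖ ^ 2)) (areaMeasure S) := by
  obtain ⟨C, d, hCd⟩ := hg
  refine ⟨by fun_prop, ?_⟩
  obtain ⟨m, hm⟩ := exists_nat_ge d
  -- Where `k ≤ ‖x‖ < k + 1` the Gaussian is at most `exp (-c k²)`, and the volume of the ball of
  -- radius `k + 1` is polynomial in `k`. The inequality `k ≤ k²` turns the bound into a term of a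
  -- known summable series.
  have hterm : ∀ k : ℕ, ENNReal.ofReal (Real.exp (-c * (k : ℝ) ^ 2)) *
      areaMeasure S (Metric.ball 0 ((k : ℝ) + 1)) ≤
      ENNReal.ofReal (|C| * Real.exp c * (((k + 1 : ℕ) : ℝ) ^ m *
        Real.exp (-c * ((k + 1 : ℕ) : ℝ)))) := by
    intro k
    refine (mul_le_mul_right (hCd (k + 1) (by simp)) _).trans ?_
    rw [← ENNReal.ofReal_mul (Real.exp_pos _).le]
    refine ENNReal.ofReal_le_ofReal ?_
    have h1 : ((k : ℝ) + 1) ^ d ≤ ((k : ℝ) + 1) ^ m := by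
      rw [← Real.rpow_natCast]
      exact Real.rpow_le_rpow_of_exponent_le (by simp) hm
    have h2 : (k : ℝ) ≤ (k : ℝ) ^ 2 := by exact_mod_cast Nat.le_self_pow two_ne_zero k
    have h3 : Real.exp (-c * (k : ℝ) ^ 2) ≤ Real.exp c * Real.exp (-c * ((k : ℝ) + 1)) := by
      rw [← Real.exp_add]
      exact Real.exp_le_exp.2 (by nlinarith)
    have h4 : C * ((k : ℝ) + 1) ^ d ≤ |C| * ((k : ℝ) + 1) ^ m :=
      mul_le_mul (le_abs_self C) h1 (by positivity) (abs_nonneg C)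
    push_cast
    calc Real.exp (-c * (k : ℝ) ^ 2) * (C * ((k : ℝ) + 1) ^ d)
        ≤ Real.exp (-c * (k : ℝ) ^ 2) * (|C| * ((k : ℝ) + 1) ^ m) :=
          mul_le_mul_of_nonneg_left h4 (Real.exp_pos _).le
      _ ≤ (Real.exp c * Real.exp (-c * ((k : ℝ) + 1))) * (|C| * ((k : ℝ) + 1) ^ m) :=
          mul_le_mul_of_nonneg_right h3 (by positivity)
      _ = _ := by ring
  have hsum : Summable fun k : ℕ => |C| * Real.exp c * (((k + 1 : ℕ) : ℝ) ^ m *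
      Real.exp (-c * ((k + 1 : ℕ) : ℝ))) :=
    ((summable_nat_add_iff 1).2 (Real.summable_pow_mul_exp_neg_nat_mul m hc)).mul_left _
  have hpt : ∀ x : Ambient n, ‖Real.exp (-c * ‖x‖ ^ 2)‖ₑ ≤
      ∑' k : ℕ, (Metric.ball 0 ((k : ℝ) + 1)).indicator
        (fun _ => ENNReal.ofReal (Real.exp (-c * (k : ℝ) ^ 2))) x := by
    intro x
    refine le_trans ?_ (ENNReal.le_tsum ⌊‖x‖⌋₊)
    rw [indicator_of_mem (by simpa using Nat.lt_floor_add_one ‖x‖),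
      Real.enorm_of_nonneg (Real.exp_pos _).le]
    refine ENNReal.ofReal_le_ofReal (Real.exp_le_exp.2 ?_)
    have h1 := Nat.floor_le (norm_nonneg x)
    have h2 : ((⌊‖x‖⌋₊ : ℕ) : ℝ) ^ 2 ≤ ‖x‖ ^ 2 := pow_le_pow_left₀ (Nat.cast_nonneg _) h1 2
    nlinarith
  refine (lintegral_mono hpt).trans_lt ?_
  rw [lintegral_tsum fun k => (measurable_const.indicator measurableSet_ball).aemeasurable]
  simp_rw [lintegral_indicator_const measurableSet_ball]
  refine (ENNReal.tsum_le_tsum hterm).trans_lt ?_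
  rw [← ENNReal.ofReal_tsum_of_nonneg (fun k => by positivity) hsum]
  exact ENNReal.ofReal_lt_top

/-- Gaussians with quadratic weights are integrable on sets of polynomial volume growth. -/
theorem integrable_one_add_sq_mul_exp (hg : HasPolynomialVolumeGrowth S) {c : ℝ} (hc : 0 < c) :
    Integrable (fun x => (1 + ‖x‖) ^ 2 * Real.exp (-c * ‖x‖ ^ 2)) (areaMeasure S) := by
  refine ((integrable_exp_neg_mul_sq hg (half_pos hc)).const_mul (2 + 4 / c)).mono' (by fun_prop)
    (Eventually.of_forall fun x => ?_)
  rw [Real.norm_of_nonneg (by positivity)]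
  -- From `(1 + r)² ≤ 2 + 2 r²`, `2 r² = (4 / c) (c r² / 2)` and `1 + z ≤ exp z`; half of the decay
  -- is spent on the weight.
  have h1 : (1 + ‖x‖) ^ 2 ≤ (2 + 4 / c) * Real.exp (c / 2 * ‖x‖ ^ 2) := by
    have h2 := Real.add_one_le_exp (c / 2 * ‖x‖ ^ 2)
    have h3 : (2 + 4 / c) * (c / 2 * ‖x‖ ^ 2 + 1) = 2 + c * ‖x‖ ^ 2 + 2 * ‖x‖ ^ 2 + 4 / c := by
      field_simp
      ring
    have h4 := mul_le_mul_of_nonneg_left h2 (show 0 ≤ 2 + 4 / c by positivity)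
    have h5 : 0 ≤ c * ‖x‖ ^ 2 + 4 / c := by positivity
    nlinarith [sq_nonneg (1 - ‖x‖)]
  calc (1 + ‖x‖) ^ 2 * Real.exp (-c * ‖x‖ ^ 2)
      ≤ (2 + 4 / c) * Real.exp (c / 2 * ‖x‖ ^ 2) * Real.exp (-c * ‖x‖ ^ 2) :=
        mul_le_mul_of_nonneg_right h1 (Real.exp_pos _).le
    _ = (2 + 4 / c) * Real.exp (-(c / 2) * ‖x‖ ^ 2) := by
        rw [mul_assoc, ← Real.exp_add]
        congr 2
        ring

/-- The Gaussian of scale `t` centred at `b`. -/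
def gauss (b : Ambient n) (t : ℝ) (x : Ambient n) : ℝ := Real.exp (-‖x - b‖ ^ 2 / (4 * t))

theorem gauss_pos (b : Ambient n) (t : ℝ) (x : Ambient n) : 0 < gauss b t x := Real.exp_pos _

/-- A Gaussian is bounded by a centred one, uniformly for bounded centres and scales. -/
theorem gauss_le {b : Ambient n} {t B τ T : ℝ} (hb : ‖b‖ ≤ B) (hτ : 0 < τ) (hτt : τ ≤ t)
    (htT : t ≤ T) (x : Ambient n) :
    gauss b t x ≤ Real.exp (B ^ 2 / (4 * τ)) * Real.exp (-(1 / (8 * T)) * ‖x‖ ^ 2) := by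
  have ht : 0 < t := hτ.trans_le hτt
  have hT : 0 < T := ht.trans_le htT
  rw [gauss, ← Real.exp_add]
  refine Real.exp_le_exp.2 ?_
  have h1 : ‖x‖ ≤ ‖x - b‖ + ‖b‖ := by simpa using norm_add_le (x - b) b
  -- Moving the centre to the origin costs half of the exponent, whence the `8` in the bound.
  have h2 : ‖x‖ ^ 2 / 2 ≤ ‖x - b‖ ^ 2 + ‖b‖ ^ 2 := by
    nlinarith [sq_nonneg (‖x - b‖ - ‖b‖), norm_nonneg x, norm_nonneg (x - b), norm_nonneg b,
      pow_le_pow_left₀ (norm_nonneg x) h1 2]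
  have h3 : -‖x - b‖ ^ 2 / (4 * t) ≤ (‖b‖ ^ 2 - ‖x‖ ^ 2 / 2) / (4 * t) := by
    gcongr
    linarith
  have h4 : ‖b‖ ^ 2 / (4 * t) ≤ B ^ 2 / (4 * τ) := by gcongr
  have h5 : 1 / (8 * T) * ‖x‖ ^ 2 ≤ 1 / (8 * t) * ‖x‖ ^ 2 := by gcongr
  have h6 : (‖b‖ ^ 2 - ‖x‖ ^ 2 / 2) / (4 * t) = ‖b‖ ^ 2 / (4 * t) - 1 / (8 * t) * ‖x‖ ^ 2 := by
    field_simp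
    ring
  linarith

theorem continuous_gauss (b : Ambient n) (t : ℝ) : Continuous (gauss b t) := by
  unfold gauss
  fun_prop

/-- Functions with Gaussian decay are integrable on sets of polynomial volume growth. -/
theorem integrable_of_le_gauss (hg : HasPolynomialVolumeGrowth S) {E : Type*}
    [NormedAddCommGroup E] {f : Ambient n → E} (hf : AEStronglyMeasurable f (areaMeasure S))
    {b : Ambient n} {t K : ℝ} (ht : 0 < t) (hK : 0 ≤ K)
    (hle : ∀ᵐ x ∂(areaMeasure S), ‖f x‖ ≤ K * (1 + ‖x‖) ^ 2 * gauss b t x) :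
    Integrable f (areaMeasure S) := by
  refine ((integrable_one_add_sq_mul_exp hg (c := 1 / (8 * t)) (by positivity)).const_mul
    (K * Real.exp (‖b‖ ^ 2 / (4 * t)))).mono' hf ?_
  filter_upwards [hle] with x hx
  refine hx.trans ?_
  have h := mul_le_mul_of_nonneg_left (gauss_le le_rfl ht le_rfl le_rfl x : gauss b t x ≤ _)
    (show 0 ≤ K * (1 + ‖x‖) ^ 2 by positivity)
  linarith

theorem integrable_gauss (hg : HasPolynomialVolumeGrowth S) (b : Ambient n) {t : ℝ} (ht : 0 < t) :
    Integrable (gauss b t) (areaMeasure S) := by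
  refine integrable_of_le_gauss hg (b := b) (continuous_gauss b t).aestronglyMeasurable ht zero_le_one
    (Eventually.of_forall fun x => ?_)
  rw [Real.norm_of_nonneg (gauss_pos b t x).le, one_mul]
  exact le_mul_of_one_le_left (gauss_pos b t x).le
    (one_le_pow₀ (by linarith [norm_nonneg x]))

/-- The Gaussian functional as a real number. -/
def gaussianReal (S : Set (Ambient n)) (b : Ambient n) (t : ℝ) : ℝ :=
  (4 * Real.pi * t) ^ (-(n : ℝ) / 2) * ∫ x, gauss b t x ∂(areaMeasure S)

theorem gaussianF_eq_ofReal (hg : HasPolynomialVolumeGrowth S) (b : Ambient n) {t : ℝ}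
    (ht : 0 < t) : gaussianF S b t = ENNReal.ofReal (gaussianReal S b t) := by
  rw [gaussianF, gaussianReal, ENNReal.ofReal_mul (by positivity),
    ofReal_integral_eq_lintegral_ofReal (integrable_gauss hg b ht)
      (Eventually.of_forall fun x => (gauss_pos b t x).le)]
  rfl

theorem gaussianReal_nonneg (b : Ambient n) {t : ℝ} (ht : 0 < t) : 0 ≤ gaussianReal S b t :=
  mul_nonneg (by positivity) (integral_nonneg fun x => (gauss_pos b t x).le)

/-- The Gaussian functional depends continuously on centre and scale. -/
theorem continuousAt_gaussianReal (hg : HasPolynomialVolumeGrowth S) (b : Ambient n) {t : ℝ}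
    (ht : 0 < t) : ContinuousAt (fun q : Ambient n × ℝ => gaussianReal S q.1 q.2) (b, t) := by
  unfold gaussianReal
  refine ContinuousAt.mul ?_ ?_
  · exact ContinuousAt.rpow_const (by fun_prop) (Or.inl (by positivity))
  · have hnhds : {q : Ambient n × ℝ | ‖q.1‖ < ‖b‖ + 1 ∧ t / 2 < q.2 ∧ q.2 < 2 * t} ∈ 𝓝 (b, t) := by
      refine IsOpen.mem_nhds ?_ ⟨by simp, by simp; linarith, by simp; linarith⟩
      exact (isOpen_lt continuous_fst.norm continuous_const).inter
        ((isOpen_lt continuous_const continuous_snd).inter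
          (isOpen_lt continuous_snd continuous_const))
    refine continuousAt_of_dominated (bound := fun x =>
      Real.exp ((‖b‖ + 1) ^ 2 / (4 * (t / 2))) * Real.exp (-(1 / (8 * (2 * t))) * ‖x‖ ^ 2))
      (Eventually.of_forall fun q => (continuous_gauss _ _).aestronglyMeasurable) ?_
      ((integrable_exp_neg_mul_sq hg (by positivity)).const_mul _)
      (Eventually.of_forall fun x => ?_)
    · filter_upwards [hnhds] with q hq
      refine Eventually.of_forall fun x => ?_
      rw [Real.norm_of_nonneg (gauss_pos _ _ x).le]
      exact gauss_le hq.1.le (by positivity) hq.2.1.le hq.2.2.le x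
    · unfold gauss
      refine Real.continuous_exp.continuousAt.comp (ContinuousAt.div (by fun_prop) (by fun_prop) ?_)
      simpa using ht.ne'

end

/-! ### The pointwise identity behind monotonicity -/

section

variable {n : ℕ} {S : Set (Ambient n)}

theorem contDiff_gauss (b : Ambient n) (t : ℝ) : ContDiff ℝ 1 (gauss b t) := by
  unfold gauss
  exact (((contDiff_id.sub contDiff_const).norm_sq ℝ).neg.div_const _).exp

theorem hasFDerivAt_gauss (b : Ambient n) {t : ℝ} (ht : t ≠ 0) (x : Ambient n) :
    HasFDerivAt (gauss b t) (-(gauss b t x / (2 * t)) • innerSL ℝ (x - b)) x := by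
  have h1 := ((hasFDerivAt_id (𝕜 := ℝ) x).sub_const b).norm_sq
  have h2 := (h1.neg.mul_const (4 * t)⁻¹).exp
  simp only [← div_eq_mul_inv] at h2
  refine HasFDerivAt.congr_fderiv (f := gauss b t) h2 ?_
  ext v
  simp [gauss]
  field_simp
  norm_num

/-- The field whose divergence theorem yields the monotonicity of the Gaussian functional. -/
def gaussField (b y : Ambient n) (t α : ℝ) (x : Ambient n) : Ambient n :=
  gauss b t x • (α • (x - b) + y)

theorem contDiff_gaussField (b y : Ambient n) (t α : ℝ) : ContDiff ℝ 1 (gaussField b y t α) :=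
  (contDiff_gauss b t).smul
    (((contDiff_id.sub contDiff_const).const_smul α).add contDiff_const)

theorem hasFDerivAt_gaussField (b y : Ambient n) {t : ℝ} (ht : t ≠ 0) (α : ℝ) (x : Ambient n) :
    HasFDerivAt (gaussField b y t α) (gauss b t x • (α • ContinuousLinearMap.id ℝ (Ambient n)) +
      (-(gauss b t x / (2 * t)) • innerSL ℝ (x - b)).smulRight (α • (x - b) + y)) x :=
  (hasFDerivAt_gauss b ht x).smul
    ((((hasFDerivAt_id (𝕜 := ℝ) x).sub_const b).const_smul α).add_const y)

theorem tr_id : tr (ContinuousLinearMap.id ℝ (Ambient n)) = n + 1 := by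
  simp [tr]

/-- Write `t = 1 + a s²`, `b = s y`, `α = a s / t`. The first bracket is the logarithmic
`s`-derivative of the weighted Gaussian; its terms cancel against `n α` and `-⟨x - b, V⟩ / (2t)`
from the divergence, where `V = α (x - b) + y`. What remains is half of `⟨(x - b)/t - x, N⟩ ⟨V, N⟩`.
The path and `α` are chosen so that `V = (y + a s x) / t` and `(x - b)/t - x = -s (y + a s x) / t`,
which makes this a negative multiple of a square when `s > 0`. -/
theorem shrinkerDiv_gaussField (hS : IsEmbeddedHypersurface S) {x y : Ambient n} (hx : x ∈ S)
    {s a : ℝ} (ht : 1 + a * s ^ 2 ≠ 0) :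
    ((-n * (a * s / (1 + a * s ^ 2)) + inner ℝ (x - s • y) y / (2 * (1 + a * s ^ 2)) +
      ‖x - s • y‖ ^ 2 * (a * s) / (2 * (1 + a * s ^ 2) ^ 2)) * gauss (s • y) (1 + a * s ^ 2) x) +
      shrinkerDiv S (gaussField (s • y) y (1 + a * s ^ 2) (a * s / (1 + a * s ^ 2))) x =
    -(s / (2 * (1 + a * s ^ 2) ^ 2)) *
      ((inner ℝ (y + (a * s) • x) (normal S x)) ^ 2 * gauss (s • y) (1 + a * s ^ 2) x) := by
  have hN : (inner ℝ (normal S x) (normal S x) : ℝ) = 1 := by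
    rw [real_inner_self_eq_norm_sq, norm_normal hS hx, one_pow]
  rw [shrinkerDiv, (hasFDerivAt_gaussField (s • y) y ht _ x).fderiv]
  simp only [tr_add, tr_smul, tr_smulRight, tr_id, gaussField, _root_.add_apply,
    ContinuousLinearMap.smulRight_apply, _root_.smul_apply, ContinuousLinearMap.id_apply,
    innerSL_apply_apply, inner_add_left, inner_smul_left, inner_add_right, inner_smul_right,
    inner_sub_left, hN, smul_eq_mul, conj_trivial, ← real_inner_self_eq_norm_sq, inner_sub_right]
  rw [real_inner_comm x y]
  set A : ℝ := inner ℝ x (normal S x)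
  set B : ℝ := inner ℝ y (normal S x)
  set P : ℝ := gauss (s • y) (1 + a * s ^ 2) x
  set X : ℝ := inner ℝ x x
  set Y : ℝ := inner ℝ y y
  set Z : ℝ := inner ℝ x y
  field_simp
  ring

/-- Along the paths `s ↦ (s y, 1 + a s²)` the exponent of the Gaussian has the expected
derivative. -/
theorem hasDerivAt_gauss_path (x y : Ambient n) {a s : ℝ} (ht : 1 + a * s ^ 2 ≠ 0) :
    HasDerivAt (fun σ : ℝ => gauss (σ • y) (1 + a * σ ^ 2) x)
      ((inner ℝ (x - s • y) y / (2 * (1 + a * s ^ 2)) +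
      ‖x - s • y‖ ^ 2 * (a * s) / (2 * (1 + a * s ^ 2) ^ 2)) * gauss (s • y) (1 + a * s ^ 2) x) s := by
  have h1 : HasDerivAt (fun σ : ℝ => x - σ • y) (-y) s := by
    simpa using ((hasDerivAt_id s).smul_const y).const_sub x
  have h2 : HasDerivAt (fun σ : ℝ => 4 * (1 + a * σ ^ 2)) (4 * (a * (2 * s))) s := by
    simpa using ((((hasDerivAt_id s).pow 2).const_mul a).const_add 1).const_mul 4
  have h3 := (h1.norm_sq.neg.div h2 (by simpa using ht)).exp
  refine h3.congr_deriv ?_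
  simp only [inner_neg_right, gauss, Pi.div_apply, Pi.neg_apply]
  rw [mul_comm]
  congr 1
  field_simp
  ring

end

/-! ### Monotonicity, strictness and the uniform gap -/

section

variable {n : ℕ} {S : Set (Ambient n)}

/-- Scales along the path `s ↦ 1 + a s²` stay between positive bounds. -/
theorem path_scale_mem {a s : ℝ} (hs : s ∈ Icc (0 : ℝ) 1) :
    min 1 (1 + a) ≤ 1 + a * s ^ 2 ∧ 1 + a * s ^ 2 ≤ 1 + |a| := by
  have h0 : 0 ≤ s ^ 2 := sq_nonneg s
  have h1 : s ^ 2 ≤ 1 := pow_le_one₀ hs.1 hs.2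
  constructor
  · rcases le_total 0 a with h | h
    · exact (min_le_left _ _).trans (by nlinarith)
    · exact (min_le_right _ _).trans (by nlinarith)
  · nlinarith [le_abs_self a, abs_nonneg a]

theorem path_scale_pos {a s : ℝ} (ha : -1 < a) (hs : s ∈ Icc (0 : ℝ) 1) : 0 < 1 + a * s ^ 2 :=
  (lt_min one_pos (by linarith : 0 < 1 + a)).trans_le (path_scale_mem (a := a) hs).1

/-- The bound is uniform in `s`, as domination under the integral sign requires; the quadratic
growth is absorbed by the Gaussian. -/
theorem abs_path_deriv_le (x y : Ambient n) {a s t τ : ℝ} (hs : s ∈ Icc (0 : ℝ) 1) (hτ : 0 < τ)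
    (hτt : τ ≤ t) :
    |inner ℝ (x - s • y) y / (2 * t) + ‖x - s • y‖ ^ 2 * (a * s) / (2 * t ^ 2)| ≤
      (1 / (2 * τ) + |a| / (2 * τ ^ 2)) * (1 + ‖y‖) ^ 2 * (1 + ‖x‖) ^ 2 := by
  have ht : 0 < t := hτ.trans_le hτt
  have h1 : ‖x - s • y‖ ≤ (1 + ‖y‖) * (1 + ‖x‖) := by
    refine (norm_sub_le _ _).trans ?_
    rw [norm_smul, Real.norm_of_nonneg hs.1]
    nlinarith [norm_nonneg x, norm_nonneg y, hs.2, hs.1, mul_nonneg (norm_nonneg x) (norm_nonneg y)]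
  have h2 : ‖y‖ ≤ (1 + ‖y‖) * (1 + ‖x‖) := by
    nlinarith [norm_nonneg x, norm_nonneg y, mul_nonneg (norm_nonneg x) (norm_nonneg y)]
  set Q := (1 + ‖y‖) * (1 + ‖x‖) with hQ
  have hQ0 : 0 ≤ Q := by positivity
  have h3 : |inner ℝ (x - s • y) y / (2 * t)| ≤ Q ^ 2 / (2 * τ) := by
    rw [abs_div, abs_of_pos (show 0 < 2 * t by positivity)]
    have := (abs_real_inner_le_norm (x - s • y) y).trans
      (mul_le_mul h1 h2 (norm_nonneg _) hQ0)
    rw [← sq] at this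
    gcongr
  have h4 : |‖x - s • y‖ ^ 2 * (a * s) / (2 * t ^ 2)| ≤ Q ^ 2 * |a| / (2 * τ ^ 2) := by
    rw [abs_div, abs_mul, abs_mul, abs_of_pos (show 0 < 2 * t ^ 2 by positivity),
      abs_of_nonneg (sq_nonneg ‖x - s • y‖), abs_of_nonneg hs.1]
    have : |a| * s ≤ |a| := mul_le_of_le_one_right (abs_nonneg a) hs.2
    have h0 : 0 ≤ |a| * s := mul_nonneg (abs_nonneg a) hs.1
    gcongr
  refine (abs_add_le _ _).trans ((add_le_add h3 h4).trans_eq ?_)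
  rw [hQ]
  field_simp

/-- The derivative of Gaussian integrals along the paths `s ↦ (s y, 1 + a s²)`. -/
theorem hasDerivAt_integral_gauss_path (hg : HasPolynomialVolumeGrowth S) (y : Ambient n) {a s : ℝ}
    (ha : -1 < a) (hs : s ∈ Ioo (0 : ℝ) 1) :
    Integrable (fun x => (inner ℝ (x - s • y) y / (2 * (1 + a * s ^ 2)) +
      ‖x - s • y‖ ^ 2 * (a * s) / (2 * (1 + a * s ^ 2) ^ 2)) * gauss (s • y) (1 + a * s ^ 2) x)
      (areaMeasure S) ∧
    HasDerivAt (fun σ : ℝ => ∫ x, gauss (σ • y) (1 + a * σ ^ 2) x ∂(areaMeasure S))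
      (∫ x, (inner ℝ (x - s • y) y / (2 * (1 + a * s ^ 2)) +
      ‖x - s • y‖ ^ 2 * (a * s) / (2 * (1 + a * s ^ 2) ^ 2)) * gauss (s • y) (1 + a * s ^ 2) x
      ∂(areaMeasure S)) s := by
  set τ := min 1 (1 + a) with hτdef
  have hτ : 0 < τ := lt_min one_pos (by linarith)
  have hT : 0 < 1 + |a| := by positivity
  refine hasDerivAt_integral_of_dominated_loc_of_deriv_le (𝕜 := ℝ)
    (F := fun σ x => gauss (σ • y) (1 + a * σ ^ 2) x)
    (F' := fun σ x => (inner ℝ (x - σ • y) y / (2 * (1 + a * σ ^ 2)) +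
      ‖x - σ • y‖ ^ 2 * (a * σ) / (2 * (1 + a * σ ^ 2) ^ 2)) * gauss (σ • y) (1 + a * σ ^ 2) x)
    (bound := fun x => ((1 / (2 * τ) + |a| / (2 * τ ^ 2)) * (1 + ‖y‖) ^ 2 *
      Real.exp (‖y‖ ^ 2 / (4 * τ))) * ((1 + ‖x‖) ^ 2 *
        Real.exp (-(1 / (8 * (1 + |a|))) * ‖x‖ ^ 2)))
    (Ioo_mem_nhds hs.1 hs.2)
    (Eventually.of_forall fun σ => (continuous_gauss _ _).aestronglyMeasurable)
    (integrable_gauss hg _ (path_scale_pos ha (Ioo_subset_Icc_self hs))) ?_ ?_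
    ((integrable_one_add_sq_mul_exp hg (by positivity)).const_mul _) ?_
  · have := continuous_gauss (s • y) (1 + a * s ^ 2)
    exact Continuous.aestronglyMeasurable (by fun_prop)
  · refine Eventually.of_forall fun x σ hσ => ?_
    have hσ' := Ioo_subset_Icc_self hσ
    obtain ⟨h1, h2⟩ := path_scale_mem (a := a) hσ'
    rw [norm_mul, Real.norm_eq_abs, Real.norm_of_nonneg (gauss_pos _ _ x).le]
    have h3 : ‖σ • y‖ ≤ ‖y‖ := by
      rw [norm_smul, Real.norm_of_nonneg hσ'.1]
      exact mul_le_of_le_one_left (norm_nonneg y) hσ'.2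
    refine (mul_le_mul (abs_path_deriv_le x y hσ' hτ h1) (gauss_le h3 hτ h1 h2 x)
      (gauss_pos _ _ x).le (by positivity)).trans_eq ?_
    ring
  · exact Eventually.of_forall fun x σ hσ =>
      hasDerivAt_gauss_path x y (path_scale_pos ha (Ioo_subset_Icc_self hσ)).ne'

/-- The normal part of an affine field has square integrable Gaussian weight. -/
theorem integrable_sq_inner_normal_mul_gauss (hS : IsEmbeddedHypersurface S)
    (hg : HasPolynomialVolumeGrowth S) (b y : Ambient n) {t : ℝ} (ht : 0 < t) (a : ℝ) :
    Integrable (fun x => (inner ℝ (y + a • x) (normal S x)) ^ 2 * gauss b t x)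
      (areaMeasure S) := by
  have hcont : ContinuousOn (fun x => (inner ℝ (y + a • x) (normal S x) : ℝ) ^ 2 * gauss b t x) S := by
    have h := continuous_gauss b t
    refine continuousOn_normal hS
      (Q := fun x N => (inner ℝ (y + a • x) N : ℝ) ^ 2 * gauss b t x) ?_ (fun x N => by simp)
    simp only [Function.uncurry_def]
    fun_prop
  refine integrable_of_le_gauss hg (b := b) (K := (‖y‖ + |a|) ^ 2)
    (hcont.aestronglyMeasurable hS.measurableSet) ht (by positivity) ?_
  filter_upwards [ae_restrict_mem (μ := μHE[n]) hS.measurableSet] with x hx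
  rw [norm_mul, norm_pow, Real.norm_eq_abs, Real.norm_of_nonneg (gauss_pos b t x).le, ← mul_pow]
  have h1 : |(inner ℝ (y + a • x) (normal S x) : ℝ)| ≤ (‖y‖ + |a|) * (1 + ‖x‖) := by
    refine (abs_real_inner_le_norm _ _).trans ?_
    rw [norm_normal hS hx, mul_one]
    refine (norm_add_le _ _).trans ?_
    rw [norm_smul, Real.norm_eq_abs]
    nlinarith [norm_nonneg x, norm_nonneg y, abs_nonneg a, mul_nonneg (norm_nonneg x) (norm_nonneg y)]
  exact mul_le_mul_of_nonneg_right (pow_le_pow_left₀ (abs_nonneg _) h1 2) (gauss_pos b t x).le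

theorem integrable_gaussField (hg : HasPolynomialVolumeGrowth S) (b y : Ambient n) {t : ℝ}
    (ht : 0 < t) (α : ℝ) : Integrable (gaussField b y t α) (areaMeasure S) := by
  refine integrable_of_le_gauss hg (b := b) (K := |α| * (1 + ‖b‖) + ‖y‖)
    (contDiff_gaussField b y t α).continuous.aestronglyMeasurable ht (by positivity)
    (Eventually.of_forall fun x => ?_)
  rw [gaussField, norm_smul, Real.norm_of_nonneg (gauss_pos b t x).le, mul_comm]
  refine mul_le_mul_of_nonneg_right ?_ (gauss_pos b t x).le
  have h1 : ‖α • (x - b) + y‖ ≤ |α| * (‖x‖ + ‖b‖) + ‖y‖ := by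
    refine (norm_add_le _ _).trans (add_le_add_left ?_ _)
    rw [norm_smul, Real.norm_eq_abs]
    exact mul_le_mul_of_nonneg_left (norm_sub_le _ _) (abs_nonneg α)
  have hX : 1 + ‖x‖ ≤ (1 + ‖x‖) ^ 2 := by nlinarith [norm_nonneg x]
  have h2 : ‖x‖ + ‖b‖ ≤ (1 + ‖b‖) * (1 + ‖x‖) := by
    nlinarith [norm_nonneg x, norm_nonneg b, mul_nonneg (norm_nonneg x) (norm_nonneg b)]
  calc ‖α • (x - b) + y‖ ≤ |α| * (‖x‖ + ‖b‖) + ‖y‖ := h1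
    _ ≤ |α| * ((1 + ‖b‖) * (1 + ‖x‖)) + ‖y‖ * (1 + ‖x‖) := by
        refine add_le_add (mul_le_mul_of_nonneg_left h2 (abs_nonneg α)) ?_
        exact le_mul_of_one_le_right (norm_nonneg y) (by linarith [norm_nonneg x])
    _ = (|α| * (1 + ‖b‖) + ‖y‖) * (1 + ‖x‖) := by ring
    _ ≤ (|α| * (1 + ‖b‖) + ‖y‖) * (1 + ‖x‖) ^ 2 := mul_le_mul_of_nonneg_left hX (by positivity)

theorem integral_mul_sub_add_mul {X : Type*} [MeasurableSpace X] {μ : Measure X} {f g h : X → ℝ}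
    (hf : Integrable f μ) (hg : Integrable g μ) (hh : Integrable h μ) {c k : ℝ} :
    ∫ x, (c * f x - g x + k * h x) ∂μ = c * (∫ x, f x ∂μ) - (∫ x, g x ∂μ) + k * ∫ x, h x ∂μ := by
  have h1 : Integrable (fun x => c * f x - g x) μ := (hf.const_mul c).sub hg
  rw [integral_add h1 (hh.const_mul k), integral_sub (hf.const_mul c) hg, integral_const_mul,
    integral_const_mul]

/-- The monotonicity formula for the Gaussian functional of a complete self-shrinker along the
paths `s ↦ (s y, 1 + a s²)`. -/
theorem hasDerivAt_gaussianReal_path (hS : IsSelfShrinker S) (hc : IsIntrinsicallyComplete S)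
    (hg : HasPolynomialVolumeGrowth S) (y : Ambient n) {a s : ℝ} (ha : -1 < a)
    (hs : s ∈ Ioo (0 : ℝ) 1) :
    HasDerivAt (fun σ : ℝ => gaussianReal S (σ • y) (1 + a * σ ^ 2))
      (-((4 * Real.pi * (1 + a * s ^ 2)) ^ (-(n : ℝ) / 2) * (s / (2 * (1 + a * s ^ 2) ^ 2)) *
        ∫ x, (inner ℝ (y + (a * s) • x) (normal S x)) ^ 2 * gauss (s • y) (1 + a * s ^ 2) x
          ∂(areaMeasure S))) s := by
  have hemb := hS.isEmbeddedHypersurface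
  have ht : 0 < 1 + a * s ^ 2 := path_scale_pos ha (Ioo_subset_Icc_self hs)
  obtain ⟨hDi, hD⟩ := hasDerivAt_integral_gauss_path hg y ha hs
  have hPi := integrable_gauss hg (s • y) ht
  have hEi := integrable_sq_inner_normal_mul_gauss hemb hg (s • y) y ht (a * s)
  have hae : ∀ᵐ x ∂(areaMeasure S), x ∈ S := ae_restrict_mem hemb.measurableSet
  set α := a * s / (1 + a * s ^ 2) with hα
  -- Solving the pointwise identity for the divergence also yields its integrability, since the
  -- other three terms are already known to be integrable.
  have hid : ∀ᵐ x ∂(areaMeasure S), shrinkerDiv S (gaussField (s • y) y (1 + a * s ^ 2) α) x =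
      -(s / (2 * (1 + a * s ^ 2) ^ 2)) *
      ((inner ℝ (y + (a * s) • x) (normal S x)) ^ 2 * gauss (s • y) (1 + a * s ^ 2) x) -
      (inner ℝ (x - s • y) y / (2 * (1 + a * s ^ 2)) +
      ‖x - s • y‖ ^ 2 * (a * s) / (2 * (1 + a * s ^ 2) ^ 2)) * gauss (s • y) (1 + a * s ^ 2) x +
      n * α * gauss (s • y) (1 + a * s ^ 2) x := by
    filter_upwards [hae] with x hx
    have := shrinkerDiv_gaussField hemb (y := y) hx ht.ne'
    rw [← hα] at this
    linarith
  have hI := ((hEi.const_mul (-(s / (2 * (1 + a * s ^ 2) ^ 2)))).sub hDi).add (hPi.const_mul (n * α))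
  have hzero := integral_shrinkerDiv_eq_zero hS hc hg
    (contDiff_gaussField (s • y) y (1 + a * s ^ 2) α)
    (integrable_gaussField hg _ y ht α) (hI.congr (hid.mono fun x hx => hx.symm))
  rw [integral_congr_ae hid] at hzero
  rw [integral_mul_sub_add_mul hEi hDi hPi] at hzero
  -- The derivative of the prefactor contributes exactly the term `-n α` of the pointwise identity.
  have hpre : HasDerivAt (fun σ : ℝ => (4 * Real.pi * (1 + a * σ ^ 2)) ^ (-(n : ℝ) / 2))
      (-(n * α) * (4 * Real.pi * (1 + a * s ^ 2)) ^ (-(n : ℝ) / 2)) s := by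
    have h1 : HasDerivAt (fun σ : ℝ => 4 * Real.pi * (1 + a * σ ^ 2))
        (4 * Real.pi * (a * (2 * s))) s := by
      simpa using ((((hasDerivAt_id s).pow 2).const_mul a).const_add 1).const_mul (4 * Real.pi)
    have hb : 0 < 4 * Real.pi * (1 + a * s ^ 2) := by positivity
    refine (h1.rpow_const (p := -(n : ℝ) / 2) (Or.inl hb.ne')).congr_deriv ?_
    rw [Real.rpow_sub_one hb.ne', hα]
    have := Real.pi_pos
    field_simp
  refine (hpre.mul hD).congr_deriv ?_
  linear_combination (4 * Real.pi * (1 + a * s ^ 2)) ^ (-(n : ℝ) / 2) * (-hzero)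

/-- The square is even in the normal, hence continuous along `S` although `normal` is not. It is
therefore nonzero on a relatively open set, which has positive area. -/
theorem integral_sq_inner_normal_mul_gauss_pos (hS : IsEmbeddedHypersurface S)
    (hg : HasPolynomialVolumeGrowth S) (b y : Ambient n) {t : ℝ} (ht : 0 < t) (a : ℝ)
    (hne : ∃ x ∈ S, inner ℝ (y + a • x) (normal S x) ≠ (0 : ℝ)) :
    0 < ∫ x, (inner ℝ (y + a • x) (normal S x)) ^ 2 * gauss b t x ∂(areaMeasure S) := by
  obtain ⟨p, hp, hpn⟩ := hne
  rw [integral_pos_iff_support_of_nonneg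
    (fun x => mul_nonneg (sq_nonneg _) (gauss_pos b t x).le)
    (integrable_sq_inner_normal_mul_gauss hS hg b y ht a)]
  have hcont : ContinuousOn (fun x => (inner ℝ (y + a • x) (normal S x) : ℝ) ^ 2) S := by
    refine continuousOn_normal hS
      (Q := fun x N => (inner ℝ (y + a • x) N : ℝ) ^ 2) ?_ (fun x N => by simp)
    simp only [Function.uncurry_def]
    fun_prop
  have hnear : {x | (inner ℝ (y + a • x) (normal S x) : ℝ) ^ 2 ≠ 0} ∈ 𝓝[S] p :=
    (hcont p hp).eventually_ne (pow_ne_zero 2 hpn)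
  obtain ⟨V, hV, hpV, hVS⟩ := mem_nhdsWithin.1 hnear
  obtain ⟨c⟩ := hS.nonempty_graphChart hp
  refine (c.areaMeasure_pos hV hpV).trans_le ?_
  have h1 : areaMeasure S V = areaMeasure S (V ∩ S) := by
    simp only [areaMeasure]
    rw [Measure.restrict_apply hV.measurableSet,
      Measure.restrict_apply (hV.measurableSet.inter hS.measurableSet), inter_assoc, inter_self]
  rw [h1]
  exact measure_mono fun x hx => mul_ne_zero (hVS hx) (gauss_pos b t x).ne'

/-- The Gaussian functional of a complete self-shrinker that does not split off a line decreases
strictly along the paths `s ↦ (s y, 1 + a s²)`. -/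
theorem strictAntiOn_gaussianReal_path (hn : 1 ≤ n) (hS : IsSelfShrinker S)
    (hc : IsIntrinsicallyComplete S) (hg : HasPolynomialVolumeGrowth S) (hne : S.Nonempty)
    (hline : ¬ SplitsOffLine S) {y : Ambient n} {a : ℝ} (ha : -1 < a) (hya : y ≠ 0 ∨ a ≠ 0) :
    StrictAntiOn (fun σ : ℝ => gaussianReal S (σ • y) (1 + a * σ ^ 2)) (Icc 0 1) := by
  -- Only the open interval needs a negative derivative; at `s = 0` the factor `s` in the formula
  -- vanishes, and continuity takes care of the ends.
  refine strictAntiOn_of_deriv_neg (convex_Icc 0 1) (fun s hs => ?_) fun s hs => ?_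
  · refine ContinuousAt.continuousWithinAt ?_
    exact (continuousAt_gaussianReal hg (s • y) (path_scale_pos ha hs)).comp
      (f := fun σ : ℝ => (σ • y, 1 + a * σ ^ 2)) (by fun_prop)
  · rw [interior_Icc] at hs
    have ht : 0 < 1 + a * s ^ 2 := path_scale_pos ha (Ioo_subset_Icc_self hs)
    rw [(hasDerivAt_gaussianReal_path hS hc hg y ha hs).deriv, neg_lt_zero]
    have hs0 := hs.1
    refine mul_pos (by positivity) (integral_sq_inner_normal_mul_gauss_pos
      hS.isEmbeddedHypersurface hg _ y ht _ ?_)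
    by_contra! h
    exact hline (splitsOffLine_of_tangent hn hS.isEmbeddedHypersurface hc hne
      (hya.imp_right fun h => mul_ne_zero h hs0.ne') h)

/-- The path with `y = b` and `a = t - 1` joins `(0, 1)` to `(b, t)`, and `t > 0` is the condition
`-1 < a`. -/
theorem gaussianReal_lt (hn : 1 ≤ n) (hS : IsSelfShrinker S)
    (hc : IsIntrinsicallyComplete S) (hg : HasPolynomialVolumeGrowth S) (hne : S.Nonempty)
    (hline : ¬ SplitsOffLine S) {b : Ambient n} {t : ℝ} (ht : 0 < t) (hbt : (b, t) ≠ (0, 1)) :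
    gaussianReal S b t < gaussianReal S 0 1 := by
  have hya : b ≠ 0 ∨ t - 1 ≠ 0 := by
    by_contra! h
    exact hbt (Prod.ext h.1 (by linarith [h.2]))
  have h := strictAntiOn_gaussianReal_path hn hS hc hg hne hline (by linarith : -1 < t - 1) hya
    (left_mem_Icc.2 zero_le_one) (right_mem_Icc.2 zero_le_one) one_pos
  simpa using h

/-- Away from `(0, 1)` the Gaussian functional is bounded away from its maximum. -/
theorem exists_gaussianReal_le (hn : 1 ≤ n) (hS : IsSelfShrinker S)
    (hc : IsIntrinsicallyComplete S) (hg : HasPolynomialVolumeGrowth S) (hne : S.Nonempty)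
    (hline : ¬ SplitsOffLine S) {ε : ℝ} (hε : 0 < ε) :
    ∃ M : ℝ, 0 ≤ M ∧ M < gaussianReal S 0 1 ∧ ∀ (b : Ambient n) (t : ℝ), 0 < t →
      ε < ‖b‖ + |Real.log t| → gaussianReal S b t ≤ M := by
  -- For positive scales the interval condition follows from the equation. It is imposed because
  -- `Real.log` also takes values at nonpositive arguments, and it keeps `K` compact and inside `t >
  -- 0`.
  set K : Set (Ambient n × ℝ) := {q | q.2 ∈ Icc (Real.exp (-ε)) (Real.exp ε) ∧
    ‖q.1‖ + |Real.log q.2| = ε} with hK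
  have hKpos : ∀ q ∈ K, 0 < q.2 := fun q hq => (Real.exp_pos _).trans_le hq.1.1
  have hKc : IsCompact K := by
    have h1 : IsCompact (Metric.closedBall (0 : Ambient n) ε ×ˢ Icc (Real.exp (-ε)) (Real.exp ε)) :=
      (isCompact_closedBall 0 ε).prod isCompact_Icc
    have h2 : ContinuousOn (fun q : Ambient n × ℝ => ‖q.1‖ + |Real.log q.2|)
        (Metric.closedBall (0 : Ambient n) ε ×ˢ Icc (Real.exp (-ε)) (Real.exp ε)) := by
      refine continuous_fst.norm.continuousOn.add (ContinuousOn.abs ?_)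
      exact ContinuousOn.log continuous_snd.continuousOn
        fun q hq => ((Real.exp_pos _).trans_le hq.2.1).ne'
    have h3 : K = (Metric.closedBall (0 : Ambient n) ε ×ˢ Icc (Real.exp (-ε)) (Real.exp ε)) ∩
        (fun q : Ambient n × ℝ => ‖q.1‖ + |Real.log q.2|) ⁻¹' {ε} := by
      ext q
      simp only [hK, mem_ofPred_eq, mem_inter_iff, mem_prod, mem_closedBall_zero_iff, mem_preimage,
        mem_singleton_iff]
      constructor
      · rintro ⟨h, h'⟩
        exact ⟨⟨by linarith [abs_nonneg (Real.log q.2)], h⟩, h'⟩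
      · rintro ⟨⟨-, h⟩, h'⟩
        exact ⟨h, h'⟩
    rw [h3]
    exact h1.of_isClosed_subset (h2.preimage_isClosed_of_isClosed h1.isClosed isClosed_singleton)
      inter_subset_left
  have hKne : K.Nonempty := ⟨(0, Real.exp ε), ⟨by simp [hε.le], le_rfl⟩, by simp [abs_of_pos hε]⟩
  have hKcont : ContinuousOn (fun q : Ambient n × ℝ => gaussianReal S q.1 q.2) K := fun q hq =>
    (continuousAt_gaussianReal hg q.1 (hKpos q hq)).continuousWithinAt
  obtain ⟨q, hq, hmax⟩ := hKc.exists_isMaxOn hKne hKcont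
  have hK1 : ∀ q ∈ K, q ≠ (0, 1) := by
    rintro q hq rfl
    have := hq.2
    simp at this
    linarith
  refine ⟨gaussianReal S q.1 q.2, gaussianReal_nonneg _ (hKpos q hq),
    gaussianReal_lt hn hS hc hg hne hline (hKpos q hq) (hK1 q hq), fun b t ht hbt => ?_⟩
  have ha : -1 < t - 1 := by linarith
  have hya : b ≠ 0 ∨ t - 1 ≠ 0 := by
    by_contra! h
    rw [h.1, show t = 1 by linarith [h.2]] at hbt
    simp at hbt
    linarith
  have hcont : ContinuousOn (fun σ : ℝ => ‖σ • b‖ + |Real.log (1 + (t - 1) * σ ^ 2)|) (Icc 0 1) := by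
    refine ContinuousOn.add (by fun_prop) (ContinuousOn.abs ?_)
    exact ContinuousOn.log (by fun_prop) fun σ hσ => (path_scale_pos ha hσ).ne'
  -- The quantity is `0` at the start of the path and exceeds `ε` at its end, so the path meets `K`.
  obtain ⟨σ, hσ, hσε⟩ := intermediate_value_Icc zero_le_one hcont
    (show ε ∈ Icc _ _ from ⟨by simp [hε.le], by simpa using hbt.le⟩)
  have hpos := path_scale_pos ha hσ
  have hmem : (σ • b, 1 + (t - 1) * σ ^ 2) ∈ K := by
    have h1 : |Real.log (1 + (t - 1) * σ ^ 2)| ≤ ε := by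
      linarith [norm_nonneg (σ • b), hσε]
    obtain ⟨h2, h3⟩ := abs_le.1 h1
    exact ⟨⟨(Real.le_log_iff_exp_le hpos).1 h2, (Real.log_le_iff_le_exp hpos).1 h3⟩, hσε⟩
  have h := (strictAntiOn_gaussianReal_path hn hS hc hg hne hline ha hya).antitoneOn
    hσ (right_mem_Icc.2 zero_le_one) hσ.2
  simp only [one_smul, one_pow, mul_one, add_sub_cancel] at h
  exact h.trans (hmax hmem)

end

end SelfShrinker

end

/-! ### Translation of the real-valued results to `ℝ≥0∞` -/

theorem lemmal (n : ℕ) (hn : 1 ≤ n) (S : Set (SelfShrinker.Ambient n)) (hne : S.Nonempty)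
    (hshrink : SelfShrinker.IsSelfShrinker S)
    (hcomplete : SelfShrinker.IsIntrinsicallyComplete S)
    (hgrowth : SelfShrinker.HasPolynomialVolumeGrowth S)
    (hline : ¬ SelfShrinker.SplitsOffLine S) :
    SelfShrinker.entropy S < ⊤ ∧
    SelfShrinker.entropy S = SelfShrinker.gaussianF S 0 1 ∧
    (∀ (x₀ : SelfShrinker.Ambient n) (t₀ : ℝ), 0 < t₀ → (x₀, t₀) ≠ (0, 1) →
      SelfShrinker.gaussianF S x₀ t₀ < SelfShrinker.gaussianF S 0 1) ∧
    ∀ ε : ℝ, 0 < ε → ∃ δ : ℝ, 0 < δ ∧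
      (⨆ (x₀ : SelfShrinker.Ambient n) (t₀ : ℝ) (_ : 0 < t₀) (_ : ε < ‖x₀‖ + |Real.log t₀|),
        SelfShrinker.gaussianF S x₀ t₀) < SelfShrinker.entropy S - ENNReal.ofReal δ := by
  have hlt : ∀ (x₀ : SelfShrinker.Ambient n) (t₀ : ℝ), 0 < t₀ → (x₀, t₀) ≠ (0, 1) →
      SelfShrinker.gaussianF S x₀ t₀ < SelfShrinker.gaussianF S 0 1 := by
    intro x₀ t₀ ht h
    rw [SelfShrinker.gaussianF_eq_ofReal hgrowth x₀ ht,
      SelfShrinker.gaussianF_eq_ofReal hgrowth 0 one_pos]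
    exact (ENNReal.ofReal_lt_ofReal_iff_of_nonneg (SelfShrinker.gaussianReal_nonneg x₀ ht)).2
      (SelfShrinker.gaussianReal_lt hn hshrink hcomplete hgrowth hne hline ht h)
  have hent : SelfShrinker.entropy S = SelfShrinker.gaussianF S 0 1 := by
    refine le_antisymm (iSup_le fun x₀ => iSup_le fun t₀ => iSup_le fun ht => ?_)
      (le_iSup_of_le 0 (le_iSup_of_le 1 (le_iSup_of_le one_pos le_rfl)))
    by_cases h : (x₀, t₀) = (0, 1)
    · obtain ⟨rfl, rfl⟩ := Prod.mk.inj h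
      exact le_rfl
    · exact (hlt x₀ t₀ ht h).le
  have hF := SelfShrinker.gaussianF_eq_ofReal hgrowth 0 one_pos
  refine ⟨by rw [hent, hF]; exact ENNReal.ofReal_lt_top, hent, hlt, fun ε hε => ?_⟩
  obtain ⟨M, hM0, hM, hle⟩ :=
    SelfShrinker.exists_gaussianReal_le hn hshrink hcomplete hgrowth hne hline hε
  -- Half of the gap leaves `M < F_{0,1} - δ` strict, as the strict bound on the supremum requires.
  refine ⟨(SelfShrinker.gaussianReal S 0 1 - M) / 2, by linarith, ?_⟩
  rw [hent, hF, ← ENNReal.ofReal_sub _ (by linarith)]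
  refine lt_of_le_of_lt (b := ENNReal.ofReal M) ?_
    ((ENNReal.ofReal_lt_ofReal_iff_of_nonneg hM0).2 (by linarith))
  refine iSup_le fun x₀ => iSup_le fun t₀ => iSup_le fun ht => iSup_le fun h => ?_
  rw [SelfShrinker.gaussianF_eq_ofReal hgrowth x₀ ht]
  exact ENNReal.ofReal_le_ofReal (hle x₀ t₀ ht h)
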